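/- \textbf{Theorem.} $\mathsf{RCA}_0$ proves the following: if a quasi order $Q$ is a better quasi order ($\mathsf{BQO}$), then so is $H_f(Q)$. In other words, the following holds in every model $(M,\mathcal S)$ of $\mathsf{RCA}_0$ (whose first-order part $M$ may be nonstandard): for any quasi order $(Q,\leq_Q)$ in $\mathcal S$, the collection $H_f(Q)$ and its order exist in $\mathcal S$, and if $Q$ is $\mathsf{BQO}$, then $H_f(Q)$ is $\mathsf{BQO}$. All notions are read inside the model. Here the set $H_f(Q)$ of hereditarily finite sets with urelements from $Q$ is generated by the following clauses: $\langle 0,q\rangle\in H_f(Q)$ for each $q\in Q$, and $\langle 1,a\rangle\in H_f(Q)$ for each finite $a\subseteq H_f(Q)$ (finite sets and pairs being coded by numbers as usual). Its order is recursively given by \begin{align*} \langle 0,p\rangle\leq\langle 0,q\rangle&\iff p\leq_Q q,\\ \langle 0,p\rangle\leq\langle 1,b\rangle&\iff \langle 0,p\rangle\leq y\text{ for some }y\in b,\\ \langle 1,a\rangle\leq\langle 0,q\rangle&\iff x\leq\langle 0,q\rangle\text{ for all }x\in a,\\ \langle 1,a\rangle\leq\langle 1,b\rangle&\iff \text{for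 each }x\in a\text{ there is }y\in b\text{ with }x\leq y. \end{align*} A \emph{barrier} is a set $B$ of finite subsets of $\mathbb N$ such that $\bigcup B$ is infinite, each infinite $X\subseteq\bigcup B$ has an initial segment in $B$, and no element of $B$ is a proper subset of another one. For finite $s,t\subseteq\mathbb N$ we write $s\vartriangleleft t$ if there is a finite nonempty $u\subseteq\mathbb N$ such that $s$ is an initial segment of $u$ and $t$ is an initial segment of $u\setminus\{\min u\}$. A quasi order $Q$ is $\mathsf{BQO}$ if for every function $f:B\to Q$ on a barrier $B$ there are $s,t\in B$ with $s\vartriangleleft t$ and $f(s)\leq_Q f(t)$. -/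

import Mathlib

/-!
Second-order arithmetic. A structure for the language of second-order arithmetic is a type `M`
(the first-order part) with `0, 1, +, *, <`, together with a family `S : Set (Set M)` of subsets
of `M` (the second-order part). The first-order part need not be the standard natural numbers, and
all set quantifiers range over `S`. A sentence is provable in `RCA_0` if and only if it holds in
all structures that satisfy the axioms of `RCA_0`.
-/

namespace RM

section

universe u

/-- Terms with `n` number variables and with parameters from `M` (`0` and `1` among them). -/
inductive Tm (M : Type u) (n : ℕ) : Type u
  | var (i : Fin n) : Tm M n
  | param (a : M) : Tm M n
  | add (t t' : Tm M n) : Tm M n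
  | mul (t t' : Tm M n) : Tm M n

/-- The value of a term under an assignment of its variables. -/
def Tm.val {M : Type u} [Add M] [Mul M] {n : ℕ} : Tm M n → (Fin n → M) → M
  | .var i, v => v i
  | .param a, _ => a
  | .add t t', v => t.val v + t'.val v
  | .mul t t', v => t.val v * t'.val v

/-- The `Σ⁰₀` formulas (all quantifiers are bounded number quantifiers) with `n` free number
variables and with number parameters from `M` and set parameters from `S`. The new variable of
`ball t φ`, that is of `∀ x < t, φ`, is the variable `0` of `φ` and does not occur in `t`. The
other connectives and `∃ x < t` are the usual classical abbreviations. -/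
inductive Sigma00 (M : Type u) (S : Set (Set M)) : ℕ → Type u
  | eq {n : ℕ} (t t' : Tm M n) : Sigma00 M S n
  | lt {n : ℕ} (t t' : Tm M n) : Sigma00 M S n
  | mem {n : ℕ} (t : Tm M n) (X : S) : Sigma00 M S n
  | not {n : ℕ} (φ : Sigma00 M S n) : Sigma00 M S n
  | and {n : ℕ} (φ ψ : Sigma00 M S n) : Sigma00 M S n
  | ball {n : ℕ} (t : Tm M n) (φ : Sigma00 M S (n + 1)) : Sigma00 M S n

/-- Truth of a `Σ⁰₀` formula under an assignment of its variables. -/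
def Sigma00.Holds {M : Type u} [Add M] [Mul M] [LT M] {S : Set (Set M)} :
    {n : ℕ} → Sigma00 M S n → (Fin n → M) → Prop
  | _, .eq t t', v => t.val v = t'.val v
  | _, .lt t t', v => t.val v < t'.val v
  | _, .mem t X, v => t.val v ∈ X.1
  | _, .not φ, v => ¬ φ.Holds v
  | _, .and φ ψ, v => φ.Holds v ∧ ψ.Holds v
  | _, .ball t φ, v => ∀ x : M, x < t.val v → φ.Holds (Fin.cons x v)

/-- `(M, S)` is a model of `RCA_0`: the basic axioms, induction for `Σ⁰₁` formulas
`∃ m, φ(m, n)`, and `Δ⁰₁` comprehension. Parameters are allowed in both schemes. -/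
structure IsModelRCA0 (M : Type u) [Zero M] [One M] [Add M] [Mul M] [LT M]
    (S : Set (Set M)) : Prop where
  succ_ne_zero : ∀ n : M, n + 1 ≠ 0
  succ_inj : ∀ m n : M, m + 1 = n + 1 → m = n
  add_zero : ∀ m : M, m + 0 = m
  add_succ : ∀ m n : M, m + (n + 1) = (m + n) + 1
  mul_zero : ∀ m : M, m * 0 = 0
  mul_succ : ∀ m n : M, m * (n + 1) = m * n + m
  not_lt_zero : ∀ m : M, ¬ m < 0
  lt_succ_iff : ∀ m n : M, m < n + 1 ↔ m < n ∨ m = n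
  sigma01_induction : ∀ φ : Sigma00 M S 2,
    (∃ m : M, φ.Holds ![m, 0]) →
    (∀ n : M, (∃ m : M, φ.Holds ![m, n]) → ∃ m : M, φ.Holds ![m, n + 1]) →
    ∀ n : M, ∃ m : M, φ.Holds ![m, n]
  delta01_comprehension : ∀ φ ψ : Sigma00 M S 2,
    (∀ n : M, (∃ m : M, φ.Holds ![m, n]) ↔ ∀ m : M, ψ.Holds ![m, n]) →
    ∃ X ∈ S, ∀ n : M, n ∈ X ↔ ∃ m : M, φ.Holds ![m, n]

variable {M : Type u} [Zero M] [One M] [Add M] [Mul M] [LT M]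

/-- The usual code of an ordered pair in second-order arithmetic, `(x + y)² + x`. -/
def pair (x y : M) : M := (x + y) * (x + y) + x

/-- `x` is an element of the finite set with code `c`: we have `c = (k, (m, n))` with `x < k`, and
`m (x + 1) + 1` divides `n`. -/
def Elt (x c : M) : Prop :=
  ∃ k m n : M, c = pair k (pair m n) ∧ x < k ∧ ∃ q : M, n = q * (m * (x + 1) + 1)

/-- `c` is the code of a finite set, namely the least code among those with the same elements.
(Numbers that are not of the form `(k, (m, n))` have no elements and are excluded because
`0 = (0, (0, 0))` has no elements either.) So finite sets and their codes correspond one to one. A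
code is also identified with the increasing enumeration of the finite set. -/
def IsFin (c : M) : Prop := ∀ c' : M, c' < c → ¬ ∀ x : M, Elt x c' ↔ Elt x c

/-- The finite set `s` is a (not necessarily proper) initial segment of the set `X`. -/
def InitSeg (s : M) (X : Set M) : Prop :=
  (∀ x : M, Elt x s → x ∈ X) ∧ ∀ x y : M, Elt y s → x ∈ X → x < y → Elt x s

/-- `s ◁ t`: there is a finite nonempty set `u`, with least element `m`, such that `s` is an
initial segment of `u` and `t` is one of `u \ {m}`. -/
def Tri (s t : M) : Prop :=
  ∃ u m : M, IsFin u ∧ Elt m u ∧ (∀ x : M, Elt x u → x = m ∨ m < x) ∧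
    InitSeg s {x | Elt x u} ∧ InitSeg t {x | Elt x u ∧ x ≠ m}

/-- `X` is infinite (unbounded). -/
def IsInf (X : Set M) : Prop := ∀ n : M, ∃ x ∈ X, n < x

/-- The base of a set of (codes of) finite sets. -/
def base (B : Set M) : Set M := {n | ∃ s ∈ B, Elt n s}

/-- `B` is a barrier, in the sense of `(M, S)`: it is a set of finite sets with infinite base such
that any infinite subset of the base has an initial segment in `B`, and no element of `B` is a
proper subset of another. -/
structure IsBarrier (S : Set (Set M)) (B : Set M) : Prop where
  mem_sets : B ∈ S
  isFin : ∀ s ∈ B, IsFin s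
  inf_base : IsInf (base B)
  initSeg : ∀ X ∈ S, IsInf X → X ⊆ base B → ∃ s ∈ B, InitSeg s X
  antichain : ∀ s ∈ B, ∀ t ∈ B, (∀ x : M, Elt x s → Elt x t) → s = t

/-- `f` is (the graph of) a function from `B` to `Q`. -/
def IsFun (f B Q : Set M) : Prop :=
  (∀ z ∈ f, ∃ s ∈ B, ∃ q ∈ Q, z = pair s q) ∧ ∀ s ∈ B, ∃! q : M, pair s q ∈ f

/-- `(Q, R)` is a quasi order; here `p ≤ q` means that the code of `(p, q)` lies in `R`. -/
structure IsQuasiOrder (S : Set (Set M)) (Q R : Set M) : Prop where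
  carrier_mem_sets : Q ∈ S
  rel_mem_sets : R ∈ S
  rel_sub : ∀ z ∈ R, ∃ p ∈ Q, ∃ q ∈ Q, z = pair p q
  refl : ∀ p ∈ Q, pair p p ∈ R
  trans : ∀ p ∈ Q, ∀ q ∈ Q, ∀ r ∈ Q, pair p q ∈ R → pair q r ∈ R → pair p r ∈ R

/-- `(Q, R)` is a better quasi order, in the sense of `(M, S)`: it is a quasi order, and each array
`f : B → Q` on a barrier `B` admits `s ◁ t` in `B` with `f(s) ≤ f(t)`. -/
def IsBQO (S : Set (Set M)) (Q R : Set M) : Prop :=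
  IsQuasiOrder S Q R ∧
    ∀ B : Set M, IsBarrier S B → ∀ f ∈ S, IsFun f B Q →
      ∃ s ∈ B, ∃ t ∈ B, ∃ p q : M,
        Tri s t ∧ pair s p ∈ f ∧ pair t q ∈ f ∧ pair p q ∈ R

/-- `(H, L)` is the collection `H_f(Q)` of hereditarily finite sets with urelements in the quasi
order `(Q, R)`, with its order. Elements are `⟨0, q⟩` for `q ∈ Q` and `⟨1, a⟩` for finite
`a ⊆ H_f(Q)`. As `⟨1, a⟩` exceeds all elements of `a`, induction shows that the clauses determine
`H` and `L` uniquely. -/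
structure IsHf (S : Set (Set M)) (Q R H L : Set M) : Prop where
  carrier_mem_sets : H ∈ S
  rel_mem_sets : L ∈ S
  mem_iff : ∀ z : M, z ∈ H ↔
    (∃ q ∈ Q, z = pair 0 q) ∨ ∃ a : M, IsFin a ∧ (∀ x : M, Elt x a → x ∈ H) ∧ z = pair 1 a
  rel_sub : ∀ z ∈ L, ∃ x ∈ H, ∃ y ∈ H, z = pair x y
  ur_ur : ∀ p q : M, pair 0 p ∈ H → pair 0 q ∈ H →
    (pair (pair 0 p) (pair 0 q) ∈ L ↔ pair p q ∈ R)
  ur_set : ∀ p b : M, pair 0 p ∈ H → pair 1 b ∈ H →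
    (pair (pair 0 p) (pair 1 b) ∈ L ↔ ∃ y : M, Elt y b ∧ pair (pair 0 p) y ∈ L)
  set_ur : ∀ a q : M, pair 1 a ∈ H → pair 0 q ∈ H →
    (pair (pair 1 a) (pair 0 q) ∈ L ↔ ∀ x : M, Elt x a → pair x (pair 0 q) ∈ L)
  set_set : ∀ a b : M, pair 1 a ∈ H → pair 1 b ∈ H →
    (pair (pair 1 a) (pair 1 b) ∈ L ↔
      ∀ x : M, Elt x a → ∃ y : M, Elt y b ∧ pair x y ∈ L)

end

end RM

/-! Let `F` be a bad array from a barrier `B` to `H_f(Q)`; a bad array from another barrier to `Q`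
is derived from it. If `x ≰ y`, the clauses of the order give a reason one level down: let `ch (x,
y)` be `x` itself if `x` is an urelement, and otherwise an element of `x` that is not below `y` (for
an urelement `y`) or not below any element of `y` (for a set `y`). If moreover `y ≰ z`, then `ch (x,
y) ≰ ch (y, z)`, because `ch (y, z)` is either the urelement `y` or an element of the set `y`. So
applying `ch` to the values at neighbouring segments of a set turns a bad array into a bad array,
and this can be iterated. The iterates are collected in `IsTable`: `D (u, x, x)` is the value of `F`
on the segment of `u` that begins at `x`, and `D (u, x, w)` arises by `ch` from the entries in which
`w` is replaced by its predecessor or `x` by its successor. Badness persists by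
`IsTable.mem_and_bad`.

For fixed `x` the value `D (u, x, w)` descends through elements of elements as `w` grows. An element
has a smaller code than a set containing it, so the code of the first value bounds the number of
steps until an urelement is reached (`IsTable.ur_or_le`), and urelements are never changed again
(`IsTable.ur_stable`). This bound by codes replaces any use of ranks and keeps the argument within
`RCA_0`.

By `exists_height` there is a monotone `h` such that `h y₀` exceeds all values of `F` on elements of
`B` inside `[0, y₀]`. A set in `derived` continues its first segment, with end `y₀`, up to a `z`
with `h y₀` predecessors, and then to the end of the segment at `z`. These sets form a barrier
(`isBarrier_derived`); monotonicity of `h` yields the antichain condition. Each of them determines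
an urelement `D (t, x₀, z)` (`Derived.exists_ur`). If `t ◁ t'` inside `u`, both computations can be
continued in `u` up to the larger of the two places `z`. There the first urelement is the result of
applying `ch` against the second, hence not below it (`not_rel_of_tri`). This contradicts the
assumption that `Q` is a better quasi order.

All objects have to exist in the model. For this, `Comp` singles out the functions and relations
that belong to it. They are closed under composition, bounded quantification, search and
course-of-values recursion; the latter rests on the coding of finite sets by divisibility. -/

namespace RM

/-! ### Closure properties of `Σ⁰₀` definability -/

section Definability

variable {M : Type*} {S : Set (Set M)} {n : ℕ}

/-- `f` is the value of a term. -/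
def TmDef [Add M] [Mul M] (f : (Fin n → M) → M) : Prop :=
  ∃ t : Tm M n, ∀ v, t.val v = f v

/-- `P` is the truth set of a `Σ⁰₀` formula. -/
def Def0 [Add M] [Mul M] [LT M] (S : Set (Set M)) (P : (Fin n → M) → Prop) : Prop :=
  ∃ φ : Sigma00 M S n, ∀ v, φ.Holds v ↔ P v

variable [Add M] [Mul M]

theorem TmDef.var (i : Fin n) : TmDef (fun v : Fin n → M => v i) := ⟨.var i, fun _ => rfl⟩

theorem TmDef.param (a : M) : TmDef (fun _ : Fin n → M => a) := ⟨.param a, fun _ => rfl⟩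

theorem TmDef.add {f g : (Fin n → M) → M} (hf : TmDef f) (hg : TmDef g) :
    TmDef (fun v => f v + g v) := by
  obtain ⟨t, ht⟩ := hf
  obtain ⟨u, hu⟩ := hg
  exact ⟨.add t u, fun v => by simp [Tm.val, ht, hu]⟩

theorem TmDef.mul {f g : (Fin n → M) → M} (hf : TmDef f) (hg : TmDef g) :
    TmDef (fun v => f v * g v) := by
  obtain ⟨t, ht⟩ := hf
  obtain ⟨u, hu⟩ := hg
  exact ⟨.mul t u, fun v => by simp [Tm.val, ht, hu]⟩

theorem TmDef.pair {f g : (Fin n → M) → M} (hf : TmDef f) (hg : TmDef g) :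
    TmDef (fun v => RM.pair (f v) (g v)) :=
  ((hf.add hg).mul (hf.add hg)).add hf

variable [LT M] {f g : (Fin n → M) → M} {P R : (Fin n → M) → Prop}

theorem Def0.eq (hf : TmDef f) (hg : TmDef g) : Def0 S (fun v => f v = g v) := by
  obtain ⟨t, ht⟩ := hf
  obtain ⟨u, hu⟩ := hg
  exact ⟨.eq t u, fun v => by simp [Sigma00.Holds, ht, hu]⟩

theorem Def0.lt (hf : TmDef f) (hg : TmDef g) : Def0 S (fun v => f v < g v) := by
  obtain ⟨t, ht⟩ := hf
  obtain ⟨u, hu⟩ := hg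
  exact ⟨.lt t u, fun v => by simp [Sigma00.Holds, ht, hu]⟩

theorem Def0.mem {X : Set M} (hX : X ∈ S) (hf : TmDef f) : Def0 S (fun v => f v ∈ X) := by
  obtain ⟨t, ht⟩ := hf
  exact ⟨.mem t ⟨X, hX⟩, fun v => by simp [Sigma00.Holds, ht]⟩

theorem Def0.not (hP : Def0 S P) : Def0 S (fun v => ¬ P v) := by
  obtain ⟨φ, hφ⟩ := hP
  exact ⟨.not φ, fun v => by simp [Sigma00.Holds, hφ]⟩

theorem Def0.and (hP : Def0 S P) (hR : Def0 S R) : Def0 S (fun v => P v ∧ R v) := by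
  obtain ⟨φ, hφ⟩ := hP
  obtain ⟨ψ, hψ⟩ := hR
  exact ⟨.and φ ψ, fun v => by simp [Sigma00.Holds, hφ, hψ]⟩

theorem Def0.or (hP : Def0 S P) (hR : Def0 S R) : Def0 S (fun v => P v ∨ R v) := by
  have := (hP.not.and hR.not).not
  simpa only [not_and_or, not_not] using this

theorem Def0.ball {f : (Fin n → M) → M} {P : M → (Fin n → M) → Prop} (hf : TmDef f)
    (hP : Def0 S (fun v : Fin (n + 1) → M => P (v 0) (Fin.tail v))) :
    Def0 S (fun v => ∀ x < f v, P x v) := by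
  obtain ⟨t, ht⟩ := hf
  obtain ⟨φ, hφ⟩ := hP
  exact ⟨.ball t φ, fun v => by simp [Sigma00.Holds, hφ, ht]⟩

theorem Def0.bex {f : (Fin n → M) → M} {P : M → (Fin n → M) → Prop} (hf : TmDef f)
    (hP : Def0 S (fun v : Fin (n + 1) → M => P (v 0) (Fin.tail v))) :
    Def0 S (fun v => ∃ x < f v, P x v) := by
  have := (Def0.ball (P := fun x v => ¬ P x v) hf hP.not).not
  simpa only [not_forall, not_not, exists_prop] using this

end Definability

/-! ### Semiring and order axioms from induction -/

namespace IsModelRCA0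

variable {M : Type*} [Zero M] [One M] [Add M] [Mul M] [LT M] {S : Set (Set M)}

theorem def0_induction (hM : IsModelRCA0 M S) {P : M → Prop}
    (hP : Def0 S (fun v : Fin 2 → M => P (v 1))) (h0 : P 0) (hs : ∀ n, P n → P (n + 1)) (n : M) :
    P n := by
  obtain ⟨φ, hφ⟩ := hP
  simpa [hφ] using hM.sigma01_induction φ ⟨0, by simpa [hφ] using h0⟩
    (fun n ⟨m, h⟩ => ⟨0, by simpa [hφ] using hs n (by simpa [hφ] using h)⟩) n

theorem sigma1_induction (hM : IsModelRCA0 M S) {P : M → M → Prop}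
    (hP : Def0 S (fun v : Fin 2 → M => P (v 0) (v 1))) (h0 : ∃ m, P m 0)
    (hs : ∀ n, (∃ m, P m n) → ∃ m, P m (n + 1)) (n : M) : ∃ m, P m n := by
  obtain ⟨φ, hφ⟩ := hP
  simpa [hφ] using hM.sigma01_induction φ (by simpa [hφ] using h0) (by simpa [hφ] using hs) n

theorem delta1_comprehension (hM : IsModelRCA0 M S) {P R : M → M → Prop}
    (hP : Def0 S (fun v : Fin 2 → M => P (v 0) (v 1)))
    (hR : Def0 S (fun v : Fin 2 → M => R (v 0) (v 1)))
    (h : ∀ n, (∃ m, P m n) ↔ ∀ m, R m n) : {n | ∃ m, P m n} ∈ S := by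
  obtain ⟨φ, hφ⟩ := hP
  obtain ⟨ψ, hψ⟩ := hR
  obtain ⟨X, hX, hX'⟩ := hM.delta01_comprehension φ ψ (by simpa [hφ, hψ] using h)
  convert hX using 1
  ext n
  simp [hX', hφ]

theorem def0_mem (hM : IsModelRCA0 M S) {P : M → Prop}
    (hP : Def0 S (fun v : Fin 2 → M => P (v 1))) : {n | P n} ∈ S := by
  have := hM.delta1_comprehension (P := fun _ n => P n) (R := fun _ n => P n) hP hP
    (fun n => ⟨fun ⟨_, h⟩ _ => h, fun h => ⟨0, h 0⟩⟩)
  convert this using 1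
  ext n
  exact ⟨fun h => ⟨0, h⟩, fun ⟨_, h⟩ => h⟩

theorem zero_add' (hM : IsModelRCA0 M S) (n : M) : 0 + n = n := by
  refine hM.def0_induction (P := fun n => 0 + n = n)
    (.eq (.add (.param _) (.var _)) (.var _)) (hM.add_zero 0) (fun n h => ?_) n
  rw [hM.add_succ, h]

theorem succ_add' (hM : IsModelRCA0 M S) (m n : M) : (m + 1) + n = (m + n) + 1 := by
  refine hM.def0_induction (P := fun n => (m + 1) + n = (m + n) + 1)
    (.eq (.add (.param _) (.var _)) (.add (.add (.param _) (.var _)) (.param _))) ?_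
    (fun n h => ?_) n
  · rw [hM.add_zero, hM.add_zero]
  · rw [hM.add_succ, h, hM.add_succ]

theorem add_comm' (hM : IsModelRCA0 M S) (m n : M) : m + n = n + m := by
  refine hM.def0_induction (P := fun n => m + n = n + m)
    (.eq (.add (.param _) (.var _)) (.add (.var _) (.param _))) ?_ (fun n h => ?_) n
  · rw [hM.add_zero, hM.zero_add']
  · rw [hM.add_succ, h, hM.succ_add']

theorem add_assoc' (hM : IsModelRCA0 M S) (a b c : M) : a + b + c = a + (b + c) := by
  refine hM.def0_induction (P := fun c => a + b + c = a + (b + c))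
    (.eq (.add (.param _) (.var _)) (.add (.param _) (.add (.param _) (.var _)))) ?_
    (fun n h => ?_) c
  · rw [hM.add_zero, hM.add_zero]
  · rw [hM.add_succ, h, hM.add_succ, hM.add_succ]

theorem zero_mul' (hM : IsModelRCA0 M S) (n : M) : 0 * n = 0 := by
  refine hM.def0_induction (P := fun n => 0 * n = 0)
    (.eq (.mul (.param _) (.var _)) (.param _)) (hM.mul_zero 0) (fun n h => ?_) n
  rw [hM.mul_succ, h, hM.add_zero]

theorem succ_mul' (hM : IsModelRCA0 M S) (m n : M) : (m + 1) * n = m * n + n := by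
  refine hM.def0_induction (P := fun n => (m + 1) * n = m * n + n)
    (.eq (.mul (.param _) (.var _)) (.add (.mul (.param _) (.var _)) (.var _))) ?_
    (fun n h => ?_) n
  · rw [hM.mul_zero, hM.mul_zero, hM.add_zero]
  · rw [hM.mul_succ, h, hM.mul_succ, hM.add_assoc', hM.add_assoc', hM.add_succ n m,
      hM.add_succ m n, hM.add_comm' n m]

theorem mul_comm' (hM : IsModelRCA0 M S) (m n : M) : m * n = n * m := by
  refine hM.def0_induction (P := fun n => m * n = n * m)
    (.eq (.mul (.param _) (.var _)) (.mul (.var _) (.param _))) ?_ (fun n h => ?_) n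
  · rw [hM.mul_zero, hM.zero_mul']
  · rw [hM.mul_succ, h, hM.succ_mul']

theorem mul_add' (hM : IsModelRCA0 M S) (a b c : M) : a * (b + c) = a * b + a * c := by
  refine hM.def0_induction (P := fun c => a * (b + c) = a * b + a * c)
    (.eq (.mul (.param _) (.add (.param _) (.var _)))
      (.add (.param _) (.mul (.param _) (.var _)))) ?_ (fun n h => ?_) c
  · rw [hM.mul_zero, hM.add_zero, hM.add_zero]
  · rw [hM.add_succ, hM.mul_succ, h, hM.mul_succ, hM.add_assoc']

theorem mul_assoc' (hM : IsModelRCA0 M S) (a b c : M) : a * b * c = a * (b * c) := by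
  refine hM.def0_induction (P := fun c => a * b * c = a * (b * c))
    (.eq (.mul (.param _) (.var _)) (.mul (.param _) (.mul (.param _) (.var _)))) ?_
    (fun n h => ?_) c
  · rw [hM.mul_zero, hM.mul_zero, hM.mul_zero]
  · rw [hM.mul_succ, h, hM.mul_succ, hM.mul_add']

theorem mul_one' (hM : IsModelRCA0 M S) (n : M) : n * 1 = n := by
  rw [← hM.zero_add' 1, hM.mul_succ, hM.mul_zero, hM.zero_add']

/-- The first-order part of a model of `RCA_0` is a commutative semiring. -/
abbrev commSemiring (hM : IsModelRCA0 M S) : CommSemiring M where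
  zero := 0
  one := 1
  add := (· + ·)
  mul := (· * ·)
  add_assoc := hM.add_assoc'
  zero_add := hM.zero_add'
  add_zero := hM.add_zero
  add_comm := hM.add_comm'
  nsmul := nsmulRec
  left_distrib := hM.mul_add'
  right_distrib a b c := by
    change (a + b) * c = a * c + b * c
    rw [hM.mul_comm', hM.mul_add', hM.mul_comm' c, hM.mul_comm' c]
  zero_mul := hM.zero_mul'
  mul_zero := hM.mul_zero
  mul_assoc := hM.mul_assoc'
  one_mul n := by
    change 1 * n = n
    rw [hM.mul_comm', hM.mul_one']
  mul_one := hM.mul_one'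
  mul_comm := hM.mul_comm'

theorem add_right_cancel' (hM : IsModelRCA0 M S) (a b c : M) : a + c = b + c → a = b := by
  refine hM.def0_induction (P := fun c => a + c = b + c → a = b) ?_ ?_ (fun n h h' => ?_) c
  · have : Def0 S (fun v : Fin 2 → M => ¬ a + v 1 = b + v 1 ∨ a = b) :=
      .or (.not (.eq (.add (.param _) (.var _)) (.add (.param _) (.var _))))
        (.eq (.param _) (.param _))
    simpa only [← imp_iff_not_or] using this
  · simp [hM.add_zero]
  · rw [hM.add_succ, hM.add_succ] at h'
    exact h (hM.succ_inj _ _ h')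

theorem lt_add_succ (hM : IsModelRCA0 M S) (m k : M) : m < m + (k + 1) := by
  refine hM.def0_induction (P := fun k => m < m + (k + 1))
    (.lt (.param _) (.add (.param _) (.add (.var _) (.param _)))) ?_ (fun n h => ?_) k
  · rw [hM.add_succ, hM.lt_succ_iff, hM.add_zero]
    exact .inr rfl
  · rw [hM.add_succ, hM.lt_succ_iff]
    exact .inl h

theorem exists_add_of_lt' (hM : IsModelRCA0 M S) {m n : M} : m < n → ∃ k, n = m + (k + 1) := by
  -- Pulling `k` in front of the implication makes the claim `Σ⁰₁`, as induction requires.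
  have key : ∀ n, ∃ k, ¬ m < n ∨ n = m + (k + 1) := by
    refine hM.sigma1_induction (P := fun k n => ¬ m < n ∨ n = m + (k + 1))
      (.or (.not (.lt (.param _) (.var _)))
        (.eq (.var _) (.add (.param _) (.add (.var _) (.param _))))) ⟨0, .inl (hM.not_lt_zero m)⟩ ?_
    rintro n ⟨k, hk⟩
    by_cases h : m < n
    · refine ⟨k + 1, .inr ?_⟩
      rw [hM.add_succ m (k + 1), ← hk.resolve_left (not_not.2 h)]
    · by_cases h' : m = n
      · refine ⟨0, .inr ?_⟩
        rw [h', hM.zero_add']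
      · refine ⟨0, .inl ?_⟩
        rw [hM.lt_succ_iff]
        tauto
  intro h
  obtain ⟨k, hk⟩ := key n
  exact ⟨k, hk.resolve_left (not_not.2 h)⟩

theorem lt_iff_exists_add' (hM : IsModelRCA0 M S) {m n : M} : m < n ↔ ∃ k, n = m + (k + 1) :=
  ⟨hM.exists_add_of_lt', fun ⟨k, hk⟩ => hk ▸ hM.lt_add_succ m k⟩

theorem zero_lt_succ' (hM : IsModelRCA0 M S) (n : M) : 0 < n + 1 := by
  rw [hM.lt_iff_exists_add']
  exact ⟨n, (hM.zero_add' _).symm⟩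

theorem eq_zero_or_succ (hM : IsModelRCA0 M S) (n : M) : n = 0 ∨ ∃ k, n = k + 1 := by
  have : ∃ k, n = 0 ∨ n = k + 1 := by
    refine hM.sigma1_induction (P := fun k n => n = 0 ∨ n = k + 1)
      (.or (.eq (.var _) (.param _)) (.eq (.var _) (.add (.var _) (.param _))))
      ⟨0, .inl rfl⟩ (fun n _ => ⟨n, .inr rfl⟩) n
  obtain ⟨k, h | h⟩ := this
  exacts [.inl h, .inr ⟨k, h⟩]

theorem lt_irrefl' (hM : IsModelRCA0 M S) (m : M) : ¬ m < m := by
  intro h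
  obtain ⟨k, hk⟩ := hM.exists_add_of_lt' h
  have : 0 + m = (k + 1) + m := by rw [hM.zero_add', hM.add_comm' (k + 1) m, ← hk]
  exact hM.succ_ne_zero k (hM.add_right_cancel' _ _ _ this).symm

theorem lt_trans' (hM : IsModelRCA0 M S) {a b c : M} (h : a < b) (h' : b < c) : a < c := by
  obtain ⟨k, rfl⟩ := hM.exists_add_of_lt' h
  obtain ⟨l, rfl⟩ := hM.exists_add_of_lt' h'
  rw [hM.add_assoc', hM.add_succ]
  exact hM.lt_add_succ _ _

theorem lt_trichotomy' (hM : IsModelRCA0 M S) (m n : M) : m < n ∨ m = n ∨ n < m := by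
  refine hM.def0_induction (P := fun n => m < n ∨ m = n ∨ n < m)
    (.or (.lt (.param _) (.var _)) (.or (.eq (.param _) (.var _)) (.lt (.var _) (.param _))))
    ?_ (fun n h => ?_) n
  · rcases hM.eq_zero_or_succ m with rfl | ⟨k, rfl⟩
    · exact .inr (.inl rfl)
    · exact .inr (.inr (hM.zero_lt_succ' k))
  · rw [hM.lt_succ_iff]
    rcases h with h | h | h
    · exact .inl (.inl h)
    · exact .inl (.inr h)
    · obtain ⟨k, rfl⟩ := hM.exists_add_of_lt' h
      rcases hM.eq_zero_or_succ k with rfl | ⟨l, rfl⟩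
      · rw [hM.zero_add']
        exact .inr (.inl rfl)
      · refine .inr (.inr ?_)
        rw [hM.add_comm' (l + 1) 1, ← hM.add_assoc']
        exact hM.lt_add_succ (n + 1) l

open Classical in
/-- The first-order part of a model of `RCA_0` is linearly ordered. -/
noncomputable abbrev linearOrder (hM : IsModelRCA0 M S) : LinearOrder M where
  le a b := a < b ∨ a = b
  lt a b := a < b
  le_refl a := .inr rfl
  le_trans a b c := by
    rintro (h | rfl) (h' | rfl)
    exacts [.inl (hM.lt_trans' h h'), .inl h, .inl h', .inr rfl]
  lt_iff_le_not_ge a b := by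
    constructor
    · refine fun h => ⟨.inl h, ?_⟩
      rintro (h' | rfl)
      exacts [hM.lt_irrefl' _ (hM.lt_trans' h h'), hM.lt_irrefl' _ h]
    · rintro ⟨h | rfl, h'⟩
      exacts [h, absurd (.inr rfl) h']
  le_antisymm a b := by
    rintro (h | rfl) (h' | h')
    exacts [absurd (hM.lt_trans' h h') (hM.lt_irrefl' _), h'.symm, rfl, rfl]
  le_total a b := by
    rcases hM.lt_trichotomy' a b with h | rfl | h
    exacts [.inl (.inl h), .inl (.inr rfl), .inr (.inl h)]
  toDecidableLE := Classical.decRel _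

end IsModelRCA0

/-- Ordered commutative semirings in which the order is the natural one and is discrete. -/
class DiscreteSemiring (M : Type*) [CommSemiring M] [LinearOrder M] : Prop extends
    IsStrictOrderedRing M, CanonicallyOrderedAdd M where
  lt_add_one_iff : ∀ a b : M, a < b + 1 ↔ a ≤ b

/-- Since `a < b` means `b = a + (k + 1)` for some `k`, the compatibility axioms reduce to semiring
identities. -/
theorem IsModelRCA0.discreteSemiring {M : Type*} [Zero M] [One M] [Add M] [Mul M] [LT M]
    {S : Set (Set M)} (hM : IsModelRCA0 M S) :
    letI := hM.commSemiring
    letI := hM.linearOrder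
    DiscreteSemiring M := by
  let i1 := hM.commSemiring
  let i2 := hM.linearOrder
  have key : ∀ {a b : M}, a < b ↔ ∃ k, b = a + (k + 1) := hM.lt_iff_exists_add'
  have hle : ∀ {a b : M}, a ≤ b ↔ ∃ k, b = a + k := by
    intro a b
    rw [le_iff_lt_or_eq, key]
    constructor
    · rintro (⟨k, h⟩ | rfl)
      exacts [⟨_, h⟩, ⟨0, by simp⟩]
    · rintro ⟨k, rfl⟩
      rcases hM.eq_zero_or_succ k with rfl | ⟨l, rfl⟩
      exacts [.inr (by simp), .inl ⟨l, rfl⟩]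
  have hcancel : ∀ a b c : M, a + c = b + c → a = b := hM.add_right_cancel'
  refine @DiscreteSemiring.mk M i1 i2 ?_ ?_ ?_
  · have : IsOrderedCancelAddMonoid M :=
      { add_le_add_left := by
          intro a b h c
          obtain ⟨k, rfl⟩ := hle.1 h
          exact hle.2 ⟨k, by ring⟩
        le_of_add_le_add_left := by
          intro a b c h
          obtain ⟨k, hk⟩ := hle.1 h
          exact hle.2 ⟨k, hcancel _ _ a (by rw [add_comm c, hk]; ring)⟩ }
    have : Nontrivial M := ⟨⟨1, 0, by simpa using hM.succ_ne_zero 0⟩⟩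
    have : ZeroLEOneClass M := ⟨hle.2 ⟨1, by simp⟩⟩
    have hmul : ∀ a b c : M, 0 < a → b < c → a * b < a * c := by
      intro a b c ha hb
      obtain ⟨k, rfl⟩ := key.1 ha
      obtain ⟨l, rfl⟩ := key.1 hb
      exact key.2 ⟨k * l + k + l, by ring⟩
    exact { mul_lt_mul_of_pos_left := fun a ha b c h => hmul a b c ha h
            mul_lt_mul_of_pos_right := fun a ha b c h => by
              simpa only [mul_comm] using hmul a b c ha h }
  · exact { exists_add_of_le := fun h => hle.1 h, le_add_self := fun a b => hle.2 ⟨b, add_comm _ _⟩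
            le_self_add := fun a b => hle.2 ⟨b, rfl⟩ }
  · intro a b
    exact (hM.lt_succ_iff a b).trans le_iff_lt_or_eq.symm

/-! ### Discrete order and the pairing function -/

section Arithmetic

variable {M : Type*} [CommSemiring M] [LinearOrder M] [DiscreteSemiring M]

theorem lt_add_one_iff {a b : M} : a < b + 1 ↔ a ≤ b := DiscreteSemiring.lt_add_one_iff a b

theorem add_one_le_iff {a b : M} : a + 1 ≤ b ↔ a < b := by
  constructor
  · intro h
    by_contra h'
    exact absurd (h.trans (not_lt.1 h')) (not_le.2 (lt_add_one_iff.2 le_rfl))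
  · intro h
    by_contra h'
    exact absurd (h.trans_le (lt_add_one_iff.1 (not_le.1 h'))) (lt_irrefl _)

theorem lt_one_iff {a : M} : a < 1 ↔ a = 0 := by
  rw [← zero_add (1 : M), lt_add_one_iff, nonpos_iff_eq_zero]

theorem le_mul_self (a : M) : a ≤ a * a := by
  rcases eq_or_ne a 0 with rfl | h
  · simp
  · have : 1 ≤ a := by
      by_contra h'
      exact h (lt_one_iff.1 (not_le.1 h'))
    exact le_mul_of_one_le_right' this

theorem add_le_pair (x y : M) : x + y ≤ pair x y :=
  (le_mul_self _).trans le_self_add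

theorem left_le_pair (x y : M) : x ≤ pair x y := le_self_add.trans (add_le_pair x y)

theorem right_le_pair (x y : M) : y ≤ pair x y := le_add_self.trans (add_le_pair x y)

/-- The code of `(x, y)` lies in the interval from `(x + y)²` to `(x + y + 1)²`, the right end
excluded. -/
theorem pair_lt_pair_of_add_lt {x y x' y' : M} (h : x + y < x' + y') : pair x y < pair x' y' := by
  have h1 := mul_le_mul' (add_one_le_iff.2 h) (add_one_le_iff.2 h)
  have h2 : pair x y < (x + y + 1) * (x + y + 1) := by
    have : (x + y + 1) * (x + y + 1) = (x + y) * (x + y) + x + (x + y + y) + 1 := by ring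
    rw [this, lt_add_one_iff]
    exact le_self_add
  exact h2.trans_le (h1.trans le_self_add)

theorem pair_lt_pair_left {x x' : M} (h : x < x') (y : M) : pair x y < pair x' y :=
  pair_lt_pair_of_add_lt (by gcongr)

theorem pair_lt_pair_right (x : M) {y y' : M} (h : y < y') : pair x y < pair x y' :=
  pair_lt_pair_of_add_lt (by gcongr)

theorem pair_le_pair {x x' y y' : M} (h : x ≤ x') (h' : y ≤ y') : pair x y ≤ pair x' y' := by
  unfold pair
  gcongr

theorem pair_inj {x y x' y' : M} : pair x y = pair x' y' ↔ x = x' ∧ y = y' := by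
  constructor
  · intro h
    have hs : x + y = x' + y' := by
      rcases lt_trichotomy (x + y) (x' + y') with h' | h' | h'
      · exact absurd h (pair_lt_pair_of_add_lt h').ne
      · exact h'
      · exact absurd h (pair_lt_pair_of_add_lt h').ne'
    have hx : x = x' := by
      unfold pair at h
      rw [hs] at h
      exact add_left_cancel h
    subst hx
    exact ⟨rfl, add_left_cancel hs⟩
  · rintro ⟨rfl, rfl⟩
    rfl

end Arithmetic

/-! ### Functions and relations that exist in the model -/

/-- `S` is the second-order part of a model of `RCA_0`. -/
class Model {M : Type*} [CommSemiring M] [LinearOrder M] (S : Set (Set M)) : Prop where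
  isModel : IsModelRCA0 M S

/-- A type whose elements are coded by numbers, so that the codes form a set of the model. -/
class Coded {M : Type*} (S : Set (Set M)) (α : Type*) where
  /-- the code of an element -/
  enc : α → M
  enc_injective : Function.Injective enc
  range_mem : Set.range enc ∈ S

/-- The code of an element of a coded type. -/
def enc {M : Type*} (S : Set (Set M)) {α : Type*} [Coded S α] (a : α) : M := Coded.enc S a

variable {M : Type*} [CommSemiring M] [LinearOrder M] {S : Set (Set M)}

/-- The graph of `f` is a set of the model. -/
@[fun_prop]
def Comp (S : Set (Set M)) {α β : Type*} [Coded S α] [Coded S β] (f : α → β) : Prop :=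
  {m | ∃ a, m = pair (enc S a) (enc S (f a))} ∈ S

/-- The codes of the objects that satisfy `P` form a set of the model. -/
def Dec (S : Set (Set M)) {α : Type*} [Coded S α] (P : α → Prop) : Prop :=
  {m | ∃ a, m = enc S a ∧ P a} ∈ S

section Coded

set_option linter.unusedSectionVars false

variable {α β γ δ : Type*} [Coded S α] [Coded S β] [Coded S γ] [Coded S δ]

theorem mem_of_ext {X Y : Set M} (hY : Y ∈ S) (h : ∀ n, n ∈ X ↔ n ∈ Y) : X ∈ S := by
  rwa [Set.ext h]

theorem enc_inj {a b : α} : enc S a = enc S b ↔ a = b := Coded.enc_injective.eq_iff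

theorem mem_dec {P : α → Prop} {a : α} :
    enc S a ∈ {m | ∃ a, m = enc S a ∧ P a} ↔ P a := by
  constructor
  · rintro ⟨b, h, hb⟩
    rwa [enc_inj.1 h]
  · exact fun h => ⟨a, rfl, h⟩

variable [DiscreteSemiring M]

theorem mem_graph {f : α → β} {a : α} {n : M} :
    pair (enc S a) n ∈ {m | ∃ a, m = pair (enc S a) (enc S (f a))} ↔ n = enc S (f a) := by
  constructor
  · rintro ⟨b, h⟩
    obtain ⟨h1, h2⟩ := pair_inj.1 h
    rwa [enc_inj.1 h1]
  · rintro rfl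
    exact ⟨a, rfl⟩

theorem mem_graph' {f : α → β} {m n : M} :
    pair m n ∈ {m | ∃ a, m = pair (enc S a) (enc S (f a))} ↔
      ∃ a, m = enc S a ∧ n = enc S (f a) := by
  simp only [Set.mem_ofPred_eq, pair_inj]

variable [hS : Model S]

theorem def0_mem {P : M → Prop} (hP : Def0 S (fun v : Fin 2 → M => P (v 1))) : {n | P n} ∈ S :=
  hS.isModel.def0_mem hP

/-- Bounded existence of a pair, in the form in which codes are analysed. -/
theorem Def0.exists_pair {n : ℕ} {f : (Fin n → M) → M} {P : M → M → (Fin n → M) → Prop}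
    (hf : TmDef f)
    (hf' : TmDef (fun v : Fin (n + 1) → M => f (Fin.tail v)))
    (hf'' : TmDef (fun v : Fin (n + 2) → M => f (Fin.tail (Fin.tail v))))
    (hP : Def0 S (fun v : Fin (n + 2) → M => P (v 1) (v 0) (Fin.tail (Fin.tail v)))) :
    Def0 S (fun v => ∃ a b, f v = RM.pair a b ∧ P a b v) := by
  have : Def0 S (fun v => ∃ a < f v + 1, ∃ b < f v + 1, f v = RM.pair a b ∧ P a b v) := by
    refine .bex (hf.add (.param 1)) (.bex (P := fun b v => f (Fin.tail v) = RM.pair (v 0) b ∧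
      P (v 0) b (Fin.tail v)) (hf'.add (.param 1)) (.and (.eq hf'' ?_) hP))
    exact .pair (.var 1) (.var 0)
  convert this using 2 with v
  constructor
  · rintro ⟨a, b, h, h'⟩
    exact ⟨a, by simpa [lt_add_one_iff, h] using left_le_pair a b, b,
      by simpa [lt_add_one_iff, h] using right_le_pair a b, h, h'⟩
  · rintro ⟨a, -, b, -, h⟩
    exact ⟨a, b, h⟩

theorem setOf_pair_mem {P : M → M → Prop}
    (hP : Def0 S (fun v : Fin 4 → M => P (v 1) (v 0))) : {n | ∃ a b, n = pair a b ∧ P a b} ∈ S :=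
  def0_mem (.exists_pair (P := fun a b _ => P a b) (.var 1) (.var 2) (.var 3) hP)

theorem setOf_pair_pair_mem {P : M → M → M → Prop}
    (hP : Def0 S (fun v : Fin 6 → M => P (v 3) (v 1) (v 0))) :
    {n | ∃ a b c, n = pair a (pair b c) ∧ P a b c} ∈ S := by
  convert setOf_pair_mem (P := fun a d => ∃ b c, d = pair b c ∧ P a b c)
    (.exists_pair (P := fun b c v => P (v 1) b c) (.var 0) (.var 1) (.var 2) hP) using 1
  ext n
  constructor
  · rintro ⟨a, b, c, rfl, h⟩
    exact ⟨a, _, rfl, b, c, rfl, h⟩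
  · rintro ⟨a, _, rfl, b, c, rfl, h⟩
    exact ⟨a, b, c, rfl, h⟩

theorem setOf_pair_pair_mem' {P : M → M → M → Prop}
    (hP : Def0 S (fun v : Fin 6 → M => P (v 1) (v 0) (v 2))) :
    {n | ∃ a b c, n = pair (pair a b) c ∧ P a b c} ∈ S := by
  convert setOf_pair_mem (P := fun d c => ∃ a b, d = pair a b ∧ P a b c)
    (.exists_pair (P := fun a b v => P a b (v 0)) (.var 1) (.var 2) (.var 3) hP) using 1
  ext n
  constructor
  · rintro ⟨a, b, c, rfl, h⟩
    exact ⟨_, c, rfl, a, b, rfl, h⟩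
  · rintro ⟨_, c, rfl, a, b, rfl, h⟩
    exact ⟨a, b, c, rfl, h⟩

instance : Coded S M where
  enc := id
  enc_injective := Function.injective_id
  range_mem := def0_mem (P := fun n => n ∈ Set.range id) (by
    have : Def0 S (fun v : Fin 2 → M => v 1 = v 1) := .eq (.var 1) (.var 1)
    simpa using this)

instance : Coded S (α × β) where
  enc p := pair (enc S p.1) (enc S p.2)
  enc_injective p q h := by
    obtain ⟨h1, h2⟩ := pair_inj.1 h
    exact Prod.ext (enc_inj.1 h1) (enc_inj.1 h2)
  range_mem := by
    refine mem_of_ext (setOf_pair_mem (S := S) (P := fun a b : M => a ∈ Set.range (Coded.enc S (α := α)) ∧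
      b ∈ Set.range (Coded.enc S (α := β))) (.and (.mem Coded.range_mem (.var 1))
        (.mem Coded.range_mem (.var 0)))) fun n => ?_
    constructor
    · rintro ⟨⟨a, b⟩, rfl⟩
      exact ⟨_, _, rfl, ⟨a, rfl⟩, ⟨b, rfl⟩⟩
    · rintro ⟨_, _, rfl, ⟨a, rfl⟩, ⟨b, rfl⟩⟩
      exact ⟨(a, b), rfl⟩

theorem enc_prod (p : α × β) : enc S p = pair (enc S p.1) (enc S p.2) := rfl

-- With truth values as coded objects, relations are functions into `Prop`, so that `Comp` and its
-- composition rule serve for relations as well.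
open Classical in
noncomputable instance : Coded S Prop where
  enc p := if p then 1 else 0
  enc_injective p q h := by
    by_cases hp : p <;> by_cases hq : q <;> simp_all
  range_mem := by
    refine mem_of_ext (def0_mem (S := S) (P := fun n : M => n = 1 ∨ n = 0)
      (.or (.eq (.var _) (.param _)) (.eq (.var _) (.param _)))) fun n => ?_
    constructor
    · rintro ⟨p, rfl⟩
      by_cases hp : p <;> simp [hp]
    · rintro (rfl | rfl)
      exacts [⟨True, by simp⟩, ⟨False, by simp⟩]

theorem enc_prop_eq_one {p : Prop} : enc S p = 1 ↔ p := by
  by_cases hp : p <;> simp [hp, enc, Coded.enc]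

theorem enc_prop_eq_zero {p : Prop} : enc S p = 0 ↔ ¬ p := by
  by_cases hp : p <;> simp [hp, enc, Coded.enc]

/-- Comprehension asks for a `Π⁰₁` form of the relation; it is obtained by negating the `Σ⁰₁` form
of the complement. -/
theorem dec_of_def0 {P : α → Prop} {A B : M → M → Prop}
    (hA : Def0 S (fun v : Fin 2 → M => A (v 0) (v 1)))
    (hB : Def0 S (fun v : Fin 2 → M => B (v 0) (v 1)))
    (h : ∀ a, P a ↔ ∃ m, A m (enc S a)) (h' : ∀ a, ¬ P a ↔ ∃ m, B m (enc S a)) : Dec S P := by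
  have := hS.isModel.delta1_comprehension
    (P := fun m n => n ∈ Set.range (Coded.enc S (α := α)) ∧ A m n)
    (R := fun m n => n ∈ Set.range (Coded.enc S (α := α)) ∧ ¬ B m n)
    (.and (.mem Coded.range_mem (.var _)) hA) (.and (.mem Coded.range_mem (.var _)) hB.not) ?_
  · refine mem_of_ext (this) fun n => ?_
    constructor
    · rintro ⟨a, rfl, ha⟩
      obtain ⟨m, hm⟩ := (h a).1 ha
      exact ⟨m, ⟨a, rfl⟩, hm⟩
    · rintro ⟨m, ⟨a, rfl⟩, hm⟩
      exact ⟨a, rfl, (h a).2 ⟨m, hm⟩⟩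
  · intro n
    constructor
    · rintro ⟨m, ⟨a, rfl⟩, hm⟩ k
      exact ⟨⟨a, rfl⟩, fun hk => (h' a).2 ⟨k, hk⟩ ((h a).2 ⟨m, hm⟩)⟩
    · intro hn
      obtain ⟨⟨a, rfl⟩, -⟩ := hn 0
      by_cases ha : P a
      · obtain ⟨m, hm⟩ := (h a).1 ha
        exact ⟨m, ⟨a, rfl⟩, hm⟩
      · obtain ⟨k, hk⟩ := (h' a).1 ha
        exact absurd hk (hn k).2

theorem comp_iff_dec_graph {f : α → β} : Comp S f ↔ Dec S (fun p : α × β => f p.1 = p.2) := by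
  unfold Comp Dec
  apply iff_of_eq
  congr 1
  ext n
  constructor
  · rintro ⟨a, rfl⟩
    exact ⟨(a, f a), rfl, rfl⟩
  · rintro ⟨⟨a, b⟩, rfl, h⟩
    exact ⟨a, by rw [show b = f a from h.symm, enc_prod]⟩

theorem comp_prop_iff {P : α → Prop} : Comp S P ↔ Dec S P := by
  constructor
  · intro h
    refine mem_of_ext (def0_mem (P := fun n => pair n 1 ∈ {m | ∃ a, m = pair (enc S a) (enc S (P a))})
      (.mem h (.pair (.var _) (.param _)))) fun n => ?_
    refine Iff.trans ?_ mem_graph'.symm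
    simp only [Set.mem_ofPred_eq, eq_comm (a := (1 : M)), enc_prop_eq_one]
  · intro h
    refine mem_of_ext (setOf_pair_mem (P := fun a i => a ∈ Set.range (Coded.enc S (α := α)) ∧
      (i = 1 ∧ a ∈ {m | ∃ a, m = enc S a ∧ P a} ∨ i = 0 ∧ ¬ a ∈ {m | ∃ a, m = enc S a ∧ P a}))
      (.and (.mem Coded.range_mem (.var _)) (.or (.and (.eq (.var _) (.param _)) (.mem h (.var _)))
        (.and (.eq (.var _) (.param _)) (.not (.mem h (.var _))))))) fun n => ?_
    constructor
    · rintro ⟨a, rfl⟩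
      refine ⟨_, _, rfl, ⟨a, rfl⟩, ?_⟩
      rw [mem_dec, enc_prop_eq_one, enc_prop_eq_zero]
      tauto
    · rintro ⟨_, i, rfl, ⟨a, rfl⟩, ⟨rfl, h'⟩ | ⟨rfl, h'⟩⟩
      · exact ⟨a, by rw [enc_prop_eq_one.2 (mem_dec.1 h')]; rfl⟩
      · refine ⟨a, by rw [enc_prop_eq_zero.2 (fun h => h' (mem_dec.2 h))]; rfl⟩

theorem dec_prod_iff {P : α × β → Prop} :
    Dec S P ↔ {n | ∃ a b, n = pair (enc S a) (enc S b) ∧ P (a, b)} ∈ S := by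
  unfold Dec
  apply iff_of_eq
  congr 1
  ext n
  simp [enc_prod]

theorem exists_iff_exists_pair_mem {A : α → β → Prop} {a : α} : (∃ b, A a b) ↔
    ∃ m, pair (enc S a) m ∈ {m | ∃ p : α × β, m = enc S p ∧ A p.1 p.2} := by
  constructor
  · rintro ⟨b, hb⟩
    exact ⟨_, (a, b), rfl, hb⟩
  · rintro ⟨m, ⟨a', b⟩, h, hb⟩
    obtain ⟨h1, -⟩ := pair_inj.1 h
    rw [enc_inj.1 h1]
    exact ⟨b, hb⟩

namespace Comp

@[fun_prop]
theorem id' : Comp S (fun a : α => a) := by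
  refine mem_of_ext (setOf_pair_mem (S := S) (P := fun a b => a ∈ Set.range (Coded.enc S (α := α)) ∧ a = b)
    (.and (.mem Coded.range_mem (.var _)) (.eq (.var _) (.var _)))) fun n => ?_
  constructor
  · rintro ⟨a, rfl⟩
    exact ⟨_, _, rfl, ⟨a, rfl⟩, rfl⟩
  · rintro ⟨_, _, rfl, ⟨a, rfl⟩, rfl⟩
    exact ⟨a, rfl⟩

@[fun_prop]
theorem const (b : β) : Comp S (fun _ : α => b) := by
  refine mem_of_ext (setOf_pair_mem (S := S)
    (P := fun x y => x ∈ Set.range (Coded.enc S (α := α)) ∧ y = enc S b)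
    (.and (.mem Coded.range_mem (.var _)) (.eq (.var _) (.param _)))) fun n => ?_
  constructor
  · rintro ⟨a, rfl⟩
    exact ⟨_, _, rfl, ⟨a, rfl⟩, rfl⟩
  · rintro ⟨_, _, rfl, ⟨a, rfl⟩, rfl⟩
    exact ⟨a, rfl⟩

@[fun_prop]
theorem prodMk {f : α → β} {g : α → γ} (hf : Comp S f) (hg : Comp S g) :
    Comp S (fun a => (f a, g a)) := by
  refine mem_of_ext (setOf_pair_pair_mem (P := fun a b c =>
      pair a b ∈ {m | ∃ a, m = pair (enc S a) (enc S (f a))} ∧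
      pair a c ∈ {m | ∃ a, m = pair (enc S a) (enc S (g a))})
    (.and (.mem hf (.pair (.var _) (.var _))) (.mem hg (.pair (.var _) (.var _))))) fun n => ?_
  constructor
  · rintro ⟨a, rfl⟩
    exact ⟨_, _, _, rfl, mem_graph.2 rfl, mem_graph.2 rfl⟩
  · rintro ⟨x, b, c, rfl, h1, h2⟩
    obtain ⟨a, rfl, rfl⟩ := mem_graph'.1 h1
    rw [mem_graph.1 h2]
    exact ⟨a, rfl⟩

theorem fst' : Comp S (fun p : α × β => p.1) := by
  refine mem_of_ext (setOf_pair_pair_mem' (S := S) (P := fun a b c =>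
      a ∈ Set.range (Coded.enc S (α := α)) ∧ b ∈ Set.range (Coded.enc S (α := β)) ∧ c = a)
    (.and (.mem Coded.range_mem (.var _))
      (.and (.mem Coded.range_mem (.var _)) (.eq (.var _) (.var _))))) fun n => ?_
  constructor
  · rintro ⟨⟨a, b⟩, rfl⟩
    exact ⟨_, _, _, rfl, ⟨a, rfl⟩, ⟨b, rfl⟩, rfl⟩
  · rintro ⟨_, _, _, rfl, ⟨a, rfl⟩, ⟨b, rfl⟩, rfl⟩
    exact ⟨(a, b), rfl⟩

theorem snd' : Comp S (fun p : α × β => p.2) := by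
  refine mem_of_ext (setOf_pair_pair_mem' (S := S) (P := fun a b c =>
      a ∈ Set.range (Coded.enc S (α := α)) ∧ b ∈ Set.range (Coded.enc S (α := β)) ∧ c = b)
    (.and (.mem Coded.range_mem (.var _))
      (.and (.mem Coded.range_mem (.var _)) (.eq (.var _) (.var _))))) fun n => ?_
  constructor
  · rintro ⟨⟨a, b⟩, rfl⟩
    exact ⟨_, _, _, rfl, ⟨a, rfl⟩, ⟨b, rfl⟩, rfl⟩
  · rintro ⟨_, _, _, rfl, ⟨a, rfl⟩, ⟨b, rfl⟩, rfl⟩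
    exact ⟨(a, b), rfl⟩

@[fun_prop]
-- The intermediate value witnesses `g (f a) = c`, and being unique it witnesses `g (f a) ≠ c`
-- equally well. Hence the graph is `Δ⁰₁`.
theorem comp {g : β → γ} {f : α → β} (hg : Comp S g) (hf : Comp S f) :
    Comp S (fun a => g (f a)) := by
  rw [comp_iff_dec_graph]
  refine dec_of_def0
    (A := fun b n => ∃ a c, n = pair a c ∧
      pair a b ∈ {m | ∃ a, m = pair (enc S a) (enc S (f a))} ∧
      pair b c ∈ {m | ∃ a, m = pair (enc S a) (enc S (g a))})
    (B := fun b n => ∃ a c, n = pair a c ∧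
      pair a b ∈ {m | ∃ a, m = pair (enc S a) (enc S (f a))} ∧
      ¬ pair b c ∈ {m | ∃ a, m = pair (enc S a) (enc S (g a))})
    (.exists_pair (f := fun v => v 1)
      (P := fun a c v => pair a (v 0) ∈ {m | ∃ a, m = pair (enc S a) (enc S (f a))} ∧
        pair (v 0) c ∈ {m | ∃ a, m = pair (enc S a) (enc S (g a))})
      (.var 1) (.var 2) (.var 3) (.and (.mem hf (.pair (.var 1) (.var 2)))
        (.mem hg (.pair (.var 2) (.var 0)))))
    (.exists_pair (f := fun v => v 1)
      (P := fun a c v => pair a (v 0) ∈ {m | ∃ a, m = pair (enc S a) (enc S (f a))} ∧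
        ¬ pair (v 0) c ∈ {m | ∃ a, m = pair (enc S a) (enc S (g a))})
      (.var 1) (.var 2) (.var 3) (.and (.mem hf (.pair (.var 1) (.var 2)))
        (.not (.mem hg (.pair (.var 2) (.var 0)))))) ?_ ?_
  · rintro ⟨a, c⟩
    constructor
    · intro h
      exact ⟨_, _, _, rfl, mem_graph.2 rfl, mem_graph.2 (congrArg (RM.enc S) h.symm)⟩
    · rintro ⟨b, x, z, h, h1, h2⟩
      obtain ⟨rfl, rfl⟩ := pair_inj.1 h
      rw [mem_graph] at h1
      subst h1
      exact (enc_inj.1 (mem_graph.1 h2)).symm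
  · rintro ⟨a, c⟩
    constructor
    · intro h
      exact ⟨_, _, _, rfl, mem_graph.2 rfl, fun h' => h (enc_inj.1 (mem_graph.1 h')).symm⟩
    · rintro ⟨b, x, z, h, h1, h2⟩ h3
      obtain ⟨rfl, rfl⟩ := pair_inj.1 h
      rw [mem_graph] at h1
      subst h1
      exact h2 (mem_graph.2 (enc_inj.2 h3.symm))

@[fun_prop]
theorem fst {f : α → β × γ} (hf : Comp S f) : Comp S (fun a => (f a).1) := fst'.comp hf

@[fun_prop]
theorem snd {f : α → β × γ} (hf : Comp S f) : Comp S (fun a => (f a).2) := snd'.comp hf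

theorem binary_of_term {h : M → M → M} (hh : TmDef (fun v : Fin 6 → M => h (v 1) (v 0))) :
    Comp S (fun p : M × M => h p.1 p.2) := by
  refine mem_of_ext (setOf_pair_pair_mem' (S := S) (P := fun a b c => c = h a b)
    (.eq (.var 2) hh)) fun n => ?_
  constructor
  · rintro ⟨⟨a, b⟩, rfl⟩
    exact ⟨_, _, _, rfl, rfl⟩
  · rintro ⟨a, b, _, rfl, rfl⟩
    exact ⟨(a, b), rfl⟩

theorem binary_of_def0 {P : M → M → Prop} (hP : Def0 S (fun v : Fin 4 → M => P (v 1) (v 0))) :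
    Comp S (fun p : M × M => P p.1 p.2) := by
  rw [comp_prop_iff, dec_prod_iff]
  exact setOf_pair_mem hP

@[fun_prop]
theorem add {f g : α → M} (hf : Comp S f) (hg : Comp S g) : Comp S (fun a => f a + g a) :=
  (binary_of_term (.add (.var _) (.var _))).comp (hf.prodMk hg)

@[fun_prop]
theorem mul {f g : α → M} (hf : Comp S f) (hg : Comp S g) : Comp S (fun a => f a * g a) :=
  (binary_of_term (.mul (.var _) (.var _))).comp (hf.prodMk hg)

@[fun_prop]
theorem pair {f g : α → M} (hf : Comp S f) (hg : Comp S g) :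
    Comp S (fun a => RM.pair (f a) (g a)) :=
  (binary_of_term (.pair (.var _) (.var _))).comp (hf.prodMk hg)

@[fun_prop]
theorem lt {f g : α → M} (hf : Comp S f) (hg : Comp S g) : Comp S (fun a => f a < g a) :=
  (binary_of_def0 (.lt (.var _) (.var _))).comp (hf.prodMk hg)

@[fun_prop]
theorem mem {f : α → M} {X : Set M} (hX : X ∈ S) (hf : Comp S f) :
    Comp S (fun a => f a ∈ X) := by
  refine Comp.comp (g := fun n => n ∈ X) ?_ hf
  rw [comp_prop_iff]
  exact mem_of_ext hX fun n => ⟨fun ⟨_, h, h'⟩ => h ▸ h', fun h => ⟨n, rfl, h⟩⟩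

theorem mem_sets {P : M → Prop} (hP : Comp S P) : {n | P n} ∈ S := by
  rw [comp_prop_iff] at hP
  exact mem_of_ext hP fun n => ⟨fun h => ⟨n, rfl, h⟩, fun ⟨_, h, h'⟩ => h ▸ h'⟩

@[fun_prop]
theorem enc : Comp S (fun a : α => RM.enc S a) := by
  refine mem_of_ext (setOf_pair_mem (S := S)
    (P := fun a b => a ∈ Set.range (Coded.enc S (α := α)) ∧ a = b)
    (.and (.mem Coded.range_mem (.var _)) (.eq (.var _) (.var _)))) fun n => ?_
  constructor
  · rintro ⟨a, rfl⟩
    exact ⟨_, _, rfl, ⟨a, rfl⟩, rfl⟩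
  · rintro ⟨_, _, rfl, ⟨a, rfl⟩, rfl⟩
    exact ⟨a, rfl⟩

@[fun_prop]
theorem eq {f g : α → β} (hf : Comp S f) (hg : Comp S g) : Comp S (fun a => f a = g a) := by
  have : Comp S (fun p : M × M => p.1 = p.2) := binary_of_def0 (.eq (.var _) (.var _))
  convert (this.comp ((Comp.enc.comp hf).prodMk (Comp.enc.comp hg))) using 2
  simp [enc_inj]

@[fun_prop]
theorem not {P : α → Prop} (hP : Comp S P) : Comp S (fun a => ¬ P a) := by
  simpa only [eq_iff_iff, iff_false] using hP.eq (const False)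

@[fun_prop]
theorem and {P R : α → Prop} (hP : Comp S P) (hR : Comp S R) :
    Comp S (fun a => P a ∧ R a) := by
  simpa only [Prod.mk.injEq, eq_iff_iff, iff_true] using (hP.prodMk hR).eq (const (True, True))

@[fun_prop]
theorem or {P R : α → Prop} (hP : Comp S P) (hR : Comp S R) :
    Comp S (fun a => P a ∨ R a) := by
  simpa only [not_and_or, not_not] using (hP.not.and hR.not).not

theorem imp {P R : α → Prop} (hP : Comp S P) (hR : Comp S R) :
    Comp S (fun a => P a → R a) := by
  simpa only [imp_iff_not_or] using hP.not.or hR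

@[fun_prop]
theorem iff {P R : α → Prop} (hP : Comp S P) (hR : Comp S R) :
    Comp S (fun a => P a ↔ R a) := by
  simpa only [eq_iff_iff] using hP.eq hR

@[fun_prop]
theorem le {f g : α → M} (hf : Comp S f) (hg : Comp S g) : Comp S (fun a => f a ≤ g a) := by
  simpa only [not_lt] using (hg.lt hf).not

/-- For a variable bound this is a bounded quantifier in a formula; the bound `f a` is then
substituted by composition. -/
theorem ball {f : α → M} {P : α → M → Prop} (hf : Comp S f)
    (hP : Comp S (fun p : α × M => P p.1 p.2)) : Comp S (fun a => ∀ x < f a, P a x) := by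
  refine Comp.comp (g := fun p : α × M => ∀ x < p.2, P p.1 x) ?_ (Comp.id'.prodMk hf)
  rw [comp_prop_iff] at hP ⊢
  rw [dec_prod_iff] at hP ⊢
  have key : ∀ a x, RM.pair (RM.enc S a) x ∈
      {n | ∃ a b, n = RM.pair (RM.enc S a) (RM.enc S b) ∧ P a b} ↔ P a x := by
    intro a x
    constructor
    · rintro ⟨b, y, h, h'⟩
      obtain ⟨h1, rfl⟩ := pair_inj.1 h
      rwa [enc_inj.1 h1]
    · exact fun h => ⟨a, x, rfl, h⟩
  refine mem_of_ext (setOf_pair_mem (P := fun a t => a ∈ Set.range (Coded.enc S (α := α)) ∧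
      ∀ x < t, RM.pair a x ∈ {n | ∃ a b, n = RM.pair (RM.enc S a) (RM.enc S b) ∧ P a b})
    (.and (.mem Coded.range_mem (.var _)) (.ball
      (P := fun x v => RM.pair (v 1) x ∈
        {n | ∃ a b, n = RM.pair (RM.enc S a) (RM.enc S b) ∧ P a b})
      (.var _) (.mem hP (.pair (.var 2) (.var 0)))))) fun n => ?_
  constructor
  · rintro ⟨a, t, rfl, h⟩
    exact ⟨_, _, rfl, ⟨a, rfl⟩, fun x hx => (key a x).2 (h x hx)⟩
  · rintro ⟨_, t, rfl, ⟨a, rfl⟩, h⟩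
    exact ⟨a, t, rfl, fun x hx => (key a x).1 (h x hx)⟩

theorem bex {f : α → M} {P : α → M → Prop} (hf : Comp S f)
    (hP : Comp S (fun p : α × M => P p.1 p.2)) : Comp S (fun a => ∃ x < f a, P a x) := by
  simpa only [not_forall, not_not, exists_prop] using (ball (P := fun a x => ¬ P a x) hf hP.not).not

/-- `Δ⁰₁` comprehension. -/
theorem of_sigma {P : α → Prop} {A : α → β → Prop} {B : α → γ → Prop}
    (hA : Comp S (fun p : α × β => A p.1 p.2)) (hB : Comp S (fun p : α × γ => B p.1 p.2))
    (h : ∀ a, P a ↔ ∃ b, A a b) (h' : ∀ a, ¬ P a ↔ ∃ c, B a c) : Comp S P := by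
  rw [comp_prop_iff] at hA hB ⊢
  exact dec_of_def0
    (A := fun m n => RM.pair n m ∈ {m | ∃ p : α × β, m = RM.enc S p ∧ A p.1 p.2})
    (B := fun m n => RM.pair n m ∈ {m | ∃ p : α × γ, m = RM.enc S p ∧ B p.1 p.2})
    (.mem hA (.pair (.var 1) (.var 0))) (.mem hB (.pair (.var 1) (.var 0)))
    (fun a => (h a).trans exists_iff_exists_pair_mem)
    (fun a => (h' a).trans exists_iff_exists_pair_mem)

theorem of_graph {f : α → β} (h : Comp S (fun p : α × β => f p.1 = p.2)) : Comp S f := by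
  rw [comp_iff_dec_graph, ← comp_prop_iff]
  exact h

/-- A function with a `Σ⁰₁` graph exists in the model. -/
theorem of_sigma_graph {f : α → β} {A : α → β → γ → Prop}
    (hA : Comp S (fun p : α × β × γ => A p.1 p.2.1 p.2.2))
    (h : ∀ a b, f a = b ↔ ∃ c, A a b c) : Comp S f := by
  -- The complement of the graph is `Σ⁰₁` too: `f a ≠ b` holds if some other value is attained.
  refine of_graph (of_sigma (A := fun p c => A p.1 p.2 c)
    (B := fun (p : α × β) (q : β × γ) => q.1 ≠ p.2 ∧ A p.1 q.1 q.2)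
    (hA.comp (f := fun q : (α × β) × γ => (q.1.1, q.1.2, q.2)) (by fun_prop)) ?_ (fun p => h _ _) ?_)
  · refine Comp.and ?_ (hA.comp (f := fun q : (α × β) × β × γ => (q.1.1, q.2.1, q.2.2))
      (by fun_prop))
    simp only [ne_eq]
    fun_prop
  · rintro ⟨a, b⟩
    constructor
    · intro hab
      obtain ⟨c, hc⟩ := (h a (f a)).1 rfl
      exact ⟨(f a, c), hab, hc⟩
    · rintro ⟨⟨b', c⟩, hb, hc⟩ hab
      exact hb (((h a b').2 ⟨c, hc⟩).symm.trans hab)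

end Comp

theorem sigma_induction {P : M → α → Prop} (hP : Comp S (fun p : M × α => P p.1 p.2))
    (h0 : ∃ a, P 0 a) (hs : ∀ n a, P n a → ∃ b, P (n + 1) b) (n : M) : ∃ a, P n a := by
  rw [comp_prop_iff] at hP
  have key : ∀ n, (∃ a, P n a) ↔
      ∃ m, pair n m ∈ {m | ∃ p : M × α, m = enc S p ∧ P p.1 p.2} :=
    fun n => exists_iff_exists_pair_mem
  rw [key]
  refine hS.isModel.sigma1_induction (P := fun m n => pair n m ∈
    {m | ∃ p : M × α, m = enc S p ∧ P p.1 p.2}) (.mem hP (.pair (.var _) (.var _)))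
    ((key 0).1 h0) (fun n hn => ?_) n
  obtain ⟨a, ha⟩ := (key n).2 hn
  exact (key _).1 (hs n a ha)

theorem comp_induction (S : Set (Set M)) [Model S] {P : M → Prop} (hP : Comp S P) (h0 : P 0)
    (hs : ∀ n, P n → P (n + 1)) (n : M) : P n := by
  have := sigma_induction (S := S) (P := fun n (_ : M) => P n) (by fun_prop) ⟨0, h0⟩
    (fun n _ h => ⟨0, hs n h⟩) n
  exact this.choose_spec

theorem comp_strong_induction (S : Set (Set M)) [Model S] {P : M → Prop} (hP : Comp S P)
    (hs : ∀ n, (∀ m < n, P m) → P n) (n : M) : P n := by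
  have : ∀ n, ∀ m < n, P m := by
    refine comp_induction S (.ball (by fun_prop) (by fun_prop)) (by simp) (fun n h m hm => ?_)
    rcases (lt_add_one_iff.1 hm).lt_or_eq with hm | rfl
    exacts [h m hm, hs m h]
  exact hs n (this n)

theorem exists_least (S : Set (Set M)) [Model S] {P : M → Prop} (hP : Comp S P) (h : ∃ n, P n) :
    ∃ n, P n ∧ ∀ m < n, ¬ P m := by
  by_contra! hc
  obtain ⟨n, hn⟩ := h
  refine comp_strong_induction S hP.not (fun n h hn => ?_) n hn
  obtain ⟨m, hm, hm'⟩ := hc n hn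
  exact h m hm hm'

/-- The values of a function of the model on a proper initial segment of the numbers are bounded. -/
theorem exists_bound {f : M → M} (hf : Comp S f) (n : M) : ∃ b, ∀ m < n, f m < b := by
  refine sigma_induction (S := S) (P := fun n b => ∀ m < n, f m < b)
    (.ball (by fun_prop) (by fun_prop)) ⟨0, by simp⟩ (fun n b h => ⟨b + f n + 1, fun m hm => ?_⟩) n
  rcases (lt_add_one_iff.1 hm).lt_or_eq with hm | rfl
  · exact (h m hm).trans_le (by rw [add_assoc]; exact le_self_add)
  · exact lt_add_one_iff.2 le_add_self

end Coded

/-! ### Coding of finite sets, search and recursion -/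

section FiniteSets

set_option linter.unusedSectionVars false

variable {M : Type*} [CommSemiring M] [LinearOrder M] [DiscreteSemiring M]
variable {S : Set (Set M)} [Model S] {α β : Type*} [Coded S α] [Coded S β]

theorem Comp.dvd {f g : α → M} (hf : Comp S f) (hg : Comp S g) : Comp S (fun a => f a ∣ g a) := by
  have : Comp S (fun a => ∃ q < g a + 1, g a = f a * q) := .bex (by fun_prop) (by fun_prop)
  convert this using 2 with a
  constructor
  · rintro ⟨q, hq⟩
    rcases eq_or_ne (g a) 0 with h0 | h0
    · exact ⟨0, lt_add_one_iff.2 zero_le, by simp [h0]⟩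
    · refine ⟨q, lt_add_one_iff.2 ?_, hq⟩
      rw [hq] at h0 ⊢
      refine le_mul_of_one_le_left' (not_lt.1 fun h => h0 ?_)
      rw [lt_one_iff.1 h, zero_mul]
  · rintro ⟨q, -, hq⟩
    exact ⟨q, hq⟩

/-- Bounded collection follows from `Σ⁰₁` induction, as the bound can be enlarged for one `x` at a
time. -/
theorem exists_collection {R : M → M → Prop} (hR : Comp S (fun p : M × M => R p.1 p.2)) {n : M}
    (h : ∀ x < n, ∃ b, R x b) : ∃ b, ∀ x < n, ∃ c < b, R x c := by
  -- The condition `x < n` is kept inside because the induction runs over all `k`, also beyond `n`.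
  have := sigma_induction (S := S) (P := fun k b => ∀ x < k, x < n → ∃ c < b, R x c)
    (.ball (by fun_prop) (.imp (by fun_prop) (.bex (by fun_prop)
      (hR.comp (f := fun q : ((M × M) × M) × M => (q.1.2, q.2)) (by fun_prop)))))
    ⟨0, by simp⟩ (fun k b hb => ?_) n
  · obtain ⟨b, hb⟩ := this
    exact ⟨b, fun x hx => hb x hx hx⟩
  · by_cases hk : k < n
    · obtain ⟨c, hc⟩ := h k hk
      refine ⟨b + (c + 1), fun x hx hxn => ?_⟩
      rcases (lt_add_one_iff.1 hx).lt_or_eq with hx | rfl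
      · obtain ⟨c', h1, h2⟩ := hb x hx hxn
        exact ⟨c', h1.trans_le le_self_add, h2⟩
      · exact ⟨c, add_one_le_iff.1 le_add_self, hc⟩
    · refine ⟨b, fun x hx hxn => hb x ?_ hxn⟩
      exact hxn.trans_le (not_lt.1 hk)

/-- Two numbers are coprime in the sense of Bézout. -/
def Bezout (a b : M) : Prop := ∃ u v, a * u = b * v + 1

theorem Bezout.symm {a b : M} (h : Bezout a b) (hb : b ≠ 0) : Bezout b a := by
  obtain ⟨u, v, h⟩ := h
  rcases eq_or_ne v 0 with rfl | hv
  · rcases eq_or_ne a 0 with rfl | ha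
    · simp at h
    · obtain ⟨a', rfl⟩ : ∃ a', a = a' + 1 := by
        obtain ⟨c, hc⟩ := exists_add_of_le (add_one_le_iff.2 (pos_iff_ne_zero.2 ha))
        exact ⟨c, by rw [hc]; ring⟩
      obtain ⟨b', rfl⟩ : ∃ b', b = b' + 1 := by
        obtain ⟨c, hc⟩ := exists_add_of_le (add_one_le_iff.2 (pos_iff_ne_zero.2 hb))
        exact ⟨c, by rw [hc]; ring⟩
      refine ⟨1, b' * u, ?_⟩
      have : (a' + 1) * (b' * u) = b' * ((a' + 1) * u) := by ring
      rw [this, h]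
      ring
  · obtain ⟨w, hw⟩ : ∃ w, b * v = w + 1 := by
      obtain ⟨c, hc⟩ := exists_add_of_le (add_one_le_iff.2 (pos_iff_ne_zero.2 (mul_ne_zero hb hv)))
      exact ⟨c, by rw [hc]; ring⟩
    -- With `b v = w + 1` and `a u = w + 2`, the identity is `(w + 1)² = (w + 2) w + 1`; no
    -- subtraction is needed.
    refine ⟨b * v * v, u * w, ?_⟩
    have e1 : b * (b * v * v) = (b * v) * (b * v) := by ring
    have e2 : a * (u * w) = (a * u) * w := by ring
    rw [e1, e2, h, hw]
    ring

theorem Bezout.mul {a b c : M} (h : Bezout a c) (h' : Bezout b c) : Bezout (a * b) c := by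
  obtain ⟨u, v, h⟩ := h
  obtain ⟨u', v', h'⟩ := h'
  refine ⟨u * u', c * v * v' + v + v', ?_⟩
  calc a * b * (u * u') = (a * u) * (b * u') := by ring
    _ = _ := by rw [h, h']; ring

/-- With `N = a x = b y` and `a u = b v + 1`, the number `N` is the difference of the multiples `a b
y u` and `a b x v` of `a b`. -/
theorem Bezout.mul_dvd {a b N : M} (h : Bezout a b) (ha : a ∣ N) (hb : b ∣ N) : a * b ∣ N := by
  obtain ⟨u, v, h⟩ := h
  obtain ⟨x, hx⟩ := ha
  obtain ⟨y, hy⟩ := hb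
  have e : a * b * (y * u) = a * b * (x * v) + N := by
    calc a * b * (y * u) = (b * y) * (a * u) := by ring
      _ = N * (b * v) + N := by rw [← hy, h]; ring
      _ = a * b * (x * v) + N := by nth_rewrite 1 [hx]; ring
  have hle : a * b * (x * v) ≤ a * b * (y * u) := e ▸ le_self_add
  rcases eq_or_ne (a * b) 0 with h0 | h0
  · rw [h0] at e ⊢
    simp only [zero_mul, zero_add] at e
    rw [← e]
  · obtain ⟨c, hc⟩ := exists_add_of_le (le_of_mul_le_mul_left hle (pos_iff_ne_zero.2 h0))
    refine ⟨c, ?_⟩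
    rw [hc, mul_add] at e
    exact (add_left_cancel e).symm

/-- Let `m = d e` and `A = m (i + 1) + 1`. Modulo `A`, the other number is `m d`, and `e m d = m²`,
while `m (i + 1)` is `-1`. So `(i + 1)² e` is an inverse, which explains the first coefficient. -/
theorem bezout_of_dvd {m i d : M} (hd : d ∣ m) :
    Bezout (m * (i + d + 1) + 1) (m * (i + 1) + 1) := by
  obtain ⟨e, rfl⟩ := hd
  rcases eq_or_ne e 0 with rfl | he
  · exact ⟨1, 0, by simp⟩
  · obtain ⟨e', rfl⟩ : ∃ e', e = e' + 1 := by
      obtain ⟨c, hc⟩ := exists_add_of_le (add_one_le_iff.2 (pos_iff_ne_zero.2 he))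
      exact ⟨c, by rw [hc]; ring⟩
    refine ⟨(i + 1) * (i + 1) * (e' + 1), (i + 1) * (i + d) * (e' + 1) + i * (e' + 1) + e', ?_⟩
    ring

/-- The numbers `m * (x + 1) + 1` with `x < k` are pairwise coprime divisors of `N`. -/
def IsModuli (k m N : M) : Prop :=
  (0 < N ∧ 0 < m) ∧ (∀ d < k, d + 1 ∣ m) ∧ ∀ x < k, m * (x + 1) + 1 ∣ N

theorem IsModuli.bezout {k m N x y : M} (h : IsModuli k m N) (hx : x < k) (hy : y < k)
    (hxy : x ≠ y) : Bezout (m * (x + 1) + 1) (m * (y + 1) + 1) := by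
  have key : ∀ {i j : M}, j < k → i < j → Bezout (m * (j + 1) + 1) (m * (i + 1) + 1) := by
    intro i j hj hij
    obtain ⟨c, rfl⟩ := exists_add_of_le (add_one_le_iff.2 hij)
    have := h.2.1 c (lt_of_le_of_lt le_add_self hj)
    have := bezout_of_dvd (i := i) this
    convert this using 3
    ring
  rcases lt_or_gt_of_ne hxy with h' | h'
  · exact (key hy h').symm (by simp)
  · exact key hx h'

theorem Bezout.not_dvd {n m x : M} (hm : 0 < m) (h : Bezout n (m * (x + 1) + 1)) :
    ¬ m * (x + 1) + 1 ∣ n := by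
  rintro ⟨c, rfl⟩
  obtain ⟨u, v, h⟩ := h
  have h1 : (m * (x + 1) + 1) * v < (m * (x + 1) + 1) * (c * u) := by
    rw [← mul_assoc, h]
    exact lt_add_one_iff.2 le_rfl
  have h2 := mul_le_mul_right (add_one_le_iff.2 (lt_of_mul_lt_mul_left h1 zero_le))
    (m * (x + 1) + 1)
  rw [← mul_assoc, h, mul_add, mul_one] at h2
  have h3 := le_of_add_le_add_left h2
  exact absurd (add_one_le_iff.1 h3)
    (not_lt.2 (add_one_le_iff.2 (mul_pos hm (lt_add_one_iff.2 zero_le)) |>.trans' (by simp)))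

theorem Comp.isModuli {f g h : α → M} (hf : Comp S f) (hg : Comp S g) (hh : Comp S h) :
    Comp S (fun a => IsModuli (f a) (g a) (h a)) := by
  refine .and (by fun_prop) (.and (.ball hf (.dvd (by fun_prop) (by fun_prop)))
    (.ball hf (.dvd (by fun_prop) (by fun_prop))))

theorem exists_isModuli (S : Set (Set M)) [Model S] (k : M) : ∃ m N, IsModuli k m N := by
  obtain ⟨m, hm0, hm⟩ : ∃ m, 0 < m ∧ ∀ d < k, d + 1 ∣ m := by
    refine sigma_induction (S := S) (P := fun k (m : M) => 0 < m ∧ ∀ d < k, d + 1 ∣ m)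
      (.and (by fun_prop) (.ball (by fun_prop) (.dvd (by fun_prop) (by fun_prop))))
      ⟨1, by simp⟩ (fun k m h => ⟨m * (k + 1), mul_pos h.1 (lt_add_one_iff.2 zero_le),
        fun d hd => ?_⟩) k
    rcases (lt_add_one_iff.1 hd).lt_or_eq with hd | rfl
    · exact (h.2 d hd).mul_right _
    · exact Dvd.intro_left _ rfl
  obtain ⟨N, hN, hN'⟩ : ∃ N : M, 0 < N ∧ ∀ x < k, m * (x + 1) + 1 ∣ N := by
    refine sigma_induction (S := S)
      (P := fun k (N : M) => 0 < N ∧ ∀ x < k, m * (x + 1) + 1 ∣ N)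
      (.and (by fun_prop) (.ball (by fun_prop) (.dvd (by fun_prop) (by fun_prop)))) ⟨1, by simp⟩
      (fun k N h => ⟨N * (m * (k + 1) + 1), mul_pos h.1 (lt_add_one_iff.2 zero_le),
        fun x hx => ?_⟩) k
    rcases (lt_add_one_iff.1 hx).lt_or_eq with hx | rfl
    · exact (h.2 x hx).mul_right _
    · exact Dvd.intro_left _ rfl
  exact ⟨m, N, ⟨hN, hm0⟩, hm, hN'⟩

theorem Bezout.exists_lt {a b : M} (h : Bezout a b) :
    ∃ c, ∃ u < c, ∃ v < c, a * u = b * v + 1 := by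
  obtain ⟨u, v, h⟩ := h
  exact ⟨u + v + 1, u, lt_add_one_iff.2 le_self_add, v, lt_add_one_iff.2 le_add_self, h⟩

/-- The number `n` is the product of the moduli that belong to the `x` with `P x`. The induction
also carries Bézout identities between `n` and the moduli not yet used; their coefficients are
bounded by the second witness, so that the induction hypothesis remains `Σ⁰₁`. -/
theorem IsModuli.exists_dvd_iff {k m N : M} (h : IsModuli k m N) {P : M → Prop}
    (hP : Comp S P) : ∃ n, n ∣ N ∧ ∀ x < k, (m * (x + 1) + 1 ∣ n ↔ P x) := by
  have key : ∃ p : M × M, p.1 ∣ N ∧ ∀ x < k, (x < k ∧ P x → m * (x + 1) + 1 ∣ p.1) ∧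
      (¬ (x < k ∧ P x) → ∃ b < p.2, ∃ u < b, ∃ v < b, p.1 * u = (m * (x + 1) + 1) * v + 1) := by
    refine sigma_induction (S := S)
      (P := fun j (p : M × M) => p.1 ∣ N ∧ ∀ x < k, (x < j ∧ P x → m * (x + 1) + 1 ∣ p.1) ∧
      (¬ (x < j ∧ P x) → ∃ b < p.2, ∃ u < b, ∃ v < b, p.1 * u = (m * (x + 1) + 1) * v + 1))
      ?_ ⟨(1, 1 + 1 + 1), ?_⟩ ?_ k
    · refine .and (.dvd (by fun_prop) (by fun_prop)) (.ball (by fun_prop) (.and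
        (.imp (by fun_prop) (.dvd (by fun_prop) (by fun_prop)))
        (.imp (by fun_prop) (.bex (by fun_prop) (.bex (by fun_prop) (.bex (by fun_prop)
          (by fun_prop)))))))
    · refine ⟨one_dvd _, fun x hx => ⟨fun h => absurd h.1 not_lt_zero, fun _ => ?_⟩⟩
      -- For the empty product the coefficients are `1` and `0`, both below `1 + 1`, which is below
      -- the initial bound.
      exact ⟨1 + 1, lt_add_one_iff.2 le_rfl, 1, lt_add_one_iff.2 le_rfl, 0,
        lt_add_one_iff.2 zero_le, by simp⟩
    · rintro j ⟨n, b⟩ ⟨hn, hb⟩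
      by_cases hj : j < k ∧ P j
      · have hbez : ∀ x < k, ¬ (x < j ∧ P x) → Bezout n (m * (x + 1) + 1) := by
          intro x hx hx'
          obtain ⟨c, -, u, -, v, -, huv⟩ := (hb x hx).2 hx'
          exact ⟨u, v, huv⟩
        have hbez' : ∀ x < k, ∃ c, ¬ (x < j + 1 ∧ P x) → ∃ u < c, ∃ v < c,
            (n * (m * (j + 1) + 1)) * u = (m * (x + 1) + 1) * v + 1 := by
          intro x hx
          by_cases hx' : x < j + 1 ∧ P x
          · exact ⟨0, fun h => absurd hx' h⟩
          · have hxj : j ≠ x := by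
              rintro rfl
              exact hx' ⟨lt_add_one_iff.2 le_rfl, hj.2⟩
            obtain ⟨c, hc⟩ := ((hbez x hx fun h => hx' ⟨lt_add_one_iff.2 h.1.le, h.2⟩).mul
              (h.bezout hj.1 hx hxj)).exists_lt
            exact ⟨c, fun _ => hc⟩
        -- Each remaining modulus gets new Bézout coefficients; collection bounds them all at once.
        obtain ⟨B, hB⟩ := exists_collection (S := S) (.imp (by fun_prop) (.bex (by fun_prop)
          (.bex (by fun_prop) (by fun_prop)))) hbez'
        refine ⟨(n * (m * (j + 1) + 1), B), ?_, fun x hx => ⟨fun hx' => ?_, fun hx' => ?_⟩⟩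
        · exact (hbez j hj.1 (by simp)).mul_dvd hn (h.2.2 j hj.1)
        · rcases (lt_add_one_iff.1 hx'.1).lt_or_eq with h1 | rfl
          · exact ((hb x hx).1 ⟨h1, hx'.2⟩).mul_right _
          · exact Dvd.intro_left _ rfl
        · obtain ⟨c, hc, h'⟩ := hB x hx
          exact ⟨c, hc, h' hx'⟩
      · refine ⟨(n, b), hn, fun x hx => ?_⟩
        have : x < j + 1 ∧ P x ↔ x < j ∧ P x := by
          rw [lt_add_one_iff, le_iff_lt_or_eq]
          constructor
          · rintro ⟨h1 | rfl, h2⟩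
            exacts [⟨h1, h2⟩, absurd ⟨hx, h2⟩ hj]
          · exact fun h => ⟨.inl h.1, h.2⟩
        rw [this]
        exact hb x hx
  obtain ⟨⟨n, b⟩, hn, hb⟩ := key
  refine ⟨n, hn, fun x hx => ⟨fun hd => ?_, fun hPx => (hb x hx).1 ⟨hx, hPx⟩⟩⟩
  by_contra hPx
  obtain ⟨c, -, u, -, v, -, huv⟩ := (hb x hx).2 (fun h => hPx h.2)
  exact Bezout.not_dvd h.1.2 ⟨u, v, huv⟩ hd

theorem elt_pair_iff {k m n x : M} :
    Elt x (pair k (pair m n)) ↔ x < k ∧ m * (x + 1) + 1 ∣ n := by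
  constructor
  · rintro ⟨k', m', n', h, hx, q, hq⟩
    obtain ⟨h1, h2⟩ := pair_inj.1 h
    obtain ⟨h3, h4⟩ := pair_inj.1 h2
    subst h1 h3 h4
    exact ⟨hx, q, by rw [hq, mul_comm]⟩
  · rintro ⟨hx, q, hq⟩
    exact ⟨k, m, n, rfl, hx, q, by rw [hq, mul_comm]⟩

theorem Elt.lt {x c : M} (h : Elt x c) : x < c := by
  obtain ⟨k, m, n, rfl, hx, -⟩ := h
  exact hx.trans_le (left_le_pair _ _)

@[fun_prop]
theorem Comp.elt {f g : α → M} (hf : Comp S f) (hg : Comp S g) :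
    Comp S (fun a => Elt (f a) (g a)) := by
  have : Comp S (fun a => ∃ k < g a + 1, ∃ m < g a + 1, ∃ n < g a + 1,
      g a = RM.pair k (RM.pair m n) ∧ f a < k ∧ m * (f a + 1) + 1 ∣ n) :=
    .bex (by fun_prop) (.bex (by fun_prop) (.bex (by fun_prop) (.and (by fun_prop)
      (.and (by fun_prop) (.dvd (by fun_prop) (by fun_prop))))))
  convert this using 2 with a
  constructor
  · rintro ⟨k, m, n, h, hx, q, hq⟩
    refine ⟨k, ?_, m, ?_, n, ?_, h, hx, q, by rw [hq, mul_comm]⟩ <;>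
      rw [lt_add_one_iff, h]
    · exact left_le_pair _ _
    · exact (left_le_pair _ _).trans (right_le_pair _ _)
    · exact (right_le_pair _ _).trans (right_le_pair _ _)
  · rintro ⟨k, -, m, -, n, -, h, hx, hd⟩
    rw [h, elt_pair_iff]
    exact ⟨hx, hd⟩

theorem isFin_iff {c : M} : IsFin c ↔ ∀ c' < c, ¬ ∀ x < c, Elt x c' ↔ Elt x c := by
  refine forall₂_congr fun c' hc' => not_congr ⟨fun h x _ => h x, fun h x => ?_⟩
  by_cases hx : x < c
  · exact h x hx
  · exact ⟨fun h => absurd (h.lt.trans hc') hx, fun h => absurd h.lt hx⟩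

@[fun_prop]
theorem Comp.isFin {f : α → M} (hf : Comp S f) : Comp S (fun a => IsFin (f a)) := by
  simp only [isFin_iff]
  exact .ball hf (.not (.ball (by fun_prop) (by fun_prop)))

theorem IsFin.ext {c c' : M} (hc : IsFin c) (hc' : IsFin c') (h : ∀ x, Elt x c ↔ Elt x c') :
    c = c' := by
  rcases lt_trichotomy c c' with h' | h' | h'
  · exact absurd h (hc' c h')
  · exact h'
  · exact absurd (fun x => (h x).symm) (hc c' h')

theorem exists_isFin_le (S : Set (Set M)) [Model S] (c : M) :
    ∃ c' ≤ c, IsFin c' ∧ ∀ x, Elt x c' ↔ Elt x c := by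
  obtain ⟨c', hc', hmin⟩ := exists_least S (P := fun c' => c' ≤ c ∧ ∀ x < c, Elt x c' ↔ Elt x c)
    (.and (by fun_prop) (.ball (by fun_prop) (by fun_prop))) ⟨c, le_rfl, fun _ _ => Iff.rfl⟩
  have key : ∀ x, Elt x c' ↔ Elt x c := by
    intro x
    by_cases hx : x < c
    · exact hc'.2 x hx
    · exact ⟨fun h => absurd (h.lt.trans_le hc'.1) hx, fun h => absurd h.lt hx⟩
  refine ⟨c', hc'.1, fun d hd hd' => hmin d hd ⟨hd.le.trans hc'.1, fun x _ => ?_⟩, key⟩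
  rw [hd', key]

/-- The bound does not depend on `P`, because all the products used as codes divide the same `N`. -/
theorem IsModuli.exists_isFin_le {k m N : M} (h : IsModuli k m N) {P : M → Prop}
    (hP : Comp S P) : ∃ c ≤ pair k (pair m N), IsFin c ∧ ∀ x, Elt x c ↔ x < k ∧ P x := by
  obtain ⟨n, hn, hn'⟩ := h.exists_dvd_iff hP
  obtain ⟨c, hc, hfin, hc'⟩ := RM.exists_isFin_le S (pair k (pair m n))
  refine ⟨c, hc.trans (pair_le_pair le_rfl (pair_le_pair le_rfl ?_)), hfin, fun x => ?_⟩
  · obtain ⟨q, rfl⟩ := hn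
    refine le_mul_of_one_le_right' (not_lt.1 fun hq => ?_)
    have := h.1.1
    rw [lt_one_iff.1 hq, mul_zero] at this
    exact lt_irrefl _ this
  · rw [hc', elt_pair_iff]
    exact and_congr_right fun hx => hn' x hx

/-- The functions of the model are closed under unbounded search. -/
theorem Comp.exists_least_choice {P : α → M → Prop} (hP : Comp S (fun p : α × M => P p.1 p.2))
    (h : ∀ a, ∃ n, P a n) :
    ∃ f : α → M, Comp S f ∧ (∀ a, P a (f a)) ∧ ∀ a n, P a n → f a ≤ n := by
  have : ∀ a, ∃ n, P a n ∧ ∀ m < n, ¬ P a m := fun a =>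
    exists_least S (hP.comp (f := fun n : M => (a, n)) (by fun_prop)) (h a)
  choose f hf hf' using this
  refine ⟨f, .of_graph ?_, hf, fun a n hn => not_lt.1 fun h => hf' a n h hn⟩
  have hc : Comp S (fun p : α × M => P p.1 p.2 ∧ ∀ m < p.2, ¬ P p.1 m) :=
    hP.and (.ball (by fun_prop)
      (hP.comp (f := fun q : (α × M) × M => (q.1.1, q.2)) (by fun_prop)).not)
  convert hc using 2 with p
  constructor
  · intro h'
    rw [← h']
    exact ⟨hf _, hf' _⟩
  · rintro ⟨h1, h2⟩
    rcases lt_trichotomy (f p.1) p.2 with h' | h' | h'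
    · exact absurd (hf _) (h2 _ h')
    · exact h'
    · exact absurd h1 (hf' _ _ h')

theorem Comp.exists_choice {P : α → M → Prop} (hP : Comp S (fun p : α × M => P p.1 p.2))
    (h : ∀ a, ∃ n, P a n) : ∃ f : α → M, Comp S f ∧ ∀ a, P a (f a) := by
  obtain ⟨f, hf, hf', -⟩ := Comp.exists_least_choice hP h
  exact ⟨f, hf, hf'⟩

/-- The codes of the subsets of `[0, k)` are bounded by a function of `k`. -/
theorem exists_code_bound (S : Set (Set M)) [Model S] : ∃ f : M → M, Comp S f ∧
    ∀ k c, IsFin c → (∀ x, Elt x c → x < k) → c ≤ f k := by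
  have hex : ∀ k : M, ∃ b, ∃ m < b, ∃ N < b, IsModuli k m N ∧ pair k (pair m N) = b := by
    intro k
    obtain ⟨m, N, h⟩ := exists_isModuli S k
    refine ⟨_, m, ?_, N, ?_, h, rfl⟩
    · refine lt_of_lt_of_le ?_ (right_le_pair _ _)
      refine lt_of_lt_of_le ?_ (add_le_pair _ _)
      exact lt_add_of_pos_right _ h.1.1
    · refine lt_of_lt_of_le ?_ (right_le_pair _ _)
      refine lt_of_lt_of_le ?_ (add_le_pair _ _)
      exact lt_add_of_pos_left _ h.1.2
  obtain ⟨f, hf, hf'⟩ := Comp.exists_choice (S := S)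
    (P := fun k b => ∃ m < b, ∃ N < b, IsModuli k m N ∧ pair k (pair m N) = b)
    (.bex (by fun_prop) (.bex (by fun_prop) (.and (.isModuli (by fun_prop) (by fun_prop)
      (by fun_prop)) (by fun_prop)))) hex
  refine ⟨f, hf, fun k c hc hck => ?_⟩
  obtain ⟨m, -, N, -, h, h'⟩ := hf' k
  obtain ⟨d, hd, hfin, hd'⟩ := h.exists_isFin_le (S := S) (P := fun x => Elt x c) (by fun_prop)
  rw [← h']
  convert hd
  exact hc.ext hfin fun x => by rw [hd']; exact ⟨fun h => ⟨hck x h, h⟩, fun h => h.2⟩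

/-- The code of the finite set of the `x < n` with `P x`. -/
noncomputable def fcode (P : M → Prop) (n : M) : M :=
  Classical.epsilon fun c => IsFin c ∧ ∀ x, Elt x c ↔ x < n ∧ P x

theorem fcode_congr {P R : M → Prop} {n : M} (h : ∀ x < n, (P x ↔ R x)) :
    fcode P n = fcode R n := by
  have : ∀ x, (x < n ∧ P x) ↔ (x < n ∧ R x) := fun x => and_congr_right (h x)
  simp only [fcode, this]

theorem fcode_spec {P : M → Prop} (hP : Comp S P) (n : M) :
    IsFin (fcode P n) ∧ ∀ x, Elt x (fcode P n) ↔ x < n ∧ P x := by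
  have : ∃ c, IsFin c ∧ ∀ x, Elt x c ↔ x < n ∧ P x := by
    obtain ⟨m, N, h⟩ := exists_isModuli S n
    obtain ⟨c, -, hc⟩ := h.exists_isFin_le hP
    exact ⟨c, hc⟩
  exact Classical.epsilon_spec this

theorem isFin_fcode {P : M → Prop} (hP : Comp S P) (n : M) : IsFin (fcode P n) :=
  (fcode_spec hP n).1

theorem elt_fcode {P : M → Prop} (hP : Comp S P) {n x : M} :
    Elt x (fcode P n) ↔ x < n ∧ P x :=
  (fcode_spec hP n).2 x

theorem Comp.fcode {P : α → M → Prop} (hP : Comp S (fun p : α × M => P p.1 p.2)) {f : α → M}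
    (hf : Comp S f) : Comp S (fun a => RM.fcode (P a) (f a)) := by
  have hP' : ∀ a, Comp S (P a) := fun a => hP.comp (f := fun x : M => (a, x)) (by fun_prop)
  have : Comp S (fun p : α × M => IsFin p.2 ∧ (∀ x < p.2, Elt x p.2 → x < f p.1) ∧
      ∀ x < f p.1, (Elt x p.2 ↔ P p.1 x)) :=
    .and (by fun_prop) (.and (.ball (by fun_prop) (.imp (by fun_prop) (by fun_prop)))
      (.ball (by fun_prop) (.iff (by fun_prop)
        (hP.comp (f := fun q : (α × M) × M => (q.1.1, q.2)) (by fun_prop)))))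
  refine .of_graph ?_
  convert this using 2 with p
  constructor
  · rintro h
    obtain ⟨h1, h2⟩ := fcode_spec (hP' p.1) (f p.1)
    rw [h] at h1 h2
    refine ⟨h1, fun x _ hx => ((h2 x).1 hx).1, fun x hx => ?_⟩
    rw [h2]
    simp [hx]
  · rintro ⟨h1, h2, h3⟩
    refine (isFin_fcode (hP' _) _).ext h1 fun x => ?_
    rw [elt_fcode (hP' _)]
    exact ⟨fun h => (h3 x h.1).2 h.2, fun h => ⟨h2 x h.lt h, (h3 x (h2 x h.lt h)).1 h⟩⟩

/-- The pairs in `c` whose first entry is below `i`. -/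
noncomputable def below (c i : M) : M := fcode (fun x => Elt x c ∧ ∃ j < i, ∃ v < c, x = pair j v) c

theorem elt_below (S : Set (Set M)) [Model S] {c i x : M} :
    Elt x (below c i) ↔ Elt x c ∧ ∃ j < i, ∃ v, x = pair j v := by
  have hc : Comp S (fun x : M => Elt x c ∧ ∃ j < i, ∃ v < c, x = pair j v) :=
    .and (by fun_prop) (.bex (by fun_prop) (.bex (by fun_prop) (by fun_prop)))
  rw [below, elt_fcode hc]
  constructor
  · rintro ⟨h, h', j, hj, v, -, hv⟩
    exact ⟨h', j, hj, v, hv⟩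
  · rintro ⟨h, j, hj, v, hv⟩
    exact ⟨h.lt, h, j, hj, v, (right_le_pair j v).trans_lt (hv ▸ h.lt), hv⟩

theorem isFin_below (S : Set (Set M)) [Model S] (c i : M) : IsFin (below c i) :=
  isFin_fcode (S := S)
    (.and (by fun_prop) (.bex (by fun_prop) (.bex (by fun_prop) (by fun_prop)))) _

@[fun_prop]
theorem Comp.below {f g : α → M} (hf : Comp S f) (hg : Comp S g) :
    Comp S (fun a => RM.below (f a) (g a)) := by
  refine .fcode (P := fun a x => Elt x (f a) ∧ ∃ j < g a, ∃ v < f a, x = RM.pair j v) ?_ hf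
  exact .and (by fun_prop) (.bex (by fun_prop) (.bex (by fun_prop) (by fun_prop)))

/-- Course-of-values recursion: `E n` may depend on the finite set of the pairs `(i, E i)` with
`i < n`. -/
theorem exists_rec_graph {Φ : M × M → M} (hΦ : Comp S Φ) : ∃ E : M → M, Comp S E ∧
    ∀ n, ∃ c, (∀ x, Elt x c ↔ ∃ i < n, x = pair i (E i)) ∧ E n = Φ (n, c) := by
  -- `A n c` says that `c` is the finite graph of the recursion up to `n`: each value is computed
  -- from the part of `c` before it.
  let A : M → M → Prop := fun n c => (∀ x < c, Elt x c → ∃ i < n, x = pair i (Φ (i, below c i))) ∧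
    ∀ i < n, Elt (pair i (Φ (i, below c i))) c
  have hA : Comp S (fun p : M × M => A p.1 p.2) :=
    .and (.ball (by fun_prop) (.imp (by fun_prop) (.bex (by fun_prop) (by fun_prop))))
      (.ball (by fun_prop) (by fun_prop))
  have hA' : ∀ {n c}, A n c → ∀ x, Elt x c ↔ ∃ i < n, x = pair i (Φ (i, below c i)) := by
    refine fun h x => ⟨fun hx => h.1 x hx.lt hx, ?_⟩
    rintro ⟨i, hi, rfl⟩
    exact h.2 i hi
  have hex : ∀ n, ∃ c, A n c := by
    refine sigma_induction hA ?_ (fun n c hc => ?_)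
    · have hF : Comp S (fun _ : M => False) := .const _
      refine ⟨fcode (fun _ => False) 0, fun x _ hx => absurd ((elt_fcode hF).1 hx).2 id, ?_⟩
      exact fun i hi => absurd hi not_lt_zero
    · let w := pair n (Φ (n, below c n))
      have hP : Comp S (fun x => Elt x c ∨ x = w) := by fun_prop
      let d := fcode (fun x => Elt x c ∨ x = w) (c + (w + 1))
      have hd : ∀ x, Elt x d ↔ Elt x c ∨ x = w := by
        intro x
        rw [elt_fcode hP]
        refine ⟨fun h => h.2, fun h => ⟨?_, h⟩⟩
        rcases h with h | rfl
        · exact h.lt.trans_le le_self_add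
        · exact lt_of_lt_of_le (lt_add_one_iff.2 le_rfl) le_add_self
      -- The new pair has first entry `n`, so it changes none of the parts from which values up to
      -- `n` are computed.
      have hb : ∀ i ≤ n, below d i = below c i := by
        intro i hi
        refine (isFin_below S _ _).ext (isFin_below S _ _) fun x => ?_
        rw [elt_below S, elt_below S, hd]
        refine and_congr_left fun ⟨j, hj, v, hv⟩ => ⟨fun h => h.resolve_right ?_, .inl⟩
        intro hx
        exact (hj.trans_le hi).ne (pair_inj.1 (hv.symm.trans hx)).1
      refine ⟨d, fun x _ hx => ?_, fun i hi => ?_⟩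
      · rcases (hd x).1 hx with hx | rfl
        · obtain ⟨i, hi, h⟩ := (hA' hc x).1 hx
          exact ⟨i, lt_add_one_iff.2 hi.le, by rw [hb i hi.le, h]⟩
        · exact ⟨n, lt_add_one_iff.2 le_rfl, by rw [hb n le_rfl]⟩
      · rw [hb i (lt_add_one_iff.1 hi), hd]
        rcases (lt_add_one_iff.1 hi).lt_or_eq with hi | rfl
        · exact .inl (hc.2 i hi)
        · exact .inr rfl
  -- Two finite approximations agree as far as both are defined, so any of them may serve as witness
  -- for the `Σ⁰₁` graph of `E`.
  have huniq : ∀ {n c n' c'}, A n c → A n' c' → ∀ i, i ≤ n → i ≤ n' → below c i = below c' i := by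
    intro n c n' c' hc hc'
    refine comp_strong_induction S (.imp (by fun_prop) (.imp (by fun_prop) (by fun_prop)))
      (fun i ih hi hi' => ?_)
    refine (isFin_below S _ _).ext (isFin_below S _ _) fun x => ?_
    rw [elt_below S, elt_below S]
    refine and_congr_left fun ⟨j, hj, v, hv⟩ => ?_
    have e := ih j hj (hj.le.trans hi) (hj.le.trans hi')
    rw [hA' hc, hA' hc']
    subst hv
    constructor
    · rintro ⟨k, hk, h⟩
      obtain ⟨rfl, rfl⟩ := pair_inj.1 h
      exact ⟨j, hj.trans_le hi', by rw [e]⟩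
    · rintro ⟨k, hk, h⟩
      obtain ⟨rfl, rfl⟩ := pair_inj.1 h
      exact ⟨j, hj.trans_le hi, by rw [e]⟩
  choose C hC using hex
  have hE : ∀ {n c i}, A n c → i ≤ n → Φ (i, below (C i) i) = Φ (i, below c i) :=
    fun h hi => by rw [huniq (hC _) h _ le_rfl hi]
  refine ⟨fun n => Φ (n, below (C n) n), ?_, fun n => ⟨below (C n) n, fun x => ?_, rfl⟩⟩
  · refine .of_sigma_graph (A := fun n v c => A n c ∧ Φ (n, below c n) = v)
      (.and (hA.comp (f := fun q : M × M × M => (q.1, q.2.2)) (by fun_prop)) (by fun_prop)) ?_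
    intro n v
    constructor
    · exact fun h => ⟨C n, hC n, h⟩
    · rintro ⟨c, hc, h⟩
      rw [← h]
      exact hE hc le_rfl
  · rw [elt_below S, hA' (hC n)]
    constructor
    · rintro ⟨⟨i, hi, rfl⟩, -⟩
      exact ⟨i, hi, congrArg (pair i) (hE (hC n) hi.le).symm⟩
    · rintro ⟨i, hi, rfl⟩
      exact ⟨⟨i, hi, congrArg (pair i) (hE (hC n) hi.le)⟩, i, hi, _, rfl⟩

/-- A function that evaluates finite functions. -/
theorem exists_lookup (S : Set (Set M)) [Model S] : ∃ ap : M × M → M, Comp S ap ∧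
    ∀ c i v, (∀ v', Elt (pair i v') c ↔ v' = v) → ap (c, i) = v := by
  obtain ⟨ap, hap, h⟩ := Comp.exists_choice (S := S)
    (P := fun (p : M × M) v => Elt (pair p.2 v) p.1 ∨ ∀ v' < p.1, ¬ Elt (pair p.2 v') p.1)
    (.or (by fun_prop) (.ball (by fun_prop) (by fun_prop))) (by
      rintro ⟨c, i⟩
      by_cases h : ∃ v, Elt (pair i v) c
      · exact ⟨_, .inl h.choose_spec⟩
      · push Not at h
        exact ⟨0, .inr fun v _ => h v⟩)
  refine ⟨ap, hap, fun c i v hv => ?_⟩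
  have hvc := (hv v).2 rfl
  rcases h (c, i) with h | h
  · exact (hv _).1 h
  · exact absurd hvc (h v ((right_le_pair _ _).trans_lt hvc.lt))

/-- Course-of-values recursion for functions, in terms of an evaluation function `ap`. -/
theorem exists_rec (S : Set (Set M)) [Model S] : ∃ ap : M × M → M, Comp S ap ∧
    ∀ Φ : M × M → M, Comp S Φ → ∃ E : M → M, Comp S E ∧
      ∀ n, ∃ c, (∀ i < n, ap (c, i) = E i) ∧ E n = Φ (n, c) := by
  obtain ⟨ap, hap, h⟩ := exists_lookup S
  refine ⟨ap, hap, fun Φ hΦ => ?_⟩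
  obtain ⟨E, hE, h'⟩ := exists_rec_graph hΦ
  refine ⟨E, hE, fun n => ?_⟩
  obtain ⟨c, hc, hc'⟩ := h' n
  refine ⟨c, fun i hi => h c i _ fun v => ?_, hc'⟩
  rw [hc]
  constructor
  · rintro ⟨j, hj, hji⟩
    obtain ⟨rfl, rfl⟩ := pair_inj.1 hji
    rfl
  · rintro rfl
    exact ⟨i, hi, rfl⟩

/-- Course-of-values recursion for sets. -/
theorem exists_set_rec {Φ : M × M → Prop} (hΦ : Comp S Φ) :
    ∃ X ∈ S, ∀ n, ∃ c, (∀ i < n, Elt i c ↔ i ∈ X) ∧ (n ∈ X ↔ Φ (n, c)) := by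
  obtain ⟨ap, hap, h⟩ := exists_rec S
  have hf : Comp S (fun p : M × M => fcode (fun i => ap (p.2, i) = 1) p.1) :=
    .fcode (by fun_prop) (by fun_prop)
  obtain ⟨E, hE, h'⟩ := h (fun p => enc S (Φ (p.1, fcode (fun i => ap (p.2, i) = 1) p.1)))
    (by fun_prop)
  refine ⟨{n | E n = 1}, Comp.mem_sets (by fun_prop), fun n => ?_⟩
  obtain ⟨c, hc, hc'⟩ := h' n
  have hP : Comp S (fun i => ap (c, i) = 1) := by fun_prop
  refine ⟨fcode (fun i => ap (c, i) = 1) n, fun i hi => ?_, ?_⟩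
  · rw [elt_fcode hP, hc i hi]
    exact ⟨fun h => h.2, fun h => ⟨hi, h⟩⟩
  · change E n = 1 ↔ _
    rw [hc', enc_prop_eq_one]

theorem Comp.ite {P : α → Prop} [DecidablePred P] (hP : Comp S P) {f g : α → β} (hf : Comp S f)
    (hg : Comp S g) : Comp S (fun a => if P a then f a else g a) := by
  have : Comp S (fun p : α × β => P p.1 ∧ f p.1 = p.2 ∨ ¬ P p.1 ∧ g p.1 = p.2) := by fun_prop
  refine .of_graph ?_
  convert this using 2 with p
  by_cases h : P p.1 <;> simp [h]

theorem exists_unpair (S : Set (Set M)) [Model S] : ∃ l r : M → M, Comp S l ∧ Comp S r ∧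
    ∀ a b, l (pair a b) = a ∧ r (pair a b) = b := by
  obtain ⟨l, hl, hl'⟩ := Comp.exists_choice (S := S)
    (P := fun (n : M) a => (∃ b < n + 1, n = pair a b) ∨ ∀ a < n + 1, ¬ ∃ b < n + 1, n = pair a b)
    (.or (.bex (by fun_prop) (by fun_prop)) (.ball (by fun_prop)
      (.not (.bex (by fun_prop) (by fun_prop))))) (by
      intro n
      by_cases h : ∃ a, ∃ b < n + 1, n = pair a b
      · exact ⟨_, .inl h.choose_spec⟩
      · exact ⟨0, .inr fun a _ h' => h ⟨a, h'⟩⟩)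
  obtain ⟨r, hr, hr'⟩ := Comp.exists_choice (S := S)
    (P := fun (n : M) b => (∃ a < n + 1, n = pair a b) ∨ ∀ b < n + 1, ¬ ∃ a < n + 1, n = pair a b)
    (.or (.bex (by fun_prop) (by fun_prop)) (.ball (by fun_prop)
      (.not (.bex (by fun_prop) (by fun_prop))))) (by
      intro n
      by_cases h : ∃ b, ∃ a < n + 1, n = pair a b
      · exact ⟨_, .inl h.choose_spec⟩
      · exact ⟨0, .inr fun a _ h' => h ⟨a, h'⟩⟩)
  refine ⟨l, r, hl, hr, fun a b => ⟨?_, ?_⟩⟩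
  · rcases hl' (pair a b) with ⟨b', -, h⟩ | h
    · exact (pair_inj.1 h).1.symm
    · exact absurd ⟨b, lt_add_one_iff.2 (right_le_pair _ _), rfl⟩
        (h a (lt_add_one_iff.2 (left_le_pair _ _)))
  · rcases hr' (pair a b) with ⟨b', -, h⟩ | h
    · exact (pair_inj.1 h).2.symm
    · exact absurd ⟨a, lt_add_one_iff.2 (left_le_pair _ _), rfl⟩
        (h b (lt_add_one_iff.2 (right_le_pair _ _)))

theorem exists_sub (S : Set (Set M)) [Model S] : ∃ f : M × M → M, Comp S f ∧
    ∀ a b, f (a + b, a) = b := by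
  obtain ⟨f, hf, hf'⟩ := Comp.exists_choice (S := S)
    (P := fun (p : M × M) d => p.2 + d = p.1 ∨ p.1 < p.2) (by fun_prop) (by
      rintro ⟨a, b⟩
      rcases lt_or_ge a b with h | h
      · exact ⟨0, .inr h⟩
      · obtain ⟨c, rfl⟩ := exists_add_of_le h
        exact ⟨c, .inl rfl⟩)
  refine ⟨f, hf, fun a b => ?_⟩
  rcases hf' (a + b, a) with h | h
  · exact add_left_cancel h
  · exact absurd h (not_lt.2 le_self_add)

open Classical in
/-- Primitive recursion with a parameter. -/
theorem exists_primrec {g : M → M} (hg : Comp S g) {h : M × M × M → M} (hh : Comp S h) :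
    ∃ f : M × M → M, Comp S f ∧ (∀ a, f (a, 0) = g a) ∧
      ∀ a n, f (a, n + 1) = h (a, n, f (a, n)) := by
  obtain ⟨l, r, hl, hr, hlr⟩ := exists_unpair S
  obtain ⟨sub, hsub, hsub'⟩ := exists_sub S
  obtain ⟨ap, hap, hrec⟩ := exists_rec S
  obtain ⟨E, hE, hE'⟩ := hrec (fun p => if r p.1 = 0 then g (l p.1) else
    h (l p.1, sub (r p.1, 1), ap (p.2, pair (l p.1) (sub (r p.1, 1)))))
    (.ite (by fun_prop) (by fun_prop) (by fun_prop))
  refine ⟨fun p => E (pair p.1 p.2), by fun_prop, fun a => ?_, fun a n => ?_⟩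
  · obtain ⟨c, -, hc⟩ := hE' (pair a 0)
    simpa [(hlr a 0).1, (hlr a 0).2] using hc
  · obtain ⟨c, hc, hc'⟩ := hE' (pair a (n + 1))
    have h1 : sub (n + 1, 1) = n := by rw [add_comm, hsub']
    have h2 : n + 1 ≠ 0 := (lt_add_one_iff.2 (zero_le (a := n))).ne'
    change E (pair a (n + 1)) = h (a, n, E (pair a n))
    rw [← hc _ (pair_lt_pair_right a (lt_add_one_iff.2 le_rfl))]
    simpa [(hlr a (n + 1)).1, (hlr a (n + 1)).2, h1, h2] using hc'

/-- The greatest element is found as the one with least distance `k` from the bound `b`. -/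
theorem exists_greatest (S : Set (Set M)) [Model S] {P : M → Prop} (hP : Comp S P) {b : M}
    (h : ∃ n, P n) (hb : ∀ n, P n → n ≤ b) : ∃ n, P n ∧ ∀ m, P m → m ≤ n := by
  obtain ⟨n, hn⟩ := h
  obtain ⟨d, hd⟩ := exists_add_of_le (hb n hn)
  obtain ⟨k, ⟨m, -, hm, hm'⟩, hk⟩ := exists_least S
    (P := fun k => ∃ n < b + 1, P n ∧ b = n + k)
    (.bex (by fun_prop) (by fun_prop)) ⟨d, n, lt_add_one_iff.2 (hb n hn), hn, hd⟩
  refine ⟨m, hm, fun i hi => ?_⟩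
  obtain ⟨e, he⟩ := exists_add_of_le (hb i hi)
  by_contra hlt
  refine hk e ?_ ⟨i, lt_add_one_iff.2 (hb i hi), hi, he⟩
  by_contra hle
  have := add_lt_add_of_lt_of_le (not_le.1 hlt) (not_lt.1 hle)
  rw [← hm', ← he] at this
  exact lt_irrefl _ this

end FiniteSets

/-! ### Existence of `H_f(Q)` and its quasi order -/

section HereditarilyFinite

set_option linter.unusedSectionVars false

variable {M : Type*} [CommSemiring M] [LinearOrder M] [DiscreteSemiring M]
variable {S : Set (Set M)} [Model S] {Q R H L : Set M}

theorem pair_zero_ne_pair_one {p a : M} : pair 0 p ≠ pair 1 a := fun h =>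
  zero_ne_one (pair_inj.1 h).1

theorem Elt.lt_pair {x a : M} (h : Elt x a) : x < pair 1 a := h.lt.trans_le (right_le_pair _ _)

theorem pair_lt_pair_of_lt_of_le {x x' y y' : M} (h : x < x') (h' : y ≤ y') :
    pair x y < pair x' y' := pair_lt_pair_of_add_lt (add_lt_add_of_lt_of_le h h')

/-- Elements of `a` are smaller than `pair 1 a`, so the clauses are a course-of-values recursion. -/
theorem exists_hf_carrier (hQ : Q ∈ S) : ∃ H ∈ S, ∀ z : M, z ∈ H ↔
    (∃ q ∈ Q, z = pair 0 q) ∨ ∃ a : M, IsFin a ∧ (∀ x : M, Elt x a → x ∈ H) ∧ z = pair 1 a := by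
  obtain ⟨H, hH, h⟩ := exists_set_rec (S := S) (Φ := fun p : M × M =>
    (∃ q < p.1 + 1, q ∈ Q ∧ p.1 = pair 0 q) ∨
      ∃ a < p.1 + 1, IsFin a ∧ (∀ x < a, Elt x a → Elt x p.2) ∧ p.1 = pair 1 a)
    (.or (.bex (by fun_prop) (.and (.mem hQ (by fun_prop)) (by fun_prop)))
      (.bex (by fun_prop) (.and (by fun_prop) (.and (.ball (by fun_prop)
        (.imp (by fun_prop) (by fun_prop))) (by fun_prop)))))
  refine ⟨H, hH, fun z => ?_⟩
  obtain ⟨c, hc, hz⟩ := h z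
  rw [hz]
  refine or_congr ?_ ?_
  · constructor
    · rintro ⟨q, -, hq, h⟩
      exact ⟨q, hq, h⟩
    · rintro ⟨q, hq, h⟩
      exact ⟨q, lt_add_one_iff.2 (h ▸ right_le_pair _ _), hq, h⟩
  · constructor
    · rintro ⟨a, -, ha, h, rfl⟩
      exact ⟨a, ha, fun x hx => (hc x hx.lt_pair).1 (h x hx.lt hx), rfl⟩
    · rintro ⟨a, ha, h, rfl⟩
      exact ⟨a, lt_add_one_iff.2 (right_le_pair _ _), ha,
        fun x _ hx => (hc x hx.lt_pair).2 (h x hx), rfl⟩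

/-- The recursion runs on the code of `(x, y)`. Every clause passes to an element on at least one
side, which decreases this code since pairing is monotone. -/
theorem exists_hf_rel (hR : R ∈ S) (hH : H ∈ S) : ∃ L ∈ S, ∀ x y : M, pair x y ∈ L ↔
    (x ∈ H ∧ y ∈ H) ∧ (
      (∃ p q, x = pair 0 p ∧ y = pair 0 q ∧ pair p q ∈ R) ∨
      (∃ p b, x = pair 0 p ∧ y = pair 1 b ∧ ∃ y', Elt y' b ∧ pair x y' ∈ L) ∨
      (∃ a q, x = pair 1 a ∧ y = pair 0 q ∧ ∀ x', Elt x' a → pair x' y ∈ L) ∨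
      (∃ a b, x = pair 1 a ∧ y = pair 1 b ∧
        ∀ x', Elt x' a → ∃ y', Elt y' b ∧ pair x' y' ∈ L)) := by
  obtain ⟨L, hL, h⟩ := exists_set_rec (S := S) (Φ := fun n : M × M =>
    ∃ x < n.1 + 1, ∃ y < n.1 + 1, n.1 = pair x y ∧ (x ∈ H ∧ y ∈ H) ∧ (
      (∃ p < x + 1, ∃ q < y + 1, (x = pair 0 p ∧ y = pair 0 q) ∧ pair p q ∈ R) ∨
      (∃ p < x + 1, ∃ b < y + 1, (x = pair 0 p ∧ y = pair 1 b) ∧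
        ∃ y' < b, Elt y' b ∧ Elt (pair x y') n.2) ∨
      (∃ a < x + 1, ∃ q < y + 1, (x = pair 1 a ∧ y = pair 0 q) ∧
        ∀ x' < a, Elt x' a → Elt (pair x' y) n.2) ∨
      (∃ a < x + 1, ∃ b < y + 1, (x = pair 1 a ∧ y = pair 1 b) ∧
        ∀ x' < a, Elt x' a → ∃ y' < b, Elt y' b ∧ Elt (pair x' y') n.2)))
    (.bex (by fun_prop) (.bex (by fun_prop) (.and (by fun_prop) (.and
      (.and (.mem hH (by fun_prop)) (.mem hH (by fun_prop)))
      (.or (.bex (by fun_prop) (.bex (by fun_prop) (.and (by fun_prop) (.mem hR (by fun_prop)))))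
      (.or (.bex (by fun_prop) (.bex (by fun_prop) (.and (by fun_prop) (.bex (by fun_prop)
        (by fun_prop)))))
      (.or (.bex (by fun_prop) (.bex (by fun_prop) (.and (by fun_prop) (.ball (by fun_prop)
        (.imp (by fun_prop) (by fun_prop))))))
      (.bex (by fun_prop) (.bex (by fun_prop) (.and (by fun_prop) (.ball (by fun_prop)
        (.imp (by fun_prop) (.bex (by fun_prop) (by fun_prop))))))))))))))
  refine ⟨L, hL, fun x y => ?_⟩
  obtain ⟨c, hc, hz⟩ := h (pair x y)
  rw [hz]
  constructor
  · rintro ⟨x', -, y', -, h, hH, h'⟩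
    obtain ⟨rfl, rfl⟩ := pair_inj.1 h
    refine ⟨hH, ?_⟩
    rcases h' with ⟨p, -, q, -, ⟨h1, h2⟩, h'⟩ | ⟨p, -, b, -, ⟨rfl, rfl⟩, y, -, hy, h'⟩ |
      ⟨a, -, q, -, ⟨rfl, rfl⟩, h'⟩ | ⟨a, -, b, -, ⟨rfl, rfl⟩, h'⟩
    · exact .inl ⟨p, q, h1, h2, h'⟩
    · exact .inr (.inl ⟨p, b, rfl, rfl, y, hy, (hc _ (pair_lt_pair_right _ hy.lt_pair)).1 h'⟩)
    · exact .inr (.inr (.inl ⟨a, q, rfl, rfl, fun x hx =>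
        (hc _ (pair_lt_pair_left hx.lt_pair _)).1 (h' x hx.lt hx)⟩))
    · refine .inr (.inr (.inr ⟨a, b, rfl, rfl, fun x hx => ?_⟩))
      obtain ⟨y, -, hy, hxy⟩ := h' x hx.lt hx
      exact ⟨y, hy, (hc _ (pair_lt_pair_of_lt_of_le hx.lt_pair hy.lt_pair.le)).1 hxy⟩
  · rintro ⟨hH, h'⟩
    refine ⟨x, lt_add_one_iff.2 (left_le_pair _ _), y, lt_add_one_iff.2 (right_le_pair _ _), rfl,
      hH, ?_⟩
    have hlt : ∀ i z : M, z < pair i z + 1 := fun i z => lt_add_one_iff.2 (right_le_pair _ _)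
    rcases h' with ⟨p, q, rfl, rfl, h'⟩ | ⟨p, b, rfl, rfl, y, hy, h'⟩ |
      ⟨a, q, rfl, rfl, h'⟩ | ⟨a, b, rfl, rfl, h'⟩
    · exact .inl ⟨p, hlt _ _, q, hlt _ _, ⟨rfl, rfl⟩, h'⟩
    · exact .inr (.inl ⟨p, hlt _ _, b, hlt _ _, ⟨rfl, rfl⟩, y, hy.lt, hy,
        (hc _ (pair_lt_pair_right _ hy.lt_pair)).2 h'⟩)
    · exact .inr (.inr (.inl ⟨a, hlt _ _, q, hlt _ _, ⟨rfl, rfl⟩, fun x _ hx =>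
        (hc _ (pair_lt_pair_left hx.lt_pair _)).2 (h' x hx)⟩))
    · refine .inr (.inr (.inr ⟨a, hlt _ _, b, hlt _ _, ⟨rfl, rfl⟩, fun x _ hx => ?_⟩))
      obtain ⟨y, hy, hxy⟩ := h' x hx
      exact ⟨y, hy.lt, hy, (hc _ (pair_lt_pair_of_lt_of_le hx.lt_pair hy.lt_pair.le)).2 hxy⟩

theorem exists_isHf (hQ : IsQuasiOrder S Q R) : ∃ H L : Set M, IsHf S Q R H L := by
  obtain ⟨H, hH, hH'⟩ := exists_hf_carrier hQ.carrier_mem_sets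
  obtain ⟨L, hL, hL'⟩ := exists_hf_rel hQ.rel_mem_sets hH
  -- The recursion is known to be correct on pairs only; all other numbers are now removed from `L`.
  have hrel : ∀ x y, pair x y ∈ {z | z ∈ L ∧ ∃ x ∈ H, ∃ y ∈ H, z = pair x y} ↔ pair x y ∈ L := by
    intro x y
    refine ⟨fun h => h.1, fun h => ⟨h, ?_⟩⟩
    exact ⟨x, ((hL' x y).1 h).1.1, y, ((hL' x y).1 h).1.2, rfl⟩
  have hmem : {z | z ∈ L ∧ ∃ x ∈ H, ∃ y ∈ H, z = pair x y} ∈ S := by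
    have : Comp S (fun z : M => z ∈ L ∧ ∃ x < z + 1, ∃ y < z + 1, (x ∈ H ∧ y ∈ H) ∧ z = pair x y) :=
      .and (.mem hL (by fun_prop)) (.bex (by fun_prop) (.bex (by fun_prop)
        (.and (.and (.mem hH (by fun_prop)) (.mem hH (by fun_prop))) (by fun_prop))))
    refine mem_of_ext this.mem_sets fun z => and_congr_right fun _ => ?_
    constructor
    · rintro ⟨x, hx, y, hy, rfl⟩
      exact ⟨x, lt_add_one_iff.2 (left_le_pair _ _), y, lt_add_one_iff.2 (right_le_pair _ _),
        ⟨hx, hy⟩, rfl⟩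
    · rintro ⟨x, -, y, -, ⟨hx, hy⟩, rfl⟩
      exact ⟨x, hx, y, hy, rfl⟩
  refine ⟨H, _, hH, hmem, hH', fun z hz => hz.2, ?_, ?_, ?_, ?_⟩
  · intro p q hp hq
    rw [hrel, hL']
    simp [hp, hq, pair_inj]
  · intro p b hp hb
    simp only [hrel]
    rw [hL']
    simp [hp, hb, pair_inj]
  · intro a q ha hq
    simp only [hrel]
    rw [hL']
    simp [ha, hq, pair_inj]
  · intro a b ha hb
    simp only [hrel]
    rw [hL']
    simp [ha, hb, pair_inj]

namespace IsHf

theorem ur_mem (h : IsHf S Q R H L) {q : M} : pair 0 q ∈ H ↔ q ∈ Q := by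
  rw [h.mem_iff]
  constructor
  · rintro (⟨q', hq', h⟩ | ⟨a, -, -, h⟩)
    · rwa [(pair_inj.1 h).2]
    · exact absurd h pair_zero_ne_pair_one
  · exact fun hq => .inl ⟨q, hq, rfl⟩

theorem mem_of_elt (h : IsHf S Q R H L) {a x : M} (ha : pair 1 a ∈ H) (hx : Elt x a) : x ∈ H := by
  rcases (h.mem_iff _).1 ha with ⟨q', hq', h⟩ | ⟨a', -, ha', h⟩
  · exact absurd h.symm pair_zero_ne_pair_one
  · rw [(pair_inj.1 h).2] at hx
    exact ha' x hx

theorem cases (h : IsHf S Q R H L) {z : M} (hz : z ∈ H) :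
    (∃ q, z = pair 0 q) ∨ ∃ a, z = pair 1 a := by
  rcases (h.mem_iff _).1 hz with ⟨q', hq', h⟩ | ⟨a', -, ha', h⟩
  exacts [.inl ⟨_, h⟩, .inr ⟨_, h⟩]

theorem refl (h : IsHf S Q R H L) (hQ : IsQuasiOrder S Q R) (z : M) : z ∈ H → pair z z ∈ L := by
  refine comp_strong_induction S (P := fun z => z ∈ H → pair z z ∈ L)
    (.imp (.mem h.carrier_mem_sets (by fun_prop)) (.mem h.rel_mem_sets (by fun_prop)))
    (fun z ih hz => ?_) z
  rcases h.cases hz with ⟨q, rfl⟩ | ⟨a, rfl⟩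
  · rw [h.ur_ur _ _ hz hz]
    exact hQ.refl q (h.ur_mem.1 hz)
  · rw [h.set_set _ _ hz hz]
    exact fun x hx => ⟨x, hx, ih x hx.lt_pair (h.mem_of_elt hz hx)⟩

/-- Induction on `x + y + z`: unless all three are urelements, the clauses lead to elements of some
of them, and the sum drops. -/
theorem trans (h : IsHf S Q R H L) (hQ : IsQuasiOrder S Q R) {x y z : M} (hx : x ∈ H) (hy : y ∈ H)
    (hz : z ∈ H) (hxy : pair x y ∈ L) (hyz : pair y z ∈ L) : pair x z ∈ L := by
  -- The redundant bounds turn the claim into one that exists in the model, as induction requires.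
  have key : ∀ n : M, ∀ x < n + 1, ∀ y < n + 1, ∀ z < n + 1, x + y + z = n →
      x ∈ H → y ∈ H → z ∈ H → pair x y ∈ L → pair y z ∈ L → pair x z ∈ L := by
    have hH := h.carrier_mem_sets
    have hL := h.rel_mem_sets
    refine comp_strong_induction S (.ball (by fun_prop) (.ball (by fun_prop) (.ball (by fun_prop)
      (.imp (by fun_prop) (.imp (.mem hH (by fun_prop)) (.imp (.mem hH (by fun_prop))
      (.imp (.mem hH (by fun_prop)) (.imp (.mem hL (by fun_prop)) (.imp (.mem hL (by fun_prop))
      (.mem hL (by fun_prop))))))))))) ?_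
    rintro n ih x - y - z - rfl hx hy hz hxy hyz
    have ih' : ∀ {x' y' z'}, x' + y' + z' < x + y + z → x' ∈ H → y' ∈ H → z' ∈ H →
        pair x' y' ∈ L → pair y' z' ∈ L → pair x' z' ∈ L := by
      intro x' y' z' hlt
      refine ih _ hlt x' ?_ y' ?_ z' ?_ rfl <;> rw [lt_add_one_iff]
      exacts [le_self_add.trans le_self_add, le_add_self.trans le_self_add, le_add_self]
    rcases h.cases hx with ⟨p, rfl⟩ | ⟨a, rfl⟩ <;> rcases h.cases hy with ⟨q, rfl⟩ | ⟨b, rfl⟩ <;>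
      rcases h.cases hz with ⟨r, rfl⟩ | ⟨c, rfl⟩
    · rw [h.ur_ur _ _ hx hy] at hxy
      rw [h.ur_ur _ _ hy hz] at hyz
      rw [h.ur_ur _ _ hx hz]
      exact hQ.trans p (h.ur_mem.1 hx) q (h.ur_mem.1 hy) r (h.ur_mem.1 hz) hxy hyz
    · rw [h.ur_set _ _ hy hz] at hyz
      rw [h.ur_set _ _ hx hz]
      obtain ⟨z', hz', hyz⟩ := hyz
      exact ⟨z', hz', ih' (by gcongr; exact hz'.lt_pair) hx hy (h.mem_of_elt hz hz') hxy hyz⟩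
    · rw [h.ur_set _ _ hx hy] at hxy
      rw [h.set_ur _ _ hy hz] at hyz
      obtain ⟨y', hy', hxy⟩ := hxy
      exact ih' (by gcongr; exact hy'.lt_pair) hx (h.mem_of_elt hy hy') hz hxy (hyz y' hy')
    · rw [h.ur_set _ _ hx hy] at hxy
      rw [h.set_set _ _ hy hz] at hyz
      rw [h.ur_set _ _ hx hz]
      obtain ⟨y', hy', hxy⟩ := hxy
      obtain ⟨z', hz', hyz⟩ := hyz y' hy'
      exact ⟨z', hz', ih' (by gcongr; exacts [hy'.lt_pair, hz'.lt_pair]) hx (h.mem_of_elt hy hy')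
        (h.mem_of_elt hz hz') hxy hyz⟩
    · rw [h.set_ur _ _ hx hy] at hxy
      rw [h.set_ur _ _ hx hz]
      exact fun x' hx' => ih' (by gcongr; exact hx'.lt_pair) (h.mem_of_elt hx hx') hy hz
        (hxy x' hx') hyz
    · rw [h.set_ur _ _ hx hy] at hxy
      rw [h.ur_set _ _ hy hz] at hyz
      rw [h.set_set _ _ hx hz]
      obtain ⟨z', hz', hyz⟩ := hyz
      exact fun x' hx' => ⟨z', hz', ih' (by gcongr; exacts [hx'.lt_pair, hz'.lt_pair])
        (h.mem_of_elt hx hx') hy (h.mem_of_elt hz hz') (hxy x' hx') hyz⟩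
    · rw [h.set_set _ _ hx hy] at hxy
      rw [h.set_ur _ _ hy hz] at hyz
      rw [h.set_ur _ _ hx hz]
      intro x' hx'
      obtain ⟨y', hy', hxy⟩ := hxy x' hx'
      exact ih' (by gcongr; exacts [hx'.lt_pair, hy'.lt_pair]) (h.mem_of_elt hx hx')
        (h.mem_of_elt hy hy') hz hxy (hyz y' hy')
    · rw [h.set_set _ _ hx hy] at hxy
      rw [h.set_set _ _ hy hz] at hyz
      rw [h.set_set _ _ hx hz]
      intro x' hx'
      obtain ⟨y', hy', hxy⟩ := hxy x' hx'
      obtain ⟨z', hz', hyz⟩ := hyz y' hy'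
      exact ⟨z', hz', ih' (by gcongr; exacts [hx'.lt_pair, hy'.lt_pair, hz'.lt_pair])
        (h.mem_of_elt hx hx') (h.mem_of_elt hy hy') (h.mem_of_elt hz hz') hxy hyz⟩
  refine key (x + y + z) x ?_ y ?_ z ?_ rfl hx hy hz hxy hyz <;> rw [lt_add_one_iff]
  exacts [le_self_add.trans le_self_add, le_add_self.trans le_self_add, le_add_self]

theorem isQuasiOrder (h : IsHf S Q R H L) (hQ : IsQuasiOrder S Q R) : IsQuasiOrder S H L where
  carrier_mem_sets := h.carrier_mem_sets
  rel_mem_sets := h.rel_mem_sets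
  rel_sub := h.rel_sub
  refl := h.refl hQ
  trans _ hx _ hy _ hz := h.trans hQ hx hy hz

end IsHf

end HereditarilyFinite

/-! ### Elements of a barrier as segments of sets -/

section Segments

set_option linter.unusedSectionVars false

variable {M : Type*} [CommSemiring M] [LinearOrder M] [DiscreteSemiring M]
variable {S : Set (Set M)} [Model S] {α : Type*} [Coded S α] {B : Set M}

/-- The code of the finite set of the `i` with `P i` and `x ≤ i ≤ y`. -/
noncomputable def icc (P : M → Prop) (x y : M) : M := fcode (fun i => P i ∧ x ≤ i) (y + 1)

theorem elt_icc {P : M → Prop} (hP : Comp S P) {x y i : M} :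
    Elt i (icc P x y) ↔ P i ∧ x ≤ i ∧ i ≤ y := by
  have : Comp S (fun i => P i ∧ x ≤ i) := by fun_prop
  rw [icc, elt_fcode this, lt_add_one_iff]
  tauto

theorem isFin_icc {P : M → Prop} (hP : Comp S P) (x y : M) : IsFin (icc P x y) := by
  have : Comp S (fun i => P i ∧ x ≤ i) := by fun_prop
  exact isFin_fcode this _

theorem icc_congr {P R : M → Prop} {x y : M} (h : ∀ i, x ≤ i → i ≤ y → (P i ↔ R i)) :
    icc P x y = icc R x y :=
  fcode_congr fun i hi => and_congr_left fun hx => h i hx (lt_add_one_iff.1 hi)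

theorem Comp.icc {P : α → M → Prop} (hP : Comp S (fun p : α × M => P p.1 p.2)) {f g : α → M}
    (hf : Comp S f) (hg : Comp S g) : Comp S (fun a => RM.icc (P a) (f a) (g a)) :=
  .fcode (P := fun a i => P a i ∧ f a ≤ i) (.and hP (by fun_prop)) (by fun_prop)

/-- The part of `P` between `x` and `y` is a nonempty element of `B`. -/
def Seg (B : Set M) (P : M → Prop) (x y : M) : Prop := P x ∧ P y ∧ x ≤ y ∧ icc P x y ∈ B

/-- `y` is the successor of `x` in `P`. -/
def Next (P : M → Prop) (x y : M) : Prop := (P x ∧ P y) ∧ x < y ∧ ∀ i, P i → x < i → y ≤ i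

theorem Comp.seg (hB : B ∈ S) {P : α → M → Prop} (hP : Comp S (fun p : α × M => P p.1 p.2))
    {f g : α → M} (hf : Comp S f) (hg : Comp S g) : Comp S (fun a => Seg B (P a) (f a) (g a)) :=
  .and (hP.comp (f := fun a => (a, f a)) (by fun_prop)) (.and
    (hP.comp (f := fun a => (a, g a)) (by fun_prop)) (.and (by fun_prop)
    (.mem hB (.icc hP hf hg))))

theorem Comp.next {f g h : α → M} (hf : Comp S f) (hg : Comp S g) (hh : Comp S h) :
    Comp S (fun a => Next (fun i => Elt i (f a)) (g a) (h a)) := by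
  have : Comp S (fun a => (Elt (g a) (f a) ∧ Elt (h a) (f a)) ∧ g a < h a ∧
      ∀ i < f a, Elt i (f a) → g a < i → h a ≤ i) :=
    .and (by fun_prop) (.and (by fun_prop) (.ball hf (.imp (by fun_prop) (.imp (by fun_prop)
      (by fun_prop)))))
  convert this using 2 with a
  refine and_congr_right fun _ => and_congr_right fun _ => forall_congr' fun i => ?_
  exact ⟨fun h _ => h, fun h hi => h hi.lt hi⟩

theorem Seg.congr {P R : M → Prop} {x y : M} (h : Seg B P x y)
    (hPR : ∀ i, x ≤ i → i ≤ y → (P i ↔ R i)) : Seg B R x y :=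
  ⟨(hPR x le_rfl h.2.2.1).1 h.1, (hPR y h.2.2.1 le_rfl).1 h.2.1, h.2.2.1, icc_congr hPR ▸ h.2.2.2⟩

/-- If `y' ≤ y`, the segment of `R` is contained in that of `P`, and the antichain condition makes
them equal. In particular `y' < y` is impossible, as `y` lies in the second segment. -/
theorem Seg.mono (hB : IsBarrier S B) {P R : M → Prop} (hP : Comp S P) (hR : Comp S R)
    {x y x' y' : M} (hRP : ∀ i, x' ≤ i → i ≤ y' → R i → P i) (h : Seg B P x y)
    (h' : Seg B R x' y') (hx : x ≤ x') :
    y ≤ y' ∧ (y' ≤ y → x = x' ∧ ∀ i, x ≤ i → i ≤ y → P i → R i) := by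
  have key : y' ≤ y → ∀ i, Elt i (icc R x' y') ↔ Elt i (icc P x y) := by
    intro hy i
    rw [hB.antichain _ h'.2.2.2 _ h.2.2.2 fun i hi => ?_]
    rw [elt_icc hR] at hi
    rw [elt_icc hP]
    exact ⟨hRP i hi.2.1 hi.2.2 hi.1, hx.trans hi.2.1, hi.2.2.trans hy⟩
  constructor
  · by_contra hlt
    have := (key (not_le.1 hlt).le y).2 ((elt_icc hP).2 ⟨h.2.1, h.2.2.1, le_rfl⟩)
    exact hlt ((elt_icc hR).1 this).2.2
  · intro hy
    have hx' := (key hy x).2 ((elt_icc hP).2 ⟨h.1, le_rfl, h.2.2.1⟩)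
    refine ⟨hx.antisymm ((elt_icc hR).1 hx').2.1, fun i h1 h2 hi => ?_⟩
    exact ((elt_icc hR).1 ((key hy i).2 ((elt_icc hP).2 ⟨hi, h1, h2⟩))).1

theorem Seg.le_of_le (hB : IsBarrier S B) {P : M → Prop} (hP : Comp S P) {x y x' y' : M}
    (h : Seg B P x y) (h' : Seg B P x' y') (hx : x ≤ x') : y ≤ y' :=
  (h.mono hB hP hP (fun _ _ _ hi => hi) h' hx).1

theorem Seg.unique (hB : IsBarrier S B) {P : M → Prop} (hP : Comp S P) {x y y' : M}
    (h : Seg B P x y) (h' : Seg B P x y') : y = y' :=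
  (h.le_of_le hB hP h' le_rfl).antisymm (h'.le_of_le hB hP h le_rfl)

/-- The empty set would be the only element of the antichain, and the base would be empty. -/
theorem IsBarrier.exists_elt (hB : IsBarrier S B) {s : M} (hs : s ∈ B) : ∃ x, Elt x s := by
  by_contra! h
  obtain ⟨n, ⟨t, ht, hn⟩, -⟩ := hB.inf_base 0
  rw [← hB.antichain s hs t ht fun x hx => absurd hx (h x)] at hn
  exact h n hn

theorem IsBarrier.exists_seg (hB : IsBarrier S B) {P : M → Prop} (hP : Comp S P)
    (hinf : IsInf {i | P i}) (hsub : ∀ i, P i → i ∈ base B) {x : M} (hx : P x) :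
    ∃ y, Seg B P x y := by
  obtain ⟨s, hs, hs1, hs2⟩ := hB.initSeg {i | P i ∧ x ≤ i} (Comp.mem_sets (by fun_prop))
    (fun n => by
      obtain ⟨i, hi, hni⟩ := hinf (n + x)
      exact ⟨i, ⟨hi, le_add_self.trans hni.le⟩, lt_of_le_of_lt le_self_add hni⟩)
    (fun i hi => hsub i hi.1)
  obtain ⟨y, hy, hmax⟩ := exists_greatest S (P := fun i => Elt i s) (by fun_prop) (b := s)
    (hB.exists_elt hs) (fun i hi => hi.lt.le)
  refine ⟨y, hx, (hs1 y hy).1, (hs1 y hy).2, ?_⟩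
  convert hs
  refine (isFin_icc hP x y).ext (hB.isFin s hs) fun i => ?_
  rw [elt_icc hP]
  constructor
  · rintro ⟨hi, hxi, hiy⟩
    rcases hiy.lt_or_eq with h | rfl
    · exact hs2 i y hy ⟨hi, hxi⟩ h
    · exact hy
  · exact fun hi => ⟨(hs1 i hi).1, (hs1 i hi).2, hmax i hi⟩

/-- Ends of segments are monotone in their beginnings, so the part of `P` from `x` to `y'` contains
both segments and witnesses the relation. -/
theorem Seg.tri (hB : IsBarrier S B) {P : M → Prop} (hP : Comp S P) {x y x' y' : M}
    (h : Seg B P x y) (h' : Seg B P x' y') (hn : Next P x x') :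
    Tri (icc P x y) (icc P x' y') := by
  have hyy' := h.le_of_le hB hP h' hn.2.1.le
  refine ⟨icc P x y', x, isFin_icc hP _ _,
    (elt_icc hP).2 ⟨h.1, le_rfl, h.2.2.1.trans hyy'⟩, fun i hi => ?_, ⟨fun i hi => ?_, ?_⟩,
    fun i hi => ?_, ?_⟩
  · exact ((elt_icc hP).1 hi).2.1.eq_or_lt.imp_left Eq.symm
  · rw [elt_icc hP] at hi
    exact (elt_icc hP).2 ⟨hi.1, hi.2.1, hi.2.2.trans hyy'⟩
  · intro i j hj hi hij
    rw [elt_icc hP] at hj ⊢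
    have hi := (elt_icc hP).1 hi
    exact ⟨hi.1, hi.2.1, hij.le.trans hj.2.2⟩
  · rw [elt_icc hP] at hi
    exact ⟨(elt_icc hP).2 ⟨hi.1, hn.2.1.le.trans hi.2.1, hi.2.2⟩, (hn.2.1.trans_le hi.2.1).ne'⟩
  · rintro i j hj ⟨hi, hix⟩ hij
    rw [elt_icc hP] at hj ⊢
    have hi := (elt_icc hP).1 hi
    exact ⟨hi.1, hn.2.2 i hi.1 (lt_of_le_of_ne hi.2.1 (Ne.symm hix)), hij.le.trans hj.2.2⟩

theorem Next.unique {P : M → Prop} {x y y' : M} (h : Next P x y) (h' : Next P x y') : y = y' :=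
  (h.2.2 _ h'.1.2 h'.2.1).antisymm (h'.2.2 _ h.1.2 h.2.1)

theorem Next.le_of_lt {P : M → Prop} {x y i : M} (h : Next P x y) (hi : P i) (hiy : i < y) :
    i ≤ x := not_lt.1 fun hx => (h.2.2 i hi hx).not_gt hiy

theorem Next.unique_left {P : M → Prop} {x x' y : M} (h : Next P x y) (h' : Next P x' y) :
    x = x' :=
  (h'.le_of_lt h.1.1 h.2.1).antisymm (h.le_of_lt h'.1.1 h'.2.1)

theorem exists_next_right (S : Set (Set M)) [Model S] {P : M → Prop} (hP : Comp S P) {x w : M}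
    (hx : P x) (hw : P w) (h : x < w) : ∃ y, Next P x y := by
  obtain ⟨y, hy, hmin⟩ := exists_least S (P := fun i => P i ∧ x < i) (by fun_prop) ⟨w, hw, h⟩
  exact ⟨y, ⟨hx, hy.1⟩, hy.2, fun i hi hxi => not_lt.1 fun hlt => hmin i hlt ⟨hi, hxi⟩⟩

theorem exists_next_left (S : Set (Set M)) [Model S] {P : M → Prop} (hP : Comp S P) {x w : M}
    (hx : P x) (hw : P w) (h : x < w) : ∃ y, Next P y w := by
  obtain ⟨y, hy, hmax⟩ := exists_greatest S (P := fun i => P i ∧ i < w) (by fun_prop) (b := w)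
    ⟨x, hx, h⟩ (fun i hi => hi.2.le)
  refine ⟨y, ⟨hy.1, hw⟩, hy.2, fun i hi hyi => not_lt.1 fun hlt => ?_⟩
  exact hyi.not_ge (hmax i ⟨hi, hlt⟩)

end Segments

/-! ### Counting, descent to elements, and the table of iterates -/

section Tables

set_option linter.unusedSectionVars false

variable {M : Type*} [CommSemiring M] [LinearOrder M] [DiscreteSemiring M]
variable {S : Set (Set M)} [Model S] {B Q R H L : Set M}

/-- `cnt (t, z)` is the number of elements of `t` below `z`. -/
structure IsCount (S : Set (Set M)) [Model S] (cnt : M × M → M) : Prop where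
  comp : Comp S cnt
  zero : ∀ t, cnt (t, 0) = 0
  succ_of_elt : ∀ t z, Elt z t → cnt (t, z + 1) = cnt (t, z) + 1
  succ_of_not_elt : ∀ t z, ¬ Elt z t → cnt (t, z + 1) = cnt (t, z)

theorem exists_isCount (S : Set (Set M)) [Model S] : ∃ cnt, IsCount S cnt := by
  obtain ⟨f, hf, h0, h1⟩ := exists_primrec (S := S) (g := fun _ => 0)
    (h := fun p : M × M × M => p.2.2 + enc S (Elt p.2.1 p.1)) (by fun_prop) (by fun_prop)
  refine ⟨f, hf, h0, fun t z hz => ?_, fun t z hz => ?_⟩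
  · rw [h1, enc_prop_eq_one.2 hz]
  · rw [h1, enc_prop_eq_zero.2 hz, add_zero]

namespace IsCount

variable {cnt : M × M → M}

/-- The second half, that equal counts force equality below `z`, is needed for the antichain
condition of the derived barrier. -/
theorem mono_set (hc : IsCount S cnt) {t u z : M} (h : ∀ i < z, Elt i t → Elt i u) :
    cnt (t, z) ≤ cnt (u, z) ∧ (cnt (t, z) = cnt (u, z) → ∀ i < z, Elt i u → Elt i t) := by
  have hcnt := hc.comp
  refine comp_induction S (P := fun n => n ≤ z → cnt (t, n) ≤ cnt (u, n) ∧
      (cnt (t, n) = cnt (u, n) → ∀ i < n, Elt i u → Elt i t)) ?_ ?_ ?_ z le_rfl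
  · exact .imp (by fun_prop) (.and (by fun_prop) (.imp (by fun_prop) (.ball (by fun_prop)
      (.imp (by fun_prop) (by fun_prop)))))
  · simp [hc.zero]
  · intro n ih hn
    obtain ⟨h1, h2⟩ := ih ((lt_add_one_iff.2 le_rfl).le.trans hn)
    have hnz : n < z := add_one_le_iff.1 hn
    by_cases ht : Elt n t
    · have hu := h n hnz ht
      rw [hc.succ_of_elt t n ht, hc.succ_of_elt u n hu]
      refine ⟨by gcongr, fun he i hi hiu => ?_⟩
      rcases (lt_add_one_iff.1 hi).lt_or_eq with hi | rfl
      · exact h2 (add_right_cancel he) i hi hiu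
      · exact ht
    · rw [hc.succ_of_not_elt t n ht]
      by_cases hu : Elt n u
      · rw [hc.succ_of_elt u n hu]
        refine ⟨h1.trans le_self_add, fun he => absurd he (lt_add_one_iff.2 h1).ne⟩
      · rw [hc.succ_of_not_elt u n hu]
        refine ⟨h1, fun he i hi hiu => ?_⟩
        rcases (lt_add_one_iff.1 hi).lt_or_eq with hi | rfl
        · exact h2 he i hi hiu
        · exact absurd hiu hu

theorem congr (hc : IsCount S cnt) {t u z : M} (h : ∀ i < z, (Elt i t ↔ Elt i u)) :
    cnt (t, z) = cnt (u, z) :=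
  (hc.mono_set fun i hi => (h i hi).1).1.antisymm (hc.mono_set fun i hi => (h i hi).2).1

theorem mono (hc : IsCount S cnt) {t z z' : M} (h : z ≤ z') : cnt (t, z) ≤ cnt (t, z') := by
  obtain ⟨d, rfl⟩ := exists_add_of_le h
  have hcnt := hc.comp
  refine comp_induction S (P := fun d => cnt (t, z) ≤ cnt (t, z + d)) (by fun_prop) (by simp)
    (fun d ih => ?_) d
  rw [← add_assoc]
  by_cases ht : Elt (z + d) t
  · rw [hc.succ_of_elt _ _ ht]
    exact ih.trans le_self_add
  · rwa [hc.succ_of_not_elt _ _ ht]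

theorem lt_of_lt (hc : IsCount S cnt) {t z z' : M} (h : z < z') (hz : Elt z t) :
    cnt (t, z) < cnt (t, z') := by
  have := hc.mono (t := t) (add_one_le_iff.2 h)
  rw [hc.succ_of_elt _ _ hz] at this
  exact add_one_le_iff.1 this

theorem eq_zero (hc : IsCount S cnt) {t z : M} (h : ∀ i < z, ¬ Elt i t) : cnt (t, z) = 0 := by
  have hcnt := hc.comp
  refine comp_induction S (P := fun n => n ≤ z → cnt (t, n) = 0) (.imp (by fun_prop) (by fun_prop))
    (fun _ => hc.zero t) (fun n ih hn => ?_) z le_rfl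
  have hnz : n < z := add_one_le_iff.1 hn
  rw [hc.succ_of_not_elt _ _ (h n hnz), ih hnz.le]

theorem next (hc : IsCount S cnt) {t z z' : M} (h : Next (fun i => Elt i t) z z') :
    cnt (t, z') = cnt (t, z) + 1 := by
  obtain ⟨d, rfl⟩ := exists_add_of_le (add_one_le_iff.2 h.2.1)
  have hcnt := hc.comp
  have key := comp_induction S (P := fun e => e ≤ d → cnt (t, z + 1 + e) = cnt (t, z) + 1)
    (.imp (by fun_prop) (by fun_prop)) (fun _ => by rw [add_zero, hc.succ_of_elt _ _ h.1.1])
    (fun e ih he => ?_) d le_rfl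
  · exact key
  · have hed : e < d := add_one_le_iff.1 he
    rw [← add_assoc, hc.succ_of_not_elt, ih hed.le]
    intro hel
    refine absurd (h.2.2 _ hel ?_) (not_le.2 (by gcongr))
    exact (lt_add_one_iff.2 le_rfl).trans_le le_self_add

end IsCount

/-- The properties of a choice function for elements of hereditarily finite sets that witness
`x ≰ y`. -/
structure IsDescent (S : Set (Set M)) [Model S] (H L : Set M) (ch : M × M → M) : Prop where
  comp : Comp S ch
  mem : ∀ {x y}, x ∈ H → y ∈ H → pair x y ∉ L → ch (x, y) ∈ H
  bad : ∀ {x y z}, x ∈ H → y ∈ H → z ∈ H → pair x y ∉ L → pair y z ∉ L →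
    pair (ch (x, y)) (ch (y, z)) ∉ L
  bad_ur : ∀ {x q}, x ∈ H → pair 0 q ∈ H → pair x (pair 0 q) ∉ L →
    pair (ch (x, pair 0 q)) (pair 0 q) ∉ L
  ur : ∀ {p y}, pair 0 p ∈ H → y ∈ H → pair (pair 0 p) y ∉ L → ch (pair 0 p, y) = pair 0 p
  lt : ∀ {a y}, pair 1 a ∈ H → y ∈ H → pair (pair 1 a) y ∉ L → ch (pair 1 a, y) < pair 1 a

/-- The negated clauses of the order provide the choices. The chosen witness is not below any
element of a set `y`, nor below `y` itself if `y` is an urelement. As `ch (y, z)` is of one of these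
kinds, badness is inherited. -/
theorem IsHf.exists_isDescent (h : IsHf S Q R H L) : ∃ ch, IsDescent S H L ch := by
  have hL := h.rel_mem_sets
  have hH := h.carrier_mem_sets
  obtain ⟨ch, hch, hch'⟩ := Comp.exists_choice (S := S) (P := fun (p : M × M) v =>
      (p.1 ∈ H ∧ p.2 ∈ H ∧ pair p.1 p.2 ∉ L) →
      (∃ q < p.1 + 1, p.1 = pair 0 q ∧ v = p.1) ∨
      (∃ a < p.1 + 1, ∃ q < p.2 + 1, (p.1 = pair 1 a ∧ p.2 = pair 0 q) ∧ Elt v a ∧ pair v p.2 ∉ L) ∨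
      (∃ a < p.1 + 1, ∃ b < p.2 + 1, (p.1 = pair 1 a ∧ p.2 = pair 1 b) ∧ Elt v a ∧
        ∀ y < b, Elt y b → pair v y ∉ L))
    (.imp (.and (.mem hH (by fun_prop)) (.and (.mem hH (by fun_prop)) (.not
      (.mem hL (by fun_prop))))) (.or (.bex (by fun_prop) (by fun_prop)) (.or
      (.bex (by fun_prop) (.bex (by fun_prop) (.and (by fun_prop) (.and (by fun_prop) (.not
        (.mem hL (by fun_prop)))))))
      (.bex (by fun_prop) (.bex (by fun_prop) (.and (by fun_prop) (.and (by fun_prop)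
        (.ball (by fun_prop) (.imp (by fun_prop) (.not (.mem hL (by fun_prop))))))))))))
    (by
      rintro ⟨x, y⟩
      by_cases hxy : x ∈ H ∧ y ∈ H ∧ pair x y ∉ L
      swap
      · exact ⟨0, fun h => absurd h hxy⟩
      obtain ⟨hx, hy, hxy⟩ := hxy
      have hlt : ∀ i z : M, z < pair i z + 1 := fun i z => lt_add_one_iff.2 (right_le_pair _ _)
      rcases h.cases hx with ⟨p, rfl⟩ | ⟨a, rfl⟩
      · exact ⟨_, fun _ => .inl ⟨p, hlt _ _, rfl, rfl⟩⟩
      rcases h.cases hy with ⟨q, rfl⟩ | ⟨b, rfl⟩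
      · rw [h.set_ur _ _ hx hy] at hxy
        push Not at hxy
        obtain ⟨v, hv, hv'⟩ := hxy
        exact ⟨v, fun _ => .inr (.inl ⟨a, hlt _ _, q, hlt _ _, ⟨rfl, rfl⟩, hv, hv'⟩)⟩
      · rw [h.set_set _ _ hx hy] at hxy
        push Not at hxy
        obtain ⟨v, hv, hv'⟩ := hxy
        exact ⟨v, fun _ => .inr (.inr ⟨a, hlt _ _, b, hlt _ _, ⟨rfl, rfl⟩, hv,
          fun y _ hy => hv' y hy⟩)⟩)
  have ur_left : ∀ {p y}, pair 0 p ∈ H → y ∈ H → pair (pair 0 p) y ∉ L →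
      ch (pair 0 p, y) = pair 0 p := by
    intro p y hx hy hxy
    rcases hch' (pair 0 p, y) ⟨hx, hy, hxy⟩ with ⟨q, -, -, h⟩ | ⟨a, -, q, -, ⟨h, -⟩, -⟩ |
      ⟨a, -, q, -, ⟨h, -⟩, -⟩
    · exact h
    · exact absurd h pair_zero_ne_pair_one
    · exact absurd h pair_zero_ne_pair_one
  have set_ur : ∀ {a q}, pair 1 a ∈ H → pair 0 q ∈ H → pair (pair 1 a) (pair 0 q) ∉ L →
      Elt (ch (pair 1 a, pair 0 q)) a ∧ pair (ch (pair 1 a, pair 0 q)) (pair 0 q) ∉ L := by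
    intro a q hx hy hxy
    rcases hch' (pair 1 a, pair 0 q) ⟨hx, hy, hxy⟩ with ⟨q, -, h, -⟩ |
      ⟨a, -, q, -, ⟨h, -⟩, h'⟩ | ⟨a, -, q, -, ⟨-, h⟩, -⟩
    · exact absurd h.symm pair_zero_ne_pair_one
    · rw [← (pair_inj.1 h).2] at h'
      exact h'
    · exact absurd h pair_zero_ne_pair_one
  have set_set : ∀ {a b}, pair 1 a ∈ H → pair 1 b ∈ H → pair (pair 1 a) (pair 1 b) ∉ L →
      Elt (ch (pair 1 a, pair 1 b)) a ∧
        ∀ y, Elt y b → pair (ch (pair 1 a, pair 1 b)) y ∉ L := by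
    intro a b hx hy hxy
    rcases hch' (pair 1 a, pair 1 b) ⟨hx, hy, hxy⟩ with ⟨q, -, h, -⟩ |
      ⟨a, -, q, -, ⟨-, h⟩, -⟩ | ⟨a', -, b', -, ⟨h1, h2⟩, h3, h4⟩
    · exact absurd h.symm pair_zero_ne_pair_one
    · exact absurd h.symm pair_zero_ne_pair_one
    · rw [← (pair_inj.1 h1).2] at h3
      rw [← (pair_inj.1 h2).2] at h4
      exact ⟨h3, fun y hy => h4 y hy.lt hy⟩
  have elt : ∀ {a y}, pair 1 a ∈ H → y ∈ H → pair (pair 1 a) y ∉ L → Elt (ch (pair 1 a, y)) a := by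
    intro a y hx hy hxy
    rcases h.cases hy with ⟨q, rfl⟩ | ⟨b, rfl⟩
    · exact (set_ur hx hy hxy).1
    · exact (set_set hx hy hxy).1
  have bad_ur : ∀ {x q}, x ∈ H → pair 0 q ∈ H → pair x (pair 0 q) ∉ L →
      pair (ch (x, pair 0 q)) (pair 0 q) ∉ L := by
    intro x q hx hy hxy
    rcases h.cases hx with ⟨p, rfl⟩ | ⟨a, rfl⟩
    · rwa [ur_left hx hy hxy]
    · exact (set_ur hx hy hxy).2
  refine ⟨ch, hch, ?_, ?_, bad_ur, ur_left, fun hx hy hxy => (elt hx hy hxy).lt_pair⟩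
  · intro x y hx hy hxy
    rcases h.cases hx with ⟨p, rfl⟩ | ⟨a, rfl⟩
    · rwa [ur_left hx hy hxy]
    · exact h.mem_of_elt hx (elt hx hy hxy)
  · intro x y z hx hy hz hxy hyz
    rcases h.cases hy with ⟨q, rfl⟩ | ⟨b, rfl⟩
    · rw [ur_left hy hz hyz]
      exact bad_ur hx hy hxy
    · have hb := elt hy hz hyz
      rcases h.cases hx with ⟨p, rfl⟩ | ⟨a, rfl⟩
      · rw [ur_left hx hy hxy]
        rw [h.ur_set _ _ hx hy] at hxy
        exact fun h' => hxy ⟨_, hb, h'⟩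
      · exact (set_set hx hy hxy).2 _ hb

/-- `D (t, x, w)` results from the values of `F` on the segments in `t` that begin with the elements
of `t` between `x` and `w`, by iterated application of `ch`. -/
structure IsTable (S : Set (Set M)) [Model S] (B : Set M) (F : M → M) (ch : M × M → M)
    (D : M × M × M → M) : Prop where
  comp : Comp S D
  base : ∀ {t x y}, Seg B (fun i => Elt i t) x y → D (t, x, x) = F (icc (fun i => Elt i t) x y)
  step : ∀ {t x x' w' w}, Next (fun i => Elt i t) x x' → Next (fun i => Elt i t) w' w → x < w →
    D (t, x, w) = ch (D (t, x, w'), D (t, x', w))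

-- The entry at `(x, w)` calls one with smaller `w` and one with larger `x`. Measuring `x` by its
-- distance from `t`, which exceeds all elements of `t`, makes both calls go to smaller indices.
open Classical in
theorem exists_isTable (hB : IsBarrier S B) {F : M → M} (hF : Comp S F) {ch : M × M → M}
    (hch : Comp S ch) : ∃ D, IsTable S B F ch D := by
  have hBS := hB.mem_sets
  have hseg : Comp S (fun p : (M × M) × M => Seg B (fun i => Elt i p.1.1) p.1.2 p.2) :=
    .seg hBS (by fun_prop) (by fun_prop) (by fun_prop)
  -- `e` gives the end of the segment at `x`, and `sc` and `pd` below give the successor and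
  -- predecessor in `t`; where none exists the value is irrelevant.
  obtain ⟨e, he, he'⟩ := Comp.exists_choice (S := S)
    (P := fun (p : M × M) y => Seg B (fun i => Elt i p.1) p.2 y ∨
      ∀ y < p.1, ¬ Seg B (fun i => Elt i p.1) p.2 y)
    (.or hseg (.ball (by fun_prop) (.not
      (hseg.comp (f := fun q : ((M × M) × M) × M => (q.1.1, q.2)) (by fun_prop))))) (by
      intro p
      by_cases h : ∃ y, Seg B (fun i => Elt i p.1) p.2 y
      · exact ⟨_, .inl h.choose_spec⟩
      · exact ⟨0, .inr fun y _ hy => h ⟨y, hy⟩⟩)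
  have he'' : ∀ {t x y}, Seg B (fun i => Elt i t) x y → e (t, x) = y := by
    intro t x y h
    rcases he' (t, x) with h' | h'
    · exact h'.unique hB (by fun_prop) h
    · exact absurd h (h' y h.2.1.lt)
  have hnext : Comp S (fun p : (M × M) × M => Next (fun i => Elt i p.1.1) p.1.2 p.2) :=
    .next (by fun_prop) (by fun_prop) (by fun_prop)
  obtain ⟨sc, hsc, hsc'⟩ := Comp.exists_choice (S := S)
    (P := fun (p : M × M) y => Next (fun i => Elt i p.1) p.2 y ∨
      ∀ y < p.1, ¬ Next (fun i => Elt i p.1) p.2 y)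
    (.or hnext (.ball (by fun_prop) (.not
      (hnext.comp (f := fun q : ((M × M) × M) × M => (q.1.1, q.2)) (by fun_prop))))) (by
      intro p
      by_cases h : ∃ y, Next (fun i => Elt i p.1) p.2 y
      · exact ⟨_, .inl h.choose_spec⟩
      · exact ⟨0, .inr fun y _ hy => h ⟨y, hy⟩⟩)
  have hsc'' : ∀ {t x y}, Next (fun i => Elt i t) x y → sc (t, x) = y := by
    intro t x y h
    rcases hsc' (t, x) with h' | h'
    · exact h'.unique h
    · exact absurd h (h' y h.1.2.lt)
  obtain ⟨pd, hpd, hpd'⟩ := Comp.exists_choice (S := S)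
    (P := fun (p : M × M) y => Next (fun i => Elt i p.1) y p.2 ∨
      ∀ y < p.1, ¬ Next (fun i => Elt i p.1) y p.2)
    (.or (.next (by fun_prop) (by fun_prop) (by fun_prop)) (.ball (by fun_prop) (.not
      (.next (by fun_prop) (by fun_prop) (by fun_prop))))) (by
      intro p
      by_cases h : ∃ y, Next (fun i => Elt i p.1) y p.2
      · exact ⟨_, .inl h.choose_spec⟩
      · exact ⟨0, .inr fun y _ hy => h ⟨y, hy⟩⟩)
  have hpd'' : ∀ {t x y}, Next (fun i => Elt i t) y x → pd (t, x) = y := by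
    intro t x y h
    rcases hpd' (t, x) with h' | h'
    · exact h'.unique_left h
    · exact absurd h (h' y h.1.1.lt)
  obtain ⟨l, r, hl, hr, hlr⟩ := exists_unpair S
  have hl' : ∀ a b, l (pair a b) = a := fun a b => (hlr a b).1
  have hr' : ∀ a b, r (pair a b) = b := fun a b => (hlr a b).2
  obtain ⟨sub, hsub, hsub'⟩ := exists_sub S
  have hsub'' : ∀ {a b}, a ≤ b → sub (b, sub (b, a)) = a := by
    intro a b h
    obtain ⟨c, rfl⟩ := exists_add_of_le h
    rw [hsub', add_comm, hsub']
  obtain ⟨ap, hap, hrec⟩ := exists_rec S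
  -- an index `pair t (pair w d)` stands for the argument `(t, t - d, w)`
  let Ψ : M × M × M × M → M := fun p =>
    if p.2.2.1 ≤ p.2.1 then F (icc (fun i => Elt i p.1) p.2.1 (e (p.1, p.2.1)))
    else ch (ap (p.2.2.2, pair p.1 (pair (pd (p.1, p.2.2.1)) (sub (p.1, p.2.1)))),
      ap (p.2.2.2, pair p.1 (pair p.2.2.1 (sub (p.1, sc (p.1, p.2.1))))))
  have hicc : Comp S (fun p : M × M × M => icc (fun i => Elt i p.1) p.2.1 p.2.2) :=
    .icc (by fun_prop) (by fun_prop) (by fun_prop)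
  have hΨ : Comp S Ψ := .ite (by fun_prop)
    (hF.comp (hicc.comp (f := fun p : M × M × M × M => (p.1, p.2.1, e (p.1, p.2.1)))
      (by fun_prop))) (by fun_prop)
  obtain ⟨E, hE, hE'⟩ := hrec (fun p => Ψ (l p.1, sub (l p.1, r (r p.1)), l (r p.1), p.2))
    (by fun_prop)
  have key : ∀ t x w, x ≤ t → ∃ c, (∀ i < pair t (pair w (sub (t, x))), ap (c, i) = E i) ∧
      E (pair t (pair w (sub (t, x)))) = Ψ (t, x, w, c) := by
    intro t x w hx
    obtain ⟨c, hc, hc'⟩ := hE' (pair t (pair w (sub (t, x))))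
    refine ⟨c, hc, ?_⟩
    simpa only [hl', hr', hsub'' hx] using hc'
  refine ⟨fun p => E (pair p.1 (pair p.2.2 (sub (p.1, p.2.1)))), by fun_prop, ?_, ?_⟩
  · intro t x y h
    obtain ⟨c, -, hc⟩ := key t x x h.1.lt.le
    change E (pair t (pair x (sub (t, x)))) = _
    rw [hc]
    change ite _ _ _ = _
    rw [if_pos le_rfl]
    simp only [he'' h]
  · intro t x x' w' w hx hw hxw
    obtain ⟨c, hc, hc'⟩ := key t x w hx.1.1.lt.le
    change E (pair t (pair w (sub (t, x)))) = ch (E (pair t (pair w' (sub (t, x)))),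
      E (pair t (pair w (sub (t, x')))))
    rw [hc']
    change ite _ _ _ = _
    rw [if_neg (not_le.2 hxw)]
    simp only [hsc'' hx, hpd'' hw]
    rw [hc, hc]
    · refine pair_lt_pair_right _ (pair_lt_pair_right _ ?_)
      have h1 := hx.1.2.lt.le
      obtain ⟨d, hd⟩ := exists_add_of_le h1
      obtain ⟨k, rfl⟩ := exists_add_of_le hx.2.1.le
      have h2 : sub (t, x + k) = d := by
        rw [hd, hsub']
      have h3 : sub (t, x) = k + d := by
        rw [hd, add_assoc, hsub']
      rw [h2, h3]
      exact lt_add_of_pos_left _ ((lt_add_iff_pos_right x).1 hx.2.1)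
    · exact pair_lt_pair_right _ (pair_lt_pair_left hw.2.1 _)

end Tables

/-! ### Badness and descent in the table -/

section Arrays

set_option linter.unusedSectionVars false

variable {M : Type*} [CommSemiring M] [LinearOrder M] [DiscreteSemiring M]
variable {S : Set (Set M)} [Model S] {B Q R H L : Set M}

/-- `F` extends a bad array from the barrier `B` to `H`. -/
structure IsBad (B H L : Set M) (F : M → M) : Prop where
  mem : ∀ s ∈ B, F s ∈ H
  bad : ∀ s ∈ B, ∀ t ∈ B, Tri s t → pair (F s) (F t) ∉ L

namespace IsTable

variable {F : M → M} {ch : M × M → M} {D : M × M × M → M}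

/-- Only the segments beginning between `x` and `w` enter the computation, and they all end by `b`.
The induction is on a bound `d` for the distance from `x` to `w`. -/
theorem congr (hD : IsTable S B F ch D) {t u a b W : M}
    (htu : ∀ i, a ≤ i → i ≤ b → (Elt i t ↔ Elt i u))
    (hseg : ∀ i, Elt i t → a ≤ i → i ≤ W → ∃ y ≤ b, Seg B (fun i => Elt i t) i y) {x w : M}
    (hx : Elt x t) (hw : Elt w t) (hax : a ≤ x) (hxw : x ≤ w) (hwW : w ≤ W) :
    D (t, x, w) = D (u, x, w) := by
  have hcomp := hD.comp
  have hWb : ∀ i, Elt i t → a ≤ i → i ≤ W → i ≤ b := by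
    intro i hi hai hiW
    obtain ⟨y, hy, hs⟩ := hseg i hi hai hiW
    exact hs.2.2.1.trans hy
  have key : ∀ d : M, ∀ x < t, ∀ w < t, (Elt x t ∧ Elt w t ∧ a ≤ x ∧ x ≤ w ∧ w ≤ W ∧ w ≤ x + d) →
      D (t, x, w) = D (u, x, w) := by
    refine comp_induction S (.ball (by fun_prop) (.ball (by fun_prop) (.imp (by fun_prop)
      (by fun_prop)))) ?_ ?_
    all_goals
      have base : ∀ x, Elt x t → a ≤ x → x ≤ W → D (t, x, x) = D (u, x, x) := by
        intro x hx hax hxW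
        obtain ⟨y, hyb, hy⟩ := hseg x hx hax hxW
        have hxy : ∀ i, x ≤ i → i ≤ y → (Elt i t ↔ Elt i u) :=
          fun i h1 h2 => htu i (hax.trans h1) (h2.trans hyb)
        rw [hD.base hy, hD.base (hy.congr hxy), icc_congr hxy]
    · rintro x - w - ⟨hx, hw, hax, hxw, hwW, hwx⟩
      rw [add_zero] at hwx
      obtain rfl := hxw.antisymm hwx
      exact base x hx hax hwW
    · rintro d ih x - w - ⟨hx, hw, hax, hxw, hwW, hwx⟩
      rcases hxw.eq_or_lt with rfl | hxw
      · exact base x hx hax hwW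
      obtain ⟨x', hx'⟩ := exists_next_right S (P := fun i => Elt i t) (by fun_prop) hx hw hxw
      obtain ⟨w', hw'⟩ := exists_next_left S (P := fun i => Elt i t) (by fun_prop) hx hw hxw
      have hwb := hWb w hw (hax.trans hxw.le) hwW
      have hx'w : x' ≤ w := hx'.2.2 w hw hxw
      have hxw' : x ≤ w' := hw'.le_of_lt hx hxw
      have hnx : Next (fun i => Elt i u) x x' := by
        refine ⟨⟨(htu x hax (hxw.le.trans hwb)).1 hx, (htu x' (hax.trans hx'.2.1.le)
          (hx'w.trans hwb)).1 hx'.1.2⟩, hx'.2.1, fun i hi hxi => ?_⟩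
        by_contra hlt
        exact hlt (hx'.2.2 i ((htu i (hax.trans hxi.le)
          ((not_le.1 hlt).le.trans (hx'w.trans hwb))).2 hi) hxi)
      have hnw : Next (fun i => Elt i u) w' w := by
        refine ⟨⟨(htu w' (hax.trans hxw') (hw'.2.1.le.trans hwb)).1 hw'.1.1, (htu w (hax.trans hxw.le)
          hwb).1 hw⟩, hw'.2.1, fun i hi hwi => ?_⟩
        by_contra hlt
        exact hlt (hw'.2.2 i ((htu i (hax.trans (hxw'.trans hwi.le))
          ((not_le.1 hlt).le.trans hwb)).2 hi) hwi)
      rw [hD.step hx' hw' hxw, hD.step hnx hnw hxw,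
        ih x hx.lt w' hw'.1.1.lt ⟨hx, hw'.1.1, hax, hxw', hw'.2.1.le.trans hwW, ?_⟩,
        ih x' hx'.1.2.lt w hw.lt ⟨hx'.1.2, hw, hax.trans hx'.2.1.le, hx'w, hwW, ?_⟩]
      · refine hwx.trans ?_
        rw [add_comm d, ← add_assoc]
        gcongr
        exact add_one_le_iff.2 hx'.2.1
      · rw [← lt_add_one_iff, add_assoc]
        exact hw'.2.1.trans_le hwx
  obtain ⟨d, rfl⟩ := exists_add_of_le hxw
  exact key d x hx.lt _ hw.lt ⟨hx, hw, hax, hxw, hwW, le_rfl⟩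

/-- The elements of the finite set `u` up to `W` are the beginnings of segments. -/
def Full (B : Set M) (u W : M) : Prop :=
  ∀ i, Elt i u → i ≤ W → ∃ y, Seg B (fun i => Elt i u) i y

/-- Both claims are proved together by induction on the distance from `x` to `w`, since `ch` is
controlled only at bad pairs. If `w` is the successor of `x`, badness is that of `F` on consecutive
segments. Otherwise the two entries compared both arise by `ch`, and they share `D (u, x', w')`, as
second argument in one and as first in the other, so that `IsDescent.bad` applies. -/
theorem mem_and_bad (hD : IsTable S B F ch D) (hB : IsBarrier S B) (hF : IsBad B H L F)
    (hch : IsDescent S H L ch) (hH : H ∈ S) (hL : L ∈ S) {u W : M} (hu : Full B u W) {x w : M}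
    (hx : Elt x u) (hw : Elt w u) (hxw : x ≤ w) (hwW : w ≤ W) :
    D (u, x, w) ∈ H ∧ ∀ x' w', Next (fun i => Elt i u) x x' → Next (fun i => Elt i u) w' w →
      x < w → pair (D (u, x, w')) (D (u, x', w)) ∉ L := by
  have hcomp := hD.comp
  have key : ∀ d : M, ∀ x < u, ∀ w < u, (Elt x u ∧ Elt w u ∧ x ≤ w ∧ w ≤ W ∧ w ≤ x + d) →
      D (u, x, w) ∈ H ∧ ∀ x' < u, ∀ w' < u, Next (fun i => Elt i u) x x' →
        Next (fun i => Elt i u) w' w → x < w → pair (D (u, x, w')) (D (u, x', w)) ∉ L := by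
    refine comp_induction S (.ball (by fun_prop) (.ball (by fun_prop) (.imp (by fun_prop)
      (.and (.mem hH (by fun_prop)) (.ball (by fun_prop) (.ball (by fun_prop) (.imp
      (.next (by fun_prop) (by fun_prop) (by fun_prop)) (.imp
      (.next (by fun_prop) (by fun_prop) (by fun_prop)) (.imp (by fun_prop) (.not (.mem hL
      (by fun_prop))))))))))))  ?_ ?_
    all_goals
      have base : ∀ x, Elt x u → x ≤ W → D (u, x, x) ∈ H := by
        intro x hx hxW
        obtain ⟨y, hy⟩ := hu x hx hxW
        rw [hD.base hy]
        exact hF.mem _ hy.2.2.2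
    · rintro x - w - ⟨hx, hw, hxw, hwW, hwx⟩
      rw [add_zero] at hwx
      obtain rfl := hxw.antisymm hwx
      exact ⟨base x hx hwW, fun _ _ _ _ _ _ h => absurd h (lt_irrefl _)⟩
    · rintro d ih x - w - ⟨hx, hw, hxw, hwW, hwx⟩
      rcases hxw.eq_or_lt with rfl | hxw
      · exact ⟨base x hx hwW, fun _ _ _ _ _ _ h => absurd h (lt_irrefl _)⟩
      obtain ⟨x', hx'⟩ := exists_next_right S (P := fun i => Elt i u) (by fun_prop) hx hw hxw
      obtain ⟨w', hw'⟩ := exists_next_left S (P := fun i => Elt i u) (by fun_prop) hx hw hxw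
      have hx'w : x' ≤ w := hx'.2.2 w hw hxw
      have hxw' : x ≤ w' := hw'.le_of_lt hx hxw
      obtain ⟨m1, b1⟩ := ih x hx.lt w' hw'.1.1.lt ⟨hx, hw'.1.1, hxw', hw'.2.1.le.trans hwW, by
        rw [← lt_add_one_iff, add_assoc]
        exact hw'.2.1.trans_le hwx⟩
      obtain ⟨m2, b2⟩ := ih x' hx'.1.2.lt w hw.lt ⟨hx'.1.2, hw, hx'w, hwW, by
        refine hwx.trans ?_
        rw [add_comm d, ← add_assoc]
        gcongr
        exact add_one_le_iff.2 hx'.2.1⟩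
      have hbad : pair (D (u, x, w')) (D (u, x', w)) ∉ L := by
        rcases hxw'.eq_or_lt with rfl | hxw'
        · obtain rfl := hx'.unique hw'
          obtain ⟨y, hy⟩ := hu x hx (hxw.le.trans hwW)
          obtain ⟨y', hy'⟩ := hu x' hw hwW
          rw [hD.base hy, hD.base hy']
          exact hF.bad _ hy.2.2.2 _ hy'.2.2.2 (hy.tri hB (by fun_prop) hy' hx')
        · have hx'lt : x' < w := (hx'.2.2 w' hw'.1.1 hxw').trans_lt hw'.2.1
          obtain ⟨x'', hx''⟩ := exists_next_right S (P := fun i => Elt i u) (by fun_prop)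
            hx'.1.2 hw hx'lt
          obtain ⟨w'', hw''⟩ := exists_next_left S (P := fun i => Elt i u) (by fun_prop)
            hx hw'.1.1 hxw'
          have hx''w := hx''.2.2 w hw hx'lt
          have hx'w' := hx'.2.2 w' hw'.1.1 hxw'
          have c1 := b1 x' hx'.1.2.lt w'' hw''.1.1.lt hx' hw'' hxw'
          have c2 := b2 x'' hx''.1.2.lt w' hw'.1.1.lt hx'' hw' hx'lt
          have e1 : w'' ≤ x + d := by
            rw [← lt_add_one_iff, add_assoc]
            exact (hw''.2.1.trans hw'.2.1).trans_le hwx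
          have e2 : w' ≤ x + d := by
            rw [← lt_add_one_iff, add_assoc]
            exact hw'.2.1.trans_le hwx
          have e3 : w ≤ x'' + d := by
            refine hwx.trans ?_
            rw [add_comm d, ← add_assoc]
            gcongr
            exact (add_one_le_iff.2 hx'.2.1).trans hx''.2.1.le
          have hw'W := hw'.2.1.le.trans hwW
          have n1 := (ih x hx.lt w'' hw''.1.1.lt ⟨hx, hw''.1.1, hw''.le_of_lt hx hxw',
            hw''.2.1.le.trans hw'W, e1⟩).1
          have n2 := (ih x' hx'.1.2.lt w' hw'.1.1.lt ⟨hx'.1.2, hw'.1.1, hx'w', hw'W,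
            e2.trans (by gcongr; exact hx'.2.1.le)⟩).1
          have n3 := (ih x'' hx''.1.2.lt w hw.lt ⟨hx''.1.2, hw, hx''w, hwW, e3⟩).1
          rw [hD.step hx' hw'' hxw', hD.step hx'' hw' hx'lt]
          exact hch.bad n1 n2 n3 c1 c2
      refine ⟨?_, fun y _ v _ hy hv _ => ?_⟩
      · rw [hD.step hx' hw' hxw]
        exact hch.mem m1 m2 hbad
      · rw [← hx'.unique hy, ← hw'.unique_left hv]
        exact hbad
  obtain ⟨d, rfl⟩ := exists_add_of_le hxw
  obtain ⟨h1, h2⟩ := key d x hx.lt _ hw.lt ⟨hx, hw, hxw, hwW, le_rfl⟩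
  exact ⟨h1, fun x' w' hx' hw' => h2 x' hx'.1.2.lt w' hw'.1.1.lt hx' hw'⟩

/-- At a bad pair `ch` returns its first argument whenever that is an urelement. -/
theorem ur_stable (hD : IsTable S B F ch D) (hB : IsBarrier S B) (hF : IsBad B H L F)
    (hch : IsDescent S H L ch) (hH : H ∈ S) (hL : L ∈ S) {u W : M} (hu : Full B u W) {x w p : M}
    (hx : Elt x u) (hw : Elt w u) (hW : Elt W u) (hxw : x ≤ w) (hwW : w ≤ W)
    (hp : D (u, x, w) = pair 0 p) : D (u, x, W) = pair 0 p := by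
  have hcomp := hD.comp
  refine comp_strong_induction S (P := fun v => Elt v u → w ≤ v → v ≤ W → D (u, x, v) = pair 0 p)
    (.imp (by fun_prop) (.imp (by fun_prop) (.imp (by fun_prop) (by fun_prop))))
    (fun v ih hv hwv hvW => ?_) W hW hwW le_rfl
  rcases hwv.eq_or_lt with rfl | hwv
  · exact hp
  have hxv := hxw.trans_lt hwv
  obtain ⟨x', hx'⟩ := exists_next_right S (P := fun i => Elt i u) (by fun_prop) hx hv hxv
  obtain ⟨v', hv'⟩ := exists_next_left S (P := fun i => Elt i u) (by fun_prop) hx hv hxv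
  have e := ih v' hv'.2.1 hv'.1.1 (hv'.le_of_lt hw hwv) (hv'.2.1.le.trans hvW)
  have h1 := (hD.mem_and_bad hB hF hch hH hL hu hx hv'.1.1 (hv'.le_of_lt hx hxv)
    (hv'.2.1.le.trans hvW)).1
  have h2 := (hD.mem_and_bad hB hF hch hH hL hu hx'.1.2 hv (hx'.2.2 v hv hxv) hvW).1
  have h3 := (hD.mem_and_bad hB hF hch hH hL hu hx hv hxv.le hvW).2 x' v' hx' hv' hxv
  rw [hD.step hx' hv' hxv]
  rw [e] at h1 h3 ⊢
  exact hch.ur h1 h2 h3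

/-- As long as the value is a set, each step lowers its code by at least one and raises the count by
exactly one, so their sum does not grow. -/
theorem ur_or_le (hD : IsTable S B F ch D) (hB : IsBarrier S B) (hF : IsBad B H L F)
    (hch : IsDescent S H L ch) (hHf : IsHf S Q R H L) {cnt : M × M → M} (hcnt : IsCount S cnt)
    {u W : M} (hu : Full B u W) {x w : M}
    (hx : Elt x u) (hw : Elt w u) (hxw : x ≤ w) (hwW : w ≤ W) :
    (∃ p, D (u, x, w) = pair 0 p) ∨
      D (u, x, w) + cnt (u, w) ≤ D (u, x, x) + cnt (u, x) := by
  have hcomp := hD.comp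
  have hcntc := hcnt.comp
  have hH := hHf.carrier_mem_sets
  have hL := hHf.rel_mem_sets
  have hur : ∀ a : M, (∃ p, a = pair 0 p) ↔ ∃ p < a + 1, a = pair 0 p := by
    intro a
    constructor
    · rintro ⟨p, rfl⟩
      exact ⟨p, lt_add_one_iff.2 (right_le_pair _ _), rfl⟩
    · rintro ⟨p, -, h⟩
      exact ⟨p, h⟩
  refine comp_strong_induction S (P := fun v => Elt v u → x ≤ v → v ≤ W →
      (∃ p, D (u, x, v) = pair 0 p) ∨ D (u, x, v) + cnt (u, v) ≤ D (u, x, x) + cnt (u, x))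
    ?_ (fun v ih hv hxv hvW => ?_) w hw hxw hwW
  · simp only [hur]
    exact .imp (by fun_prop) (.imp (by fun_prop) (.imp (by fun_prop) (.or (.bex (by fun_prop)
      (by fun_prop)) (by fun_prop))))
  rcases hxv.eq_or_lt with rfl | hxv
  · exact .inr le_rfl
  obtain ⟨x', hx'⟩ := exists_next_right S (P := fun i => Elt i u) (by fun_prop) hx hv hxv
  obtain ⟨v', hv'⟩ := exists_next_left S (P := fun i => Elt i u) (by fun_prop) hx hv hxv
  have hxv' := hv'.le_of_lt hx hxv
  have hv'W := hv'.2.1.le.trans hvW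
  have h1 := (hD.mem_and_bad hB hF hch hH hL hu hx hv'.1.1 hxv' hv'W).1
  have h2 := (hD.mem_and_bad hB hF hch hH hL hu hx'.1.2 hv (hx'.2.2 v hv hxv) hvW).1
  have h3 := (hD.mem_and_bad hB hF hch hH hL hu hx hv hxv.le hvW).2 x' v' hx' hv' hxv
  rw [hD.step hx' hv' hxv]
  rcases hHf.cases h1 with ⟨p, hp⟩ | ⟨a, ha⟩
  · rw [hp] at h1 h3 ⊢
    exact .inl ⟨p, hch.ur h1 h2 h3⟩
  · rcases ih v' hv'.2.1 hv'.1.1 hxv' hv'W with ⟨p, hp⟩ | hle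
    · exact absurd (hp.symm.trans ha) pair_zero_ne_pair_one
    · right
      refine le_trans ?_ hle
      rw [hcnt.next hv', ← add_assoc, add_right_comm]
      gcongr
      rw [add_one_le_iff]
      rw [ha] at h1 h3 ⊢
      exact hch.lt h1 h2 h3

end IsTable

end Arrays

/-! ### The derived barrier -/

section Derived

set_option linter.unusedSectionVars false

variable {M : Type*} [CommSemiring M] [LinearOrder M] [DiscreteSemiring M]
variable {S : Set (Set M)} [Model S] {B Q R H L : Set M} {F : M → M} {ch cnt : M × M → M}
variable {h : M → M}

/-- The subsets of `[0, m]` have bounded codes, so `F` is bounded on those in `B`. Choosing the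
least bound makes `h` monotone, because a bound for `n` is also one for each `m ≤ n`. -/
theorem exists_height (hB : B ∈ S) (hF : Comp S F) : ∃ h : M → M, Comp S h ∧
    (∀ m n, m ≤ n → h m ≤ h n) ∧ ∀ m, ∀ r ∈ B, IsFin r → (∀ i, Elt i r → i ≤ m) → F r < h m := by
  obtain ⟨bd, hbd, hbd'⟩ := exists_code_bound S
  obtain ⟨h, hh, h1, h2⟩ := Comp.exists_least_choice (S := S)
    (P := fun (m : M) n => ∀ r < bd (m + 1) + 1, r ∈ B → IsFin r → (∀ i < r, Elt i r → i ≤ m) →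
      F r < n)
    (.ball (by fun_prop) (.imp (.mem hB (by fun_prop)) (.imp (by fun_prop) (.imp
      (.ball (by fun_prop) (.imp (by fun_prop) (by fun_prop))) (by fun_prop))))) (by
      intro m
      obtain ⟨b, hb⟩ := exists_bound hF (bd (m + 1) + 1)
      exact ⟨b, fun r hr _ _ _ => hb r hr⟩)
  have key : ∀ m, ∀ r ∈ B, IsFin r → (∀ i, Elt i r → i ≤ m) → F r < h m := by
    intro m r hr hfin hm
    exact h1 m r (lt_add_one_iff.2 (hbd' _ _ hfin fun i hi => lt_add_one_iff.2 (hm i hi))) hr hfin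
      fun i _ hi => hm i hi
  refine ⟨h, hh, fun m n hmn => h2 m _ fun r _ hr hfin hm => ?_, key⟩
  exact key n r hr hfin fun i hi => (hm i hi.lt hi).trans hmn

/-- The finite set `t` has least element `x₀` and greatest element `y`; its segment at `x₀` ends
with `y₀`, its segment at `z` ends with `y`, where `z` has exactly `h y₀` predecessors in `t`, which
also begin segments. -/
structure Derived (B : Set M) (cnt : M × M → M) (h : M → M) (t x₀ y₀ z y : M) : Prop where
  first : ∀ i, Elt i t → x₀ ≤ i
  last : ∀ i, Elt i t → i ≤ y
  seg_first : Seg B (fun i => Elt i t) x₀ y₀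
  seg_last : Seg B (fun i => Elt i t) z y
  count : cnt (t, z) = h y₀
  full : IsTable.Full B t z

/-- The finite sets that admit a decomposition as in `Derived`. -/
def derived (B : Set M) (cnt : M × M → M) (h : M → M) : Set M :=
  {t | IsFin t ∧ ∃ x₀ y₀ z y, Derived B cnt h t x₀ y₀ z y}

theorem comp_derived (hB : B ∈ S) (hcnt : Comp S cnt) (hh : Comp S h) :
    Comp S (fun p : M × M × M × M × M => Derived B cnt h p.1 p.2.1 p.2.2.1 p.2.2.2.1 p.2.2.2.2) := by
  have : Comp S (fun p : M × M × M × M × M => (∀ i < p.1, Elt i p.1 → p.2.1 ≤ i) ∧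
      (∀ i < p.1, Elt i p.1 → i ≤ p.2.2.2.2) ∧ Seg B (fun i => Elt i p.1) p.2.1 p.2.2.1 ∧
      Seg B (fun i => Elt i p.1) p.2.2.2.1 p.2.2.2.2 ∧ cnt (p.1, p.2.2.2.1) = h p.2.2.1 ∧
      ∀ i < p.1, Elt i p.1 → i ≤ p.2.2.2.1 → ∃ y < p.1, Seg B (fun i => Elt i p.1) i y) :=
    .and (.ball (by fun_prop) (.imp (by fun_prop) (by fun_prop))) (.and
      (.ball (by fun_prop) (.imp (by fun_prop) (by fun_prop))) (.and
      (.seg hB (by fun_prop) (by fun_prop) (by fun_prop)) (.and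
      (.seg hB (by fun_prop) (by fun_prop) (by fun_prop)) (.and (by fun_prop)
      (.ball (by fun_prop) (.imp (by fun_prop) (.imp (by fun_prop) (.bex (by fun_prop)
        (.seg hB (by fun_prop) (by fun_prop) (by fun_prop))))))))))
  convert this using 2 with p
  constructor
  · intro hd
    refine ⟨fun i _ => hd.first i, fun i _ => hd.last i, hd.seg_first, hd.seg_last, hd.count,
      fun i _ hi hiz => ?_⟩
    obtain ⟨y, hy⟩ := hd.full i hi hiz
    exact ⟨y, hy.2.1.lt, hy⟩
  · rintro ⟨h1, h2, h3, h4, h5, h6⟩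
    refine ⟨fun i hi => h1 i hi.lt hi, fun i hi => h2 i hi.lt hi, h3, h4, h5, fun i hi hiz => ?_⟩
    obtain ⟨y, -, hy⟩ := h6 i hi.lt hi hiz
    exact ⟨y, hy⟩

theorem derived_mem_sets (hB : B ∈ S) (hcnt : Comp S cnt) (hh : Comp S h) :
    derived B cnt h ∈ S := by
  have hc := comp_derived hB hcnt hh
  have : Comp S (fun t => IsFin t ∧ ∃ x₀ < t, ∃ y₀ < t, ∃ z < t, ∃ y < t,
      Derived B cnt h t x₀ y₀ z y) :=
    .and (by fun_prop) (.bex (by fun_prop) (.bex (by fun_prop) (.bex (by fun_prop) (.bex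
      (by fun_prop) (hc.comp (f := fun p : (((M × M) × M) × M) × M =>
        (p.1.1.1.1, p.1.1.1.2, p.1.1.2, p.1.2, p.2)) (by fun_prop))))))
  refine mem_of_ext this.mem_sets fun t => and_congr_right fun _ => ?_
  constructor
  · rintro ⟨x₀, y₀, z, y, hd⟩
    exact ⟨x₀, hd.seg_first.1.lt, y₀, hd.seg_first.2.1.lt, z, hd.seg_last.1.lt, y,
      hd.seg_last.2.1.lt, hd⟩
  · rintro ⟨x₀, -, y₀, -, z, -, y, -, hd⟩
    exact ⟨x₀, y₀, z, y, hd⟩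

/-- Both last segments end with the greatest element of `t`, so one contains the other and they
coincide. -/
theorem Derived.unique (hB : IsBarrier S B) {t x₀ y₀ z y x₀' y₀' z' y' : M}
    (hd : Derived B cnt h t x₀ y₀ z y) (hd' : Derived B cnt h t x₀' y₀' z' y') :
    x₀ = x₀' ∧ z = z' := by
  refine ⟨(hd.first _ hd'.seg_first.1).antisymm (hd'.first _ hd.seg_first.1), ?_⟩
  have hP : Comp S (fun i => Elt i t) := by fun_prop
  rcases le_total z z' with hz | hz
  · exact ((hd.seg_last.mono hB hP hP (fun _ _ _ hi => hi) hd'.seg_last hz).2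
      (hd.last _ hd'.seg_last.2.1)).1
  · exact ((hd'.seg_last.mono hB hP hP (fun _ _ _ hi => hi) hd.seg_last hz).2
      (hd'.last _ hd.seg_last.2.1)).1.symm

theorem Derived.subset_base (S : Set (Set M)) [Model S] {t x₀ y₀ z y : M}
    (hd : Derived B cnt h t x₀ y₀ z y) {i : M} (hi : Elt i t) : i ∈ base B := by
  have key : ∀ {a b}, Seg B (fun i => Elt i t) a b → a ≤ i → i ≤ b → i ∈ base B :=
    fun hs ha hb => ⟨_, hs.2.2.2, (elt_icc (S := S) (by fun_prop)).2 ⟨hi, ha, hb⟩⟩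
  rcases le_total i z with hiz | hiz
  · obtain ⟨b, hb⟩ := hd.full i hi hiz
    exact key hb le_rfl hb.2.2.1
  · exact key hd.seg_last hiz (hd.last i hi)

/-- Thinning out a set can only delay the end of its first segment, so `y₀ ≤ y₀'`, and by
monotonicity of `h` the smaller set needs at least as many elements before `z'`. This forces `z ≤
z'`. The last segment of `t'` is then contained in that of `t`, hence equal to it, and with `z = z'`
the counts show that nothing is missing below `z`. -/
theorem Derived.eq_of_subset (hB : IsBarrier S B) (hcnt : IsCount S cnt)
    (hh : ∀ m n, m ≤ n → h m ≤ h n) {t x₀ y₀ z y t' x₀' y₀' z' y' : M}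
    (hd : Derived B cnt h t x₀ y₀ z y) (hd' : Derived B cnt h t' x₀' y₀' z' y')
    (hsub : ∀ i, Elt i t' → Elt i t) : ∀ i, Elt i t' ↔ Elt i t := by
  have hP : Comp S (fun i => Elt i t) := by fun_prop
  have hP' : Comp S (fun i => Elt i t') := by fun_prop
  have h1 : y₀ ≤ y₀' := (hd.seg_first.mono hB hP hP' (fun i _ _ => hsub i) hd'.seg_first
    (hd.first _ (hsub _ hd'.seg_first.1))).1
  have h2 : cnt (t, z) ≤ cnt (t', z') := by
    rw [hd.count, hd'.count]
    exact hh _ _ h1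
  have h3 : z ≤ z' := by
    by_contra hlt
    have := hcnt.lt_of_lt (not_le.1 hlt) (hsub _ hd'.seg_last.1)
    exact (this.trans_le h2).not_ge (hcnt.mono_set fun i _ => hsub i).1
  obtain ⟨rfl, h4⟩ := (hd.seg_last.mono hB hP hP' (fun i _ _ => hsub i) hd'.seg_last h3).2
    (hd.last _ (hsub _ hd'.seg_last.2.1))
  have h5 := hcnt.mono_set (z := z) (t := t') (u := t) fun i _ => hsub i
  refine fun i => ⟨hsub i, fun hi => ?_⟩
  rcases lt_or_ge i z with hiz | hiz
  · exact h5.2 (h5.1.antisymm h2) i hiz hi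
  · exact h4 i hiz (hd.last i hi) hi

/-- The element of `X` with `h y₀` predecessors is reached by `Σ⁰₁` induction, passing to successors
in `X`; the set is cut off at the end of the segment there. -/
theorem exists_initSeg_derived (hB : IsBarrier S B) (hcnt : IsCount S cnt) {X : Set M}
    (hX : X ∈ S) (hinf : IsInf X) (hsub : X ⊆ base B) :
    ∃ t ∈ derived B cnt h, InitSeg t X ∧ ∃ i, Elt i t := by
  have hP : Comp S (fun i => i ∈ X) := .mem hX (by fun_prop)
  have hcntc := hcnt.comp
  obtain ⟨x₀, hx₀, hmin⟩ := exists_least S hP ⟨_, (hinf 0).choose_spec.1⟩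
  have hmin' : ∀ i ∈ X, x₀ ≤ i := fun i hi => not_lt.1 fun hlt => hmin i hlt hi
  have hseg : ∀ {x}, x ∈ X → ∃ y, Seg B (fun i => i ∈ X) x y :=
    fun hx => hB.exists_seg hP hinf hsub hx
  obtain ⟨y₀, hy₀⟩ := hseg hx₀
  have hicc : ∀ {z i}, Elt i (icc (fun i => i ∈ X) 0 z) ↔ i ∈ X ∧ i ≤ z := by
    intro z i
    rw [elt_icc hP]
    simp
  obtain ⟨z, hz, hzc⟩ : ∃ z, z ∈ X ∧ cnt (icc (fun i => i ∈ X) 0 z, z) = h y₀ := by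
    refine sigma_induction (S := S)
      (P := fun n z => z ∈ X ∧ cnt (icc (fun i => i ∈ X) 0 z, z) = n) (.and
      (.mem hX (by fun_prop)) (.eq (hcntc.comp (.prodMk (.icc (.mem hX (by fun_prop)) (by fun_prop)
      (by fun_prop)) (by fun_prop))) (by fun_prop))) ⟨x₀, hx₀, hcnt.eq_zero ?_⟩ ?_ (h y₀)
    · intro i hi hi'
      exact hmin i hi (hicc.1 hi').1
    · rintro n z ⟨hz, hzn⟩
      obtain ⟨w, hw, hzw⟩ := hinf z
      obtain ⟨z', hz'⟩ := exists_next_right S hP hz hw hzw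
      refine ⟨z', hz'.1.2, ?_⟩
      rw [hcnt.next (z := z), ← hzn]
      · congr 1
        refine hcnt.congr fun i hi => ?_
        rw [hicc, hicc]
        simp [hi.le, (hi.trans hz'.2.1).le]
      · exact ⟨⟨hicc.2 ⟨hz, hz'.2.1.le⟩, hicc.2 ⟨hz'.1.2, le_rfl⟩⟩, hz'.2.1,
          fun i hi hzi => hz'.2.2 i (hicc.1 hi).1 hzi⟩
  obtain ⟨y, hy⟩ := hseg hz
  have helt : ∀ {i}, Elt i (icc (fun i => i ∈ X) 0 y) ↔ i ∈ X ∧ i ≤ y := hicc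
  have hcongr : ∀ {a b}, Seg B (fun i => i ∈ X) a b → b ≤ y →
      Seg B (fun i => Elt i (icc (fun i => i ∈ X) 0 y)) a b := by
    intro a b hab hb
    refine hab.congr fun i _ hi => ?_
    rw [helt]
    simp [hi.trans hb]
  refine ⟨icc (fun i => i ∈ X) 0 y, ⟨isFin_icc hP _ _, x₀, y₀, z, y, ?_⟩, ⟨?_, ?_⟩, y,
    helt.2 ⟨hy.2.1, le_rfl⟩⟩
  · refine ⟨fun i hi => hmin' i (helt.1 hi).1, fun i hi => (helt.1 hi).2,
      hcongr hy₀ (hy₀.le_of_le hB hP hy (hmin' z hz)), hcongr hy le_rfl, ?_, fun i hi hiz => ?_⟩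
    · rw [← hzc]
      refine hcnt.congr fun i hi => ?_
      rw [hicc, hicc]
      simp [hi.le, hi.le.trans hy.2.2.1]
    · obtain ⟨b, hb⟩ := hseg (helt.1 hi).1
      exact ⟨b, hcongr hb (hb.le_of_le hB hP hy hiz)⟩
  · exact fun i hi => (helt.1 hi).1
  · intro i j hj hi hij
    exact helt.2 ⟨hi, hij.le.trans (helt.1 hj).2⟩

/-- The base is defined by an unbounded quantifier and need not exist in the model, so an infinite
part of it is enumerated in increasing order. -/
theorem IsBarrier.exists_infinite_subset (hB : IsBarrier S B) :
    ∃ X ∈ S, IsInf X ∧ X ⊆ base B := by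
  have hBS := hB.mem_sets
  obtain ⟨s, hs, hs'⟩ := Comp.exists_choice (S := S)
    (P := fun (n : M) s => s ∈ B ∧ ∃ x < s, Elt x s ∧ n < x)
    (.and (.mem hBS (by fun_prop)) (.bex (by fun_prop) (by fun_prop))) (by
      intro n
      obtain ⟨x, ⟨s, hs, hx⟩, hn⟩ := hB.inf_base n
      exact ⟨s, hs, x, hx.lt, hx, hn⟩)
  obtain ⟨k, hk, hk'⟩ := Comp.exists_choice (S := S)
    (P := fun (n : M) x => Elt x (s n) ∧ n < x) (by fun_prop) (by
      intro n
      obtain ⟨-, x, -, hx⟩ := hs' n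
      exact ⟨x, hx⟩)
  obtain ⟨f, hf, h0, h1⟩ := exists_primrec (S := S) hk (h := fun p : M × M × M => k p.2.2)
    (by fun_prop)
  -- This makes the range of the enumeration decidable: an element `x` can only occur at an index up
  -- to `x`.
  have hle : ∀ n, n ≤ f (0, n) := by
    refine comp_induction S (by fun_prop) zero_le fun n hn => ?_
    rw [h1, add_one_le_iff]
    exact hn.trans_lt (hk' _).2
  have hX : Comp S (fun x : M => ∃ n < x + 1, f (0, n) = x) := .bex (by fun_prop) (by fun_prop)
  refine ⟨_, hX.mem_sets, fun n => ?_, ?_⟩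
  · exact ⟨f (0, n + 1), ⟨n + 1, lt_add_one_iff.2 (hle _), rfl⟩, add_one_le_iff.1 (hle _)⟩
  · rintro x ⟨n, -, rfl⟩
    have hbase : ∀ m, k m ∈ base B := fun m => ⟨s m, (hs' m).1, (hk' m).1⟩
    rcases eq_or_ne n 0 with rfl | hn
    · rw [h0]
      exact hbase 0
    · obtain ⟨m, rfl⟩ := exists_add_of_le (add_one_le_iff.2 (pos_iff_ne_zero.2 hn))
      rw [zero_add, add_comm, h1]
      exact hbase _

theorem isBarrier_derived (hB : IsBarrier S B) (hcnt : IsCount S cnt) (hhc : Comp S h)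
    (hh : ∀ m n, m ≤ n → h m ≤ h n) : IsBarrier S (derived B cnt h) where
  mem_sets := derived_mem_sets hB.mem_sets hcnt.comp hhc
  isFin _ ht := ht.1
  inf_base n := by
    obtain ⟨X, hX, hinf, hsub⟩ := hB.exists_infinite_subset
    obtain ⟨t, ht, hi, x, hx⟩ := exists_initSeg_derived (h := h) hB hcnt (X := {x | x ∈ X ∧ n < x})
      (Comp.mem_sets (.and (.mem hX (by fun_prop)) (by fun_prop))) (fun m => by
        obtain ⟨x, hx, hmn⟩ := hinf (m + n)
        exact ⟨x, ⟨hx, lt_of_le_of_lt le_add_self hmn⟩, lt_of_le_of_lt le_self_add hmn⟩)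
      (fun x hx => hsub hx.1)
    exact ⟨x, ⟨t, ht, hx⟩, (hi.1 x hx).2⟩
  initSeg X hX hinf hsub := by
    obtain ⟨t, ht, hi, -⟩ := exists_initSeg_derived (h := h) hB hcnt hX hinf (fun x hx => by
      obtain ⟨t, ⟨-, x₀, y₀, z, y, hd⟩, hxt⟩ := hsub hx
      exact hd.subset_base S hxt)
    exact ⟨t, ht, hi⟩
  antichain := by
    rintro s ⟨hs, x₀, y₀, z, y, hd⟩ t ⟨ht, x₀', y₀', z', y', hd'⟩ hst
    exact hs.ext ht (hd'.eq_of_subset hB hcnt hh hd hst)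

end Derived

/-! ### The derived array and its badness -/

section Main

set_option linter.unusedSectionVars false

variable {M : Type*} [CommSemiring M] [LinearOrder M] [DiscreteSemiring M]
variable {S : Set (Set M)} [Model S] {B Q R H L : Set M} {F : M → M} {ch cnt : M × M → M}
variable {h : M → M} {D : M × M × M → M}

/-- If no urelement were reached by `z`, the code of the first value, which is less than `h y₀`,
would have dropped `h y₀` times. -/
theorem Derived.exists_ur (hB : IsBarrier S B) (hD : IsTable S B F ch D) (hF : IsBad B H L F)
    (hch : IsDescent S H L ch) (hHf : IsHf S Q R H L) (hcnt : IsCount S cnt)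
    (hh : ∀ m, ∀ r ∈ B, IsFin r → (∀ i, Elt i r → i ≤ m) → F r < h m) {t x₀ y₀ z y : M}
    (hd : Derived B cnt h t x₀ y₀ z y) : ∃ q ∈ Q, D (t, x₀, z) = pair 0 q := by
  have hmem := (hD.mem_and_bad hB hF hch hHf.carrier_mem_sets hHf.rel_mem_sets hd.full
    hd.seg_first.1 hd.seg_last.1 (hd.first _ hd.seg_last.1) le_rfl).1
  rcases hD.ur_or_le hB hF hch hHf hcnt hd.full hd.seg_first.1 hd.seg_last.1
    (hd.first _ hd.seg_last.1) le_rfl with ⟨p, hp⟩ | hle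
  · rw [hp, hHf.ur_mem] at hmem
    exact ⟨p, hmem, hp⟩
  · exfalso
    rw [hd.count, hD.base hd.seg_first, hcnt.eq_zero fun i hi hi' => (hd.first i hi').not_gt hi,
      add_zero] at hle
    refine absurd (le_add_self.trans hle) (not_le.2 (hh _ _ hd.seg_first.2.2.2
      (hB.isFin _ hd.seg_first.2.2.2) fun i hi => ?_))
    exact ((elt_icc (S := S) (by fun_prop)).1 hi).2.2

/-- For `t ◁ t'` inside `u`, the predicate `P` will be `u` in the case of `t`, and `u` without its
least element in the case of `t'`. -/
theorem Derived.agree_of_initSeg {t u x₀ y₀ z y : M} {P : M → Prop}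
    (hd : Derived B cnt h t x₀ y₀ z y) (hP : ∀ i, P i → Elt i u) (ht : InitSeg t {i | P i})
    (hPu : ∀ i, x₀ ≤ i → Elt i u → P i) (i : M) (h1 : x₀ ≤ i) (h2 : i ≤ y) :
    Elt i t ↔ Elt i u := by
  refine ⟨fun hi => hP i (ht.1 i hi), fun hi => ?_⟩
  rcases h2.eq_or_lt with rfl | h2
  · exact hd.seg_last.2.1
  · exact ht.2 i y hd.seg_last.2.1 (hPu i h1 hi) h2

/-- Both values can be computed in the common set `u` and do not change up to the maximum of `z` and
`z'`. In the same table, badness of neighbouring entries then separates `p` from `q`. -/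
theorem not_rel_of_tri (hB : IsBarrier S B) (hD : IsTable S B F ch D) (hF : IsBad B H L F)
    (hch : IsDescent S H L ch) (hHf : IsHf S Q R H L)
    {t x₀ y₀ z y t' x₁ y₁ z' y' p q : M}
    (hd : Derived B cnt h t x₀ y₀ z y) (hd' : Derived B cnt h t' x₁ y₁ z' y')
    (hp : D (t, x₀, z) = pair 0 p) (hq : D (t', x₁, z') = pair 0 q) (htri : Tri t t') :
    pair p q ∉ R := by
  have hH := hHf.carrier_mem_sets
  have hL := hHf.rel_mem_sets
  obtain ⟨u, m, -, hm, hmin, ht, ht'⟩ := htri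
  have hx₀u : Elt x₀ u := ht.1 _ hd.seg_first.1
  obtain rfl : x₀ = m := by
    rcases hmin x₀ hx₀u with h | h
    · exact h
    · exact (hd.first m (ht.2 m x₀ hd.seg_first.1 hm h)).antisymm h.le
  have hx₁u := ht'.1 _ hd'.seg_first.1
  have hlt : x₀ < x₁ := (hmin x₁ hx₁u.1).resolve_left hx₁u.2
  have hnext : Next (fun i => Elt i u) x₀ x₁ := by
    refine ⟨⟨hx₀u, hx₁u.1⟩, hlt, fun i hi hxi => ?_⟩
    by_contra hlt'
    exact hlt' (hd'.first i (ht'.2 i x₁ hd'.seg_first.1 ⟨hi, hxi.ne'⟩ (not_le.1 hlt')))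
  have hle : ∀ i, Elt i u → x₀ ≤ i := fun i hi => (hmin i hi).elim (fun h => h.ge) fun h => h.le
  have agree : ∀ i, x₀ ≤ i → i ≤ y → (Elt i t ↔ Elt i u) :=
    hd.agree_of_initSeg (P := fun i => Elt i u) (fun i hi => hi) ht fun i _ hi => hi
  have agree' : ∀ i, x₁ ≤ i → i ≤ y' → (Elt i t' ↔ Elt i u) :=
    hd'.agree_of_initSeg (P := fun i => Elt i u ∧ i ≠ x₀) (fun i hi => hi.1) ht'
      fun i h1 hi => ⟨hi, (hlt.trans_le h1).ne'⟩
  have hsegs : ∀ i, Elt i t → x₀ ≤ i → i ≤ z → ∃ b ≤ y, Seg B (fun i => Elt i t) i b := by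
    intro i hi _ hiz
    obtain ⟨b, hb⟩ := hd.full i hi hiz
    exact ⟨b, hd.last b hb.2.1, hb⟩
  have hsegs' : ∀ i, Elt i t' → x₁ ≤ i → i ≤ z' → ∃ b ≤ y', Seg B (fun i => Elt i t') i b := by
    intro i hi _ hiz
    obtain ⟨b, hb⟩ := hd'.full i hi hiz
    exact ⟨b, hd'.last b hb.2.1, hb⟩
  have hx₀z := hd.first _ hd.seg_last.1
  have hx₁z' := hd'.first _ hd'.seg_last.1
  rw [hD.congr agree hsegs hd.seg_first.1 hd.seg_last.1 le_rfl hx₀z le_rfl] at hp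
  rw [hD.congr agree' hsegs' hd'.seg_first.1 hd'.seg_last.1 le_rfl hx₁z' le_rfl] at hq
  have hz : Elt z u := ht.1 _ hd.seg_last.1
  have hz' : Elt z' u := (ht'.1 _ hd'.seg_last.1).1
  -- Segments beginning up to `z` are found in `t`, later ones in `t'`.
  have hfull : IsTable.Full B u (max z z') := by
    intro i hi hiW
    rcases le_or_gt i z with hiz | hiz
    · obtain ⟨b, hby, hb⟩ := hsegs i ((agree i (hle i hi) (hiz.trans hd.seg_last.2.2.1)).2 hi)
        (hle i hi) hiz
      exact ⟨b, hb.congr fun j h1 h2 => agree j ((hle i hi).trans h1) (h2.trans hby)⟩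
    · have hiz' : i ≤ z' := (le_max_iff.1 hiW).resolve_left (not_le.2 hiz)
      have hxi : x₁ ≤ i := hnext.2.2 i hi (hx₀z.trans_lt hiz)
      obtain ⟨b, hby, hb⟩ := hsegs' i ((agree' i hxi (hiz'.trans hd'.seg_last.2.2.1)).2 hi) hxi hiz'
      exact ⟨b, hb.congr fun j h1 h2 => agree' j (hxi.trans h1) (h2.trans hby)⟩
  have hW : Elt (max z z') u := by
    rcases max_choice z z' with h | h <;> rw [h]
    exacts [hz, hz']
  have hp' := hD.ur_stable hB hF hch hH hL hfull hx₀u hz hW hx₀z (le_max_left _ _) hp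
  have hq' := hD.ur_stable hB hF hch hH hL hfull hx₁u.1 hz' hW hx₁z' (le_max_right _ _) hq
  have hx₁W : x₁ ≤ max z z' := hx₁z'.trans (le_max_right _ _)
  have hx₀W : x₀ < max z z' := hlt.trans_le hx₁W
  obtain ⟨w, hw⟩ := exists_next_left S (P := fun i => Elt i u) (by fun_prop) hx₀u hW hx₀W
  have h1 := (hD.mem_and_bad hB hF hch hH hL hfull hx₀u hw.1.1 (hw.le_of_lt hx₀u hx₀W)
    hw.2.1.le).1
  have h2 := (hD.mem_and_bad hB hF hch hH hL hfull hx₁u.1 hW hx₁W le_rfl).1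
  obtain ⟨h3, h4⟩ := hD.mem_and_bad hB hF hch hH hL hfull hx₀u hW hx₀W.le le_rfl
  have h4 := h4 x₁ w hnext hw hx₀W
  rw [hp'] at h3
  rw [hq'] at h2 h4
  -- The value `⟨0, p⟩` is itself the result of a last step against `⟨0, q⟩`, and `ch` chooses
  -- something not below an urelement.
  rw [← hHf.ur_ur p q h3 h2, ← hp', hD.step hnext hw hx₀W, hq']
  exact hch.bad_ur h1 h2 h4

theorem IsBQO.isHf (hHf : IsHf S Q R H L) (hQ : IsBQO S Q R) : IsBQO S H L := by
  refine ⟨hHf.isQuasiOrder hQ.1, fun B hB f hf hfun => ?_⟩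
  by_contra hgood
  have hBS := hB.mem_sets
  obtain ⟨F, hF, hF'⟩ := Comp.exists_choice (S := S) (P := fun s v => s ∈ B → pair s v ∈ f)
    (.imp (.mem hBS (by fun_prop)) (.mem hf (by fun_prop))) (by
      intro s
      by_cases hs : s ∈ B
      · obtain ⟨v, hv, -⟩ := hfun.2 s hs
        exact ⟨v, fun _ => hv⟩
      · exact ⟨0, fun h => absurd h hs⟩)
  have hbad : IsBad B H L F := by
    refine ⟨fun s hs => ?_, fun s hs t ht hst hrel => ?_⟩
    · obtain ⟨s', -, q, hq, h⟩ := hfun.1 _ (hF' s hs)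
      rwa [(pair_inj.1 h).2]
    · exact hgood ⟨s, hs, t, ht, _, _, hst, hF' s hs, hF' t ht, hrel⟩
  obtain ⟨ch, hch⟩ := hHf.exists_isDescent
  obtain ⟨D, hD⟩ := exists_isTable hB hF hch.comp
  obtain ⟨cnt, hcnt⟩ := exists_isCount S
  obtain ⟨h, hhc, hmono, hh⟩ := exists_height hBS hF
  have hB' := isBarrier_derived (h := h) hB hcnt hhc hmono
  -- The data of a decomposition are elements of `t`, hence below `t`; with bounded quantifiers the
  -- new array exists in the model.
  let P : M → M → Prop := fun t q => ∃ x₀ < t, ∃ y₀ < t, ∃ z < t, ∃ y < t,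
    Derived B cnt h t x₀ y₀ z y ∧ D (t, x₀, z) = pair 0 q
  have hP : ∀ {t q}, P t q ↔ ∃ x₀ y₀ z y, Derived B cnt h t x₀ y₀ z y ∧
      D (t, x₀, z) = pair 0 q := by
    intro t q
    constructor
    · rintro ⟨x₀, -, y₀, -, z, -, y, -, h⟩
      exact ⟨x₀, y₀, z, y, h⟩
    · rintro ⟨x₀, y₀, z, y, hd, hq⟩
      exact ⟨x₀, hd.seg_first.1.lt, y₀, hd.seg_first.2.1.lt, z, hd.seg_last.1.lt, y,
        hd.seg_last.2.1.lt, hd, hq⟩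
  have hDc := hD.comp
  have hPc : Comp S (fun p : M × M => P p.1 p.2) :=
    .bex (by fun_prop) (.bex (by fun_prop) (.bex (by fun_prop) (.bex (by fun_prop)
      (.and ((comp_derived hBS hcnt.comp hhc).comp (f := fun p : ((((M × M) × M) × M) × M) × M =>
        (p.1.1.1.1.1, p.1.1.1.2, p.1.1.2, p.1.2, p.2)) (by fun_prop)) (by fun_prop)))))
  let g : Set M := {n | ∃ t < n + 1, ∃ q < n + 1, n = pair t q ∧ t ∈ derived B cnt h ∧ P t q}
  have hg : g ∈ S := Comp.mem_sets (.bex (by fun_prop) (.bex (by fun_prop) (.and (by fun_prop)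
    (.and (.mem hB'.mem_sets (by fun_prop)) (hPc.comp (f := fun p : (M × M) × M => (p.1.2, p.2))
      (by fun_prop))))))
  have hgmem : ∀ {t q}, pair t q ∈ g ↔ t ∈ derived B cnt h ∧ P t q := by
    intro t q
    constructor
    · rintro ⟨t', -, q', -, h, h'⟩
      obtain ⟨rfl, rfl⟩ := pair_inj.1 h
      exact h'
    · exact fun h => ⟨t, lt_add_one_iff.2 (left_le_pair _ _), q,
        lt_add_one_iff.2 (right_le_pair _ _), rfl, h⟩
  -- As `x₀` and `z` are determined by `t`, the value does not depend on the decomposition.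
  have hval : ∀ {t x₀ y₀ z y q}, Derived B cnt h t x₀ y₀ z y → P t q → D (t, x₀, z) = pair 0 q := by
    intro t x₀ y₀ z y q hd hPq
    obtain ⟨x₀', y₀', z', y', hd', hq⟩ := hP.1 hPq
    obtain ⟨rfl, rfl⟩ := hd.unique hB hd'
    exact hq
  obtain ⟨t, ⟨-, x₀, y₀, z, y, hd⟩, t', ⟨-, x₁, y₁, z', y', hd'⟩, p, q, htri, hp, hq, hpq⟩ :=
    hQ.2 _ hB' g hg (by
      constructor
      · rintro n ⟨t, -, q, -, rfl, ht, hPq⟩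
        obtain ⟨x₀, y₀, z, y, hd, hq⟩ := hP.1 hPq
        obtain ⟨q', hq', h⟩ := hd.exists_ur hB hD hbad hch hHf hcnt hh
        rw [hq] at h
        rw [← (pair_inj.1 h).2] at hq'
        exact ⟨t, ht, q, hq', rfl⟩
      · rintro t ⟨ht, x₀, y₀, z, y, hd⟩
        obtain ⟨q, -, hq⟩ := hd.exists_ur hB hD hbad hch hHf hcnt hh
        refine ⟨q, hgmem.2 ⟨⟨ht, x₀, y₀, z, y, hd⟩, hP.2 ⟨x₀, y₀, z, y, hd, hq⟩⟩, fun q' hq' => ?_⟩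
        exact (pair_inj.1 ((hval hd (hgmem.1 hq').2).symm.trans hq)).2)
  exact not_rel_of_tri hB hD hbad hch hHf hd hd' (hval hd (hgmem.1 hp).2)
    (hval hd' (hgmem.1 hq).2) htri hpq

end Main

end RM

theorem mainTheorem4 {M : Type*} [Zero M] [One M] [Add M] [Mul M] [LT M] (S : Set (Set M))
    (hM : RM.IsModelRCA0 M S) (Q R : Set M) (hQ : RM.IsQuasiOrder S Q R) :
    (∃ H L : Set M, RM.IsHf S Q R H L) ∧
      ∀ H L : Set M, RM.IsHf S Q R H L → RM.IsBQO S Q R → RM.IsBQO S H L := by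
  -- The operations and the strict order of these structures are definitionally the given ones, so
  -- the notions of the statement keep their meaning.
  let i₁ := hM.commSemiring
  let i₂ := hM.linearOrder
  have i₃ : RM.DiscreteSemiring M := hM.discreteSemiring
  have i₄ : RM.Model S := ⟨hM⟩
  exact ⟨RM.exists_isHf hQ, fun H L hHf hQ' => RM.IsBQO.isHf hHf hQ'⟩
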